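/- Let $(B,g)$ be a pseudo-Riemannian manifold with Levi-Civita connection $\nabla$, let $\sigma=\pm1$, and let $\pi:P\to B$ be a principal $S^1$-bundle with an $i\mathbb R$-valued connection form $A$. Let $v$ be the fundamental vector field on $P$, so $T\pi(v)=0$ and $A(v)=i$; let $\hat X$ denote the horizontal lift of a vector field $X$ on $B$, so $A(\hat X)=0$ and $T\pi(\hat X)=X$; and let $\Omega(X,Y)=-A([\hat X,\hat Y])$ be the curvature form. Let $D$ be the Levi-Civita connection of the Kaluza--Klein metric $\tilde g=\pi^*g+\sigma A\otimes A$ on $P$, with curvature $R(U,V)W=D_UD_VW-D_VD_UW-D_{[U,V]}W$, and let $\phi$ be the section of $\operatorname{End}(TB)$ with $g(\phi X,Y)=\sigma\frac i2\Omega(X,Y)$. Let $\xi$ be a vector field on $B$ with $g(\xi,\xi)=\sigma$, and put $\eta=g(\xi,\cdot)$. Suppose that one of the following holds: (i) there are $f,h\in C^\infty(P)$ such that $\tilde R=f\hat\xi+hv$ is a (nowhere vanishing) light-like recurrent vector field, i.e. $\tilde g(\tilde R,\tilde R)=0$ and $D\tilde R=\omega\otimes\tilde R$ for some $1$-form $\omega$;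 in this case let $\varepsilon=\operatorname{sign}(fh)$; (ii) $\xi$ is a Killing field and $A=A_0+i\sigma\varepsilon\,\pi^*\eta$ for a flat connection form $A_0$ and a constant $\varepsilon=\pm1$. Put $r=\hat\xi+\varepsilon v$ and $\tilde r=\hat\xi-\varepsilon v$. Let $\mathcal D=\xi^\perp$, let $p:TB\to\mathcal D$ be the orthogonal projection, and let $\nabla^{\mathcal D}$ be the connection on $\mathcal D$ with $\nabla^{\mathcal D}_\xi Y=p([\xi,Y])$ and $\nabla^{\mathcal D}_XY=p(\nabla_XY)$ for $X\perp\xi$. Let $R^{\mathcal D}$ be its curvature and $(\nabla^{\mathcal D}_X\phi)Y=\nabla^{\mathcal D}_X(\phi Y)-\phi(\nabla^{\mathcal D}_XY)$. Then for all sections $X,Y,Z$ of $\mathcal D$: $$\begin{aligned} R(\cdot,\cdot)r&=0,\\ R(r,\hat X)\hat Y&=\widehat{R^{\mathcal D}(\xi,X)Y},\\ R(r,\hat X)\tilde r&=0,\\ R(\hat X,\hat Y)\hat Z&=\widehat{R^{\mathcal D}(X,Y)Z}+\sigma\varepsilon\, g\big((\nabla^{\mathcal D}_X\phi)Y-(\nabla^{\mathcal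 D}_Y\phi)X,Z\big)\,r,\\ R(\hat X,\hat Y)\tilde r&=-2\varepsilon\,\big((\nabla^{\mathcal D}_X\phi)Y-(\nabla^{\mathcal D}_Y\phi)X\big)^{\wedge},\\ R(r,v)&=0,\\ R(\hat X,v)\hat Y&=\widehat{(\nabla^{\mathcal D}_X\phi)Y}+\varepsilon\sigma\, g(\phi X,\phi Y)\,r,\\ R(\hat X,v)\tilde r&=2\varepsilon\,\widehat{\phi^2X}. \end{aligned}$$ -/

import Mathlib

open Bundle VectorField
open scoped Manifold ContDiff Topology

noncomputable section

namespace KaluzaKlein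

/-! ### Pseudo-Riemannian metrics, Levi-Civita connections, curvature -/

section Metric

variable {E : Type*} [NormedAddCommGroup E] [NormedSpace ℝ E]
  {M : Type*} [TopologicalSpace M] [ChartedSpace E M] [IsManifold 𝓘(ℝ, E) ∞ M]

/-- A smooth pseudo-Riemannian metric on `M`: a smooth field of symmetric non-degenerate bilinear
forms on the tangent spaces, of arbitrary signature. -/
structure PseudoRiemannianMetric (E : Type*) [NormedAddCommGroup E] [NormedSpace ℝ E]
    (M : Type*) [TopologicalSpace M] [ChartedSpace E M] [IsManifold 𝓘(ℝ, E) ∞ M] where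
  /-- The bilinear form at each point. -/
  val (x : M) : TangentSpace 𝓘(ℝ, E) x →L[ℝ] TangentSpace 𝓘(ℝ, E) x →L[ℝ] ℝ
  symm (x : M) (u w : TangentSpace 𝓘(ℝ, E) x) : val x u w = val x w u
  nondegenerate (x : M) (u : TangentSpace 𝓘(ℝ, E) x) (hu : ∀ w, val x u w = 0) : u = 0
  contMDiff : ContMDiff 𝓘(ℝ, E) (𝓘(ℝ, E).prod 𝓘(ℝ, E →L[ℝ] E →L[ℝ] ℝ)) ∞
    (fun x ↦ TotalSpace.mk' (E →L[ℝ] E →L[ℝ] ℝ)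
      (E := fun x : M ↦ TangentSpace 𝓘(ℝ, E) x →L[ℝ] TangentSpace 𝓘(ℝ, E) x →L[ℝ] ℝ) x (val x))

/-- `D` is the Levi-Civita connection of the field `g` of bilinear forms on the tangent spaces: it
is smooth, torsion-free, `D_X Y - D_Y X = [X, Y]`, and metric,
`w (g(Y, Z)) = g(D_w Y, Z) + g(Y, D_w Z)`.
In Mathlib's notation `D Y x w` is the derivative `D_w Y` at the point `x`. -/
structure IsLeviCivita (g : ∀ x : M, TangentSpace 𝓘(ℝ, E) x → TangentSpace 𝓘(ℝ, E) x → ℝ)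
    (D : CovariantDerivative 𝓘(ℝ, E) E (fun x : M ↦ TangentSpace 𝓘(ℝ, E) x)) : Prop where
  smooth : CovariantDerivative.ContMDiffCovariantDerivative D ∞
  torsion_free (X Y : ∀ x : M, TangentSpace 𝓘(ℝ, E) x) (x : M)
    (hX : MDiffAt (T% X) x) (hY : MDiffAt (T% Y) x) :
    D Y x (X x) - D X x (Y x) = mlieBracket 𝓘(ℝ, E) X Y x
  metric (Y Z : ∀ x : M, TangentSpace 𝓘(ℝ, E) x) (x : M)
    (hY : MDiffAt (T% Y) x) (hZ : MDiffAt (T% Z) x) (w : TangentSpace 𝓘(ℝ, E) x) :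
    mvfderiv 𝓘(ℝ, E) (fun y ↦ g y (Y y) (Z y)) x w =
      g x (D Y x w) (Z x) + g x (Y x) (D Z x w)

/-- The curvature `R(X, Y) Z = D_X D_Y Z - D_Y D_X Z - D_[X,Y] Z`. -/
def curvature (D : CovariantDerivative 𝓘(ℝ, E) E (fun x : M ↦ TangentSpace 𝓘(ℝ, E) x))
    (X Y Z : ∀ x : M, TangentSpace 𝓘(ℝ, E) x) (x : M) : TangentSpace 𝓘(ℝ, E) x :=
  D (fun y ↦ D Z y (Y y)) x (X x) - D (fun y ↦ D Z y (X y)) x (Y x)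
    - D Z x (mlieBracket 𝓘(ℝ, E) X Y x)

/-- `ξ` is a Killing field: `(L_ξ g)(X, Y) = ξ (g(X, Y)) - g([ξ, X], Y) - g(X, [ξ, Y]) = 0`. -/
def IsKilling (g : PseudoRiemannianMetric E M) (ξ : ∀ x : M, TangentSpace 𝓘(ℝ, E) x) : Prop :=
  ∀ (X Y : ∀ x : M, TangentSpace 𝓘(ℝ, E) x) (x : M),
    MDiffAt (T% X) x → MDiffAt (T% Y) x →
    mvfderiv 𝓘(ℝ, E) (fun y ↦ g.val y (X y) (Y y)) x (ξ x) =
      g.val x (mlieBracket 𝓘(ℝ, E) ξ X x) (Y x) + g.val x (X x) (mlieBracket 𝓘(ℝ, E) ξ Y x)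

/-- `V` is light-like: it vanishes nowhere and has zero square. -/
def IsLightlike (g : ∀ x : M, TangentSpace 𝓘(ℝ, E) x → TangentSpace 𝓘(ℝ, E) x → ℝ)
    (V : ∀ x : M, TangentSpace 𝓘(ℝ, E) x) : Prop :=
  ∀ x, V x ≠ 0 ∧ g x (V x) (V x) = 0

/-- The non-vanishing vector field `V` is recurrent: `D V = θ ⊗ V` for a `1`-form `θ`. -/
def IsRecurrent (D : CovariantDerivative 𝓘(ℝ, E) E (fun x : M ↦ TangentSpace 𝓘(ℝ, E) x))
    (V : ∀ x : M, TangentSpace 𝓘(ℝ, E) x) : Prop :=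
  (∀ x, V x ≠ 0) ∧ ∃ θ : ∀ x : M, TangentSpace 𝓘(ℝ, E) x →L[ℝ] ℝ,
    ∀ (x : M) (w : TangentSpace 𝓘(ℝ, E) x), D V x w = θ x w • V x

/-! ### The transverse connection on `𝒟 = ξ^⊥`, where `g(ξ, ξ) = σ = ±1` -/

/-- `X` is a smooth section of `𝒟 = ξ^⊥`. -/
def IsTransverseSection (g : PseudoRiemannianMetric E M)
    (ξ X : ∀ x : M, TangentSpace 𝓘(ℝ, E) x) : Prop :=
  CMDiff ∞ (T% X) ∧ ∀ x, g.val x (ξ x) (X x) = 0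

/-- The orthogonal projection onto `𝒟 = ξ^⊥`, when `g(ξ, ξ) = σ = ±1`. -/
def transverseProj (g : PseudoRiemannianMetric E M) (σ : ℝ)
    (ξ : ∀ x : M, TangentSpace 𝓘(ℝ, E) x) (x : M) (w : TangentSpace 𝓘(ℝ, E) x) :
    TangentSpace 𝓘(ℝ, E) x :=
  w - (σ * g.val x (ξ x) w) • ξ x

/-- The transverse derivative `∇^𝒟_W Y` of a section `Y` of `𝒟`, for a vector field `W`. It is
linear in `W`, equal to `p [ξ, Y]` if `W = ξ` and to `p (∇_W Y)` if `W` is orthogonal to `ξ`; the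
component of a general `W` along `ξ` is `σ g(ξ, W)`. -/
def transverseDeriv (g : PseudoRiemannianMetric E M) (σ : ℝ)
    (ξ : ∀ x : M, TangentSpace 𝓘(ℝ, E) x)
    (nabla : CovariantDerivative 𝓘(ℝ, E) E (fun x : M ↦ TangentSpace 𝓘(ℝ, E) x))
    (W Y : ∀ x : M, TangentSpace 𝓘(ℝ, E) x) (x : M) : TangentSpace 𝓘(ℝ, E) x :=
  transverseProj g σ ξ x (nabla Y x (transverseProj g σ ξ x (W x)))
    + (σ * g.val x (ξ x) (W x)) • transverseProj g σ ξ x (mlieBracket 𝓘(ℝ, E) ξ Y x)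

/-- The transverse curvature
`R^𝒟(W₁, W₂) Y = ∇^𝒟_{W₁} ∇^𝒟_{W₂} Y - ∇^𝒟_{W₂} ∇^𝒟_{W₁} Y - ∇^𝒟_{[W₁, W₂]} Y`. -/
def transverseCurvature (g : PseudoRiemannianMetric E M) (σ : ℝ)
    (ξ : ∀ x : M, TangentSpace 𝓘(ℝ, E) x)
    (nabla : CovariantDerivative 𝓘(ℝ, E) E (fun x : M ↦ TangentSpace 𝓘(ℝ, E) x))
    (W₁ W₂ Y : ∀ x : M, TangentSpace 𝓘(ℝ, E) x) (x : M) : TangentSpace 𝓘(ℝ, E) x :=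
  transverseDeriv g σ ξ nabla W₁ (transverseDeriv g σ ξ nabla W₂ Y) x
    - transverseDeriv g σ ξ nabla W₂ (transverseDeriv g σ ξ nabla W₁ Y) x
    - transverseDeriv g σ ξ nabla (mlieBracket 𝓘(ℝ, E) W₁ W₂) Y x

/-- `(∇^𝒟_W φ) Y = ∇^𝒟_W (φ Y) - φ (∇^𝒟_W Y)`. -/
def transverseDerivEnd (g : PseudoRiemannianMetric E M) (σ : ℝ)
    (ξ : ∀ x : M, TangentSpace 𝓘(ℝ, E) x)
    (nabla : CovariantDerivative 𝓘(ℝ, E) E (fun x : M ↦ TangentSpace 𝓘(ℝ, E) x))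
    (φ : ∀ x : M, TangentSpace 𝓘(ℝ, E) x →L[ℝ] TangentSpace 𝓘(ℝ, E) x)
    (W Y : ∀ x : M, TangentSpace 𝓘(ℝ, E) x) (x : M) : TangentSpace 𝓘(ℝ, E) x :=
  transverseDeriv g σ ξ nabla W (fun y ↦ φ y (Y y)) x - φ x (transverseDeriv g σ ξ nabla W Y x)

end Metric

/-! ### Principal circle bundles, connection forms, the Kaluza-Klein metric -/

section CircleBundle

variable {E : Type*} [NormedAddCommGroup E] [NormedSpace ℝ E]
  {B : Type*} [TopologicalSpace B] [ChartedSpace E B] [IsManifold 𝓘(ℝ, E) ∞ B]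
  {F : Type*} [NormedAddCommGroup F] [NormedSpace ℝ F]
  {P : Type*} [TopologicalSpace P] [ChartedSpace F P] [IsManifold 𝓘(ℝ, F) ∞ P]
  [MulAction Circle P]

/-- `pr : P → B` is a smooth principal `S¹`-bundle for the given action of the circle on `P` (the
group is abelian, so left and right actions are the same): the projection and the action are
smooth, the action preserves the fibres, and near each point of `B` there is a smooth equivariant
trivialization. -/
structure IsPrincipalCircleBundle (E F : Type*) [NormedAddCommGroup E] [NormedSpace ℝ E]
    [NormedAddCommGroup F] [NormedSpace ℝ F] {B P : Type*} [TopologicalSpace B] [ChartedSpace E B]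
    [TopologicalSpace P] [ChartedSpace F P] [MulAction Circle P] (pr : P → B) : Prop where
  contMDiff_proj : ContMDiff 𝓘(ℝ, F) 𝓘(ℝ, E) ∞ pr
  contMDiff_smul : ContMDiff ((𝓡 1).prod 𝓘(ℝ, F)) 𝓘(ℝ, F) ∞ (fun q : Circle × P ↦ q.1 • q.2)
  proj_smul (z : Circle) (p : P) : pr (z • p) = pr p
  exists_trivialization (b : B) : ∃ (U : Set B) (e : OpenPartialHomeomorph P (B × Circle)),
    IsOpen U ∧ b ∈ U ∧ e.source = pr ⁻¹' U ∧ e.target = U ×ˢ Set.univ ∧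
    ContMDiffOn 𝓘(ℝ, F) (𝓘(ℝ, E).prod (𝓡 1)) ∞ e e.source ∧
    ContMDiffOn (𝓘(ℝ, E).prod (𝓡 1)) 𝓘(ℝ, F) ∞ e.symm e.target ∧
    (∀ p ∈ e.source, (e p).1 = pr p) ∧
    (∀ p ∈ e.source, ∀ z : Circle, (e (z • p)).2 = z * (e p).2)

/-- The fundamental vector field `v`: the velocity at `t = 0` of `t ↦ p · exp(i t)`. -/
def fundamentalField (F : Type*) [NormedAddCommGroup F] [NormedSpace ℝ F]
    {P : Type*} [TopologicalSpace P] [ChartedSpace F P] [MulAction Circle P] (p : P) :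
    TangentSpace 𝓘(ℝ, F) p :=
  (mfderiv 𝓘(ℝ, ℝ) 𝓘(ℝ, F) (fun t : ℝ ↦ Circle.exp t • p) 0 : ℝ →L[ℝ] F) 1

/-- A connection form on the principal circle bundle `P`, with values in the Lie algebra `i ℝ`: a
smooth invariant `1`-form which takes the value `i` on the fundamental field. -/
structure ConnectionForm (F : Type*) [NormedAddCommGroup F] [NormedSpace ℝ F]
    (P : Type*) [TopologicalSpace P] [ChartedSpace F P] [IsManifold 𝓘(ℝ, F) ∞ P]
    [MulAction Circle P] where
  /-- The `1`-form. -/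
  form (p : P) : TangentSpace 𝓘(ℝ, F) p →L[ℝ] ℂ
  contMDiff : ContMDiff 𝓘(ℝ, F) (𝓘(ℝ, F).prod 𝓘(ℝ, F →L[ℝ] ℂ)) ∞
    (fun p ↦ TotalSpace.mk' (F →L[ℝ] ℂ)
      (E := fun p : P ↦ TangentSpace 𝓘(ℝ, F) p →L[ℝ] ℂ) p (form p))
  imaginary (p : P) (w : TangentSpace 𝓘(ℝ, F) p) : (form p w).re = 0
  form_fundamentalField (p : P) : form p (fundamentalField F p) = Complex.I
  invariant (z : Circle) (p : P) (w : TangentSpace 𝓘(ℝ, F) p) :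
    form (z • p) (mfderiv 𝓘(ℝ, F) 𝓘(ℝ, F) (fun q : P ↦ z • q) p w) = form p w

/-- The horizontal lift `X̂` of a vector field `X` on `B`: the unique vector field on `P` such that
`A(X̂) = 0` and `T pr (X̂) = X`. -/
def horizontalLift (pr : P → B) (A : ConnectionForm F P) (X : ∀ b : B, TangentSpace 𝓘(ℝ, E) b)
    (p : P) : TangentSpace 𝓘(ℝ, F) p :=
  Classical.epsilon fun w : TangentSpace 𝓘(ℝ, F) p ↦
    A.form p w = 0 ∧ mfderiv 𝓘(ℝ, F) 𝓘(ℝ, E) pr p w = X (pr p)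

/-- The curvature form on vector fields of `B`, `Ω(X, Y) = - A([X̂, Ŷ])`, as a function on `P`
(it is constant along the fibres). -/
def curvatureForm (pr : P → B) (A : ConnectionForm F P) (X Y : ∀ b : B, TangentSpace 𝓘(ℝ, E) b)
    (p : P) : ℂ :=
  -A.form p (mlieBracket 𝓘(ℝ, F) (horizontalLift pr A X) (horizontalLift pr A Y) p)

/-- The connection form is flat: `Ω = 0`. -/
def IsFlat (pr : P → B) (A : ConnectionForm F P) : Prop :=
  ∀ (X Y : ∀ b : B, TangentSpace 𝓘(ℝ, E) b) (p : P),
    MDiffAt (T% X) (pr p) → MDiffAt (T% Y) (pr p) → curvatureForm pr A X Y p = 0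

/-- The Kaluza-Klein metric `pr^* g + σ A ⊗ A` on `P` (as `A` is imaginary, `A ⊗ A` is real). -/
def kaluzaKleinMetric (g : PseudoRiemannianMetric E B) (σ : ℝ) (pr : P → B)
    (A : ConnectionForm F P) (p : P) (w₁ w₂ : TangentSpace 𝓘(ℝ, F) p) : ℝ :=
  g.val (pr p) (mfderiv 𝓘(ℝ, F) 𝓘(ℝ, E) pr p w₁) (mfderiv 𝓘(ℝ, F) 𝓘(ℝ, E) pr p w₂)
    + σ * (A.form p w₁ * A.form p w₂).re

/-- The section `φ` of `End(TB)` such that `g(φ X, Y) = σ (i / 2) Ω(X, Y)`, which determines it. -/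
def phi (g : PseudoRiemannianMetric E B) (σ : ℝ) (pr : P → B) (A : ConnectionForm F P) :
    ∀ b : B, TangentSpace 𝓘(ℝ, E) b →L[ℝ] TangentSpace 𝓘(ℝ, E) b :=
  Classical.epsilon fun φ : ∀ b : B, TangentSpace 𝓘(ℝ, E) b →L[ℝ] TangentSpace 𝓘(ℝ, E) b ↦
    ∀ (X Y : ∀ b : B, TangentSpace 𝓘(ℝ, E) b) (p : P),
      MDiffAt (T% X) (pr p) → MDiffAt (T% Y) (pr p) →
      (g.val (pr p) (φ (pr p) (X (pr p))) (Y (pr p)) : ℂ) =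
        σ * (Complex.I / 2) * curvatureForm pr A X Y p

/-- First situation: `P`, with Levi-Civita connection `D`, carries a light-like recurrent vector
field of the form `f ξ̂ + h v` with `f` and `h` smooth, and `ε` is the sign of `f h`. -/
def HasRecurrentField (g : PseudoRiemannianMetric E B) (σ : ℝ) (pr : P → B)
    (A : ConnectionForm F P)
    (D : CovariantDerivative 𝓘(ℝ, F) F (fun p : P ↦ TangentSpace 𝓘(ℝ, F) p))
    (ξ : ∀ b : B, TangentSpace 𝓘(ℝ, E) b) (ε : P → ℝ) : Prop :=
  ∃ f h : P → ℝ, ContMDiff 𝓘(ℝ, F) 𝓘(ℝ, ℝ) ∞ f ∧ ContMDiff 𝓘(ℝ, F) 𝓘(ℝ, ℝ) ∞ h ∧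
    IsLightlike (kaluzaKleinMetric g σ pr A)
      (fun p ↦ f p • horizontalLift pr A ξ p + h p • fundamentalField F p) ∧
    IsRecurrent D (fun p ↦ f p • horizontalLift pr A ξ p + h p • fundamentalField F p) ∧
    ∀ p, ε p = Real.sign (f p * h p)

/-- Second situation: `ξ` is a Killing field, `ε` is constant equal to `1` or `-1`, and
`A = A₀ + i σ ε pr^* η` for a flat connection form `A₀` and `η = g(ξ, ·)`. -/
def IsKillingTwistOfFlat (g : PseudoRiemannianMetric E B) (σ : ℝ) (pr : P → B)
    (A : ConnectionForm F P) (ξ : ∀ b : B, TangentSpace 𝓘(ℝ, E) b) (ε : P → ℝ) : Prop :=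
  IsKilling g ξ ∧ ((∀ p, ε p = 1) ∨ (∀ p, ε p = -1)) ∧
    ∃ A₀ : ConnectionForm F P, IsFlat (E := E) pr A₀ ∧
      ∀ (p : P) (w : TangentSpace 𝓘(ℝ, F) p), A.form p w = A₀.form p w + Complex.I *
        ((σ * ε p * g.val (pr p) (ξ (pr p)) (mfderiv 𝓘(ℝ, F) 𝓘(ℝ, E) pr p w) : ℝ) : ℂ)

/-- The parallel field `r = ξ̂ + ε v`. -/
def rField (pr : P → B) (A : ConnectionForm F P) (ξ : ∀ b : B, TangentSpace 𝓘(ℝ, E) b)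
    (ε : P → ℝ) (p : P) : TangentSpace 𝓘(ℝ, F) p :=
  horizontalLift pr A ξ p + ε p • fundamentalField F p

/-- The complementary field `r̃ = ξ̂ - ε v`. -/
def rTildeField (pr : P → B) (A : ConnectionForm F P) (ξ : ∀ b : B, TangentSpace 𝓘(ℝ, E) b)
    (ε : P → ℝ) (p : P) : TangentSpace 𝓘(ℝ, F) p :=
  horizontalLift pr A ξ p - ε p • fundamentalField F p

end CircleBundle

end KaluzaKlein

end

open KaluzaKlein

set_option linter.unusedSectionVars false

noncomputable section

namespace KaluzaKlein

/-! ### Derivations, brackets and related vector fields, computed in charts. -/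

section
variable {E : Type*} [NormedAddCommGroup E] [NormedSpace ℝ E] [FiniteDimensional ℝ E]
  {H : Type*} [TopologicalSpace H] {I : ModelWithCorners ℝ E H} [I.Boundaryless]
  {M : Type*} [TopologicalSpace M] [ChartedSpace H M] [IsManifold I ∞ M]
  {G : Type*} [NormedAddCommGroup G] [NormedSpace ℝ G]

variable {E' : Type*} [NormedAddCommGroup E'] [NormedSpace ℝ E']
  {H' : Type*} [TopologicalSpace H'] {I' : ModelWithCorners ℝ E' H'} [I'.Boundaryless]
  {M' : Type*} [TopologicalSpace M'] [ChartedSpace H' M'] [IsManifold I' ∞ M']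

/-! Write $A=i\alpha$, so that $\tilde g=\pi^*g-\sigma\,\alpha\otimes\alpha$ and $\tilde
g(v,v)=-\sigma$. The field $v$ commutes with every horizontal lift, and $\alpha([\hat X,\hat
Y])=2\sigma g(\phi X,Y)$. The Koszul formula then gives $D_vv=0$, $D_{\hat X}v=D_v\hat
X=\widehat{\phi X}$ and $D_{\hat X}\hat Y=\widehat{\nabla_XY}+\sigma g(\phi X,Y)v$.

Both hypotheses amount to the same structure equations: $\varepsilon$ is smooth, $\varepsilon^2=1$,
$\phi\xi=0$ and $\nabla\xi=-\varepsilon\phi$. In situation (i) they are the projection to $TB$ of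
$D\tilde R=\omega\otimes\tilde R$. In situation (ii), flatness of $A_0$ gives $\alpha([\hat X,\hat
Y])=-\sigma\varepsilon\,d\eta(X,Y)$, and $d\eta(X,Y)=2g(\nabla_X\xi,Y)$ because $\xi$ is Killing.
The structure equations make $r$ parallel (`cov_rField`).

Hence $r^\perp$ is a parallel, integrable distribution. It is spanned by the fields $\bar W=\hat
W+\sigma\varepsilon\eta(W)v$ (`parallelLift`), with $\bar\xi=r$ and $\bar X=\hat X$ for $X\perp\xi$.
These satisfy $[\bar W_1,\bar W_2]=\overline{[W_1,W_2]}$ when $\eta(W_1)$ and $\eta(W_2)$ are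
constant, and $[\bar W,v]=0$ when $\eta(W)$ is constant. For a section $Y$ of $\mathcal D$, $D_{\bar
W}\hat Y=\widehat{\nabla^{\mathcal D}_WY}+\sigma\varepsilon g(\phi W,Y)\,r$ and $D_{\bar
W}v=\widehat{\phi W}$. Differentiating again, with $r$ parallel and $\nabla^{\mathcal D}$ metric,
yields $R(\bar W_1,\bar W_2)$ and $R(\bar W,v)$ on $\hat Y$ and $v$ in terms of $R^{\mathcal D}$ and
of the exterior derivative `extDerivPhi` of $\phi$. The values on $\tilde r=r-2\varepsilon v$
follow.

The formulas with $r$ in the first slot need $\nabla^{\mathcal D}_\xi\phi=0$, which is closedness of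
$\Omega$: it is the vertical part of the Jacobi identity for $r,\hat X,\hat Y$
(`mvfderiv_metric_phi_field`). Finally $R(r,v)$ kills $r$, $v$ and every $\hat Y$, hence vanishes by
skew-adjointness. -/

lemma eventually_mdifferentiableAt {f : M → M'} {x : M} (hf : CMDiffAt ∞ f x) :
    ∀ᶠ y in 𝓝 x, MDiffAt f y := by
  have : CMDiffAt 1 f x := hf.of_le (by simp)
  filter_upwards [(contMDiffAt_iff_contMDiffAt_nhds (by simp)).1 this] with y hy
    using hy.mdifferentiableAt one_ne_zero

lemma mvfderiv_comp_apply' {g : M' → G} {f : M → M'} (x : M) (hg : MDiffAt g (f x))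
    (hf : MDiffAt f x) (v : TangentSpace I x) :
    mvfderiv I (g ∘ f) x v = mvfderiv I' g (f x) (mfderiv I I' f x v) :=
  mfderiv_comp_apply x hg hf v

lemma mvfderiv_const_mul' {f : M → ℝ} {x : M} (c : ℝ) (hf : MDiffAt f x) (w : TangentSpace I x) :
    mvfderiv I (fun y ↦ c * f y) x w = c * mvfderiv I f x w := by
  have h := mvfderiv_mul (I := I) (f := fun _ : M ↦ c) mdifferentiableAt_const hf
  rw [mvfderiv_const, smul_zero, add_zero] at h
  exact congrArg (fun L : E →L[ℝ] ℝ ↦ L w) h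

/-- The preferred chart at `x` has identity derivative at `x`, so no differential remains in front
of the bracket taken in the chart. -/
lemma mlieBracket_eq_lieBracket_chart (V W : ∀ x : M, TangentSpace I x) (x : M) :
    mlieBracket I V W x =
      lieBracket ℝ (mpullback 𝓘(ℝ, E) I (extChartAt I x).symm V)
        (mpullback 𝓘(ℝ, E) I (extChartAt I x).symm W) (extChartAt I x x) := by
  rw [← mlieBracketWithin_univ, mlieBracketWithin_apply, mfderiv_extChartAt_self]
  simp only [I.range_eq_univ, mpullbackWithin_univ, Set.preimage_univ, Set.inter_univ]
  have h (u : E) : (ContinuousLinearMap.id ℝ E).inverse u = u := by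
    rw [ContinuousLinearMap.inverse_id]; rfl
  refine (h _).trans ?_
  exact congrFun (lieBracketWithin_univ (𝕜 := ℝ)
    (V := mpullback 𝓘(ℝ, E) I (extChartAt I x).symm V)) _

lemma mvfderiv_eq_fderiv_chart {g : M → G} {x : M} (hg : MDiffAt g x) :
    mvfderiv I g x = fderiv ℝ (g ∘ (extChartAt I x).symm) (extChartAt I x x) := by
  have h := hg.mfderiv
  simp only [I.range_eq_univ, fderivWithin_univ] at h
  exact h

lemma mpullback_extChartAt_symm_self (V : ∀ x : M, TangentSpace I x) (x : M) :
    mpullback 𝓘(ℝ, E) I (extChartAt I x).symm V (extChartAt I x x) = V x := by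
  have h := mfderivWithin_extChartAt_symm_inverse_apply (I := I) (x := x) (V x)
  simp only [I.range_eq_univ, mfderivWithin_univ] at h
  rw [mpullback_apply, extChartAt_to_inv]
  exact h

lemma fderiv_chart_mpullback {g : M → G} {x : M} {V : ∀ x : M, TangentSpace I x} {y : E}
    (hy : y ∈ (extChartAt I x).target) (hg : MDiffAt g ((extChartAt I x).symm y)) :
    fderiv ℝ (g ∘ (extChartAt I x).symm) y (mpullback 𝓘(ℝ, E) I (extChartAt I x).symm V y) =
      mvfderiv I g ((extChartAt I x).symm y) (V ((extChartAt I x).symm y)) := by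
  have hinv := isInvertible_mfderivWithin_extChartAt_symm (I := I) hy
  have hd := mdifferentiableWithinAt_extChartAt_symm (I := I) hy
  simp only [I.range_eq_univ, mfderivWithin_univ, mdifferentiableWithinAt_univ] at hinv hd
  have h := mfderiv_comp_apply (I := 𝓘(ℝ, E)) (I' := I) (I'' := 𝓘(ℝ, G)) y hg hd
    (mpullback 𝓘(ℝ, E) I (extChartAt I x).symm V y)
  rw [mfderiv_eq_fderiv] at h
  refine h.trans ?_
  rw [mpullback_apply]
  have := hinv.self_apply_inverse (y := V ((extChartAt I x).symm y))
  exact congrArg _ this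

/-- The equality has to hold near the base point, since the commutator formula differentiates both
sides once more. -/
lemma fderiv_chart_mpullback_eventuallyEq {g : M → G} {x : M} {V : ∀ x : M, TangentSpace I x}
    (hg : CMDiffAt ∞ g x) :
    (fun y ↦ fderiv ℝ (g ∘ (extChartAt I x).symm) y
        (mpullback 𝓘(ℝ, E) I (extChartAt I x).symm V y)) =ᶠ[𝓝 (extChartAt I x x)]
      (fun y ↦ mvfderiv I g y (V y)) ∘ (extChartAt I x).symm := by
  have h1 : ∀ᶠ y in 𝓝 x, MDiffAt g y :=
    eventually_mdifferentiableAt hg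
  have h2 : Filter.Tendsto (extChartAt I x).symm (𝓝 (extChartAt I x x)) (𝓝 x) := by
    have := continuousAt_extChartAt_symm (I := I) x
    rwa [ContinuousAt, extChartAt_to_inv] at this
  filter_upwards [h2.eventually h1, extChartAt_target_mem_nhds (I := I) x] with y hy hy'
  exact fderiv_chart_mpullback hy' hy

lemma contDiffAt_comp_extChartAt_symm {g : M → G} {x : M} (hg : CMDiffAt ∞ g x) :
    ContDiffAt ℝ ∞ (g ∘ (extChartAt I x).symm) (extChartAt I x x) := by
  have h := contMDiffWithinAt_extChartAt_symm_range (n := ∞) (I := I) x (mem_extChartAt_target x)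
  rw [I.range_eq_univ, contMDiffWithinAt_univ] at h
  exact (ContMDiffAt.comp_of_eq (I' := I) hg h (extChartAt_to_inv x)).contDiffAt

lemma differentiableAt_mpullback_extChartAt_symm {x : M} {V : ∀ x : M, TangentSpace I x}
    (hV : MDiffAt (T% V) x) :
    DifferentiableAt ℝ (mpullback 𝓘(ℝ, E) I (extChartAt I x).symm V) (extChartAt I x x) := by
  rw [← mdifferentiableWithinAt_univ] at hV
  have h := hV.differentiableWithinAt_mpullbackWithin_vectorField
  simp only [I.range_eq_univ, Set.preimage_univ, Set.inter_univ, mpullbackWithin_univ] at h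
  exact differentiableWithinAt_univ.1 h

lemma mdifferentiableAt_of_comp_extChartAt_symm {g : M → G} {x : M}
    (h : DifferentiableAt ℝ (g ∘ (extChartAt I x).symm) (extChartAt I x x)) : MDiffAt g x := by
  have h3 := MDifferentiableAt.comp (I' := 𝓘(ℝ, E)) x h.mdifferentiableAt
    (mdifferentiableAt_extChartAt (I := I) (mem_chart_source H x))
  refine h3.congr_of_eventuallyEq ?_
  filter_upwards [extChartAt_source_mem_nhds (I := I) x] with y hy
  simp only [Function.comp_apply, (extChartAt I x).left_inv hy]

lemma mdifferentiableAt_mvfderiv_apply {g : M → G} {x : M} {V : ∀ x : M, TangentSpace I x}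
    (hg : CMDiffAt ∞ g x) (hV : MDiffAt (T% V) x) :
    MDiffAt (fun y ↦ mvfderiv I g y (V y)) x := by
  apply mdifferentiableAt_of_comp_extChartAt_symm (I := I)
  refine DifferentiableAt.congr_of_eventuallyEq ?_ (fderiv_chart_mpullback_eventuallyEq hg).symm
  refine DifferentiableAt.clm_apply ?_ (differentiableAt_mpullback_extChartAt_symm hV)
  exact ((contDiffAt_comp_extChartAt_symm hg).fderiv_right (m := 1) (by norm_cast)).differentiableAt
    one_ne_zero

/-- The derivative of a function along `[V, W]` is the commutator of its derivatives. -/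
lemma mvfderiv_mlieBracket {g : M → G} {x : M} {V W : ∀ x : M, TangentSpace I x}
    (hg : CMDiffAt ∞ g x) (hV : MDiffAt (T% V) x) (hW : MDiffAt (T% W) x) :
    mvfderiv I g x (mlieBracket I V W x) =
      mvfderiv I (fun y ↦ mvfderiv I g y (W y)) x (V x) -
        mvfderiv I (fun y ↦ mvfderiv I g y (V y)) x (W x) := by
  rw [mvfderiv_eq_fderiv_chart (hg.mdifferentiableAt (by simp)),
    mvfderiv_eq_fderiv_chart (mdifferentiableAt_mvfderiv_apply hg hV),
    mvfderiv_eq_fderiv_chart (mdifferentiableAt_mvfderiv_apply hg hW),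
    ← (fderiv_chart_mpullback_eventuallyEq hg).fderiv_eq,
    ← (fderiv_chart_mpullback_eventuallyEq hg).fderiv_eq, mlieBracket_eq_lieBracket_chart]
  have := fderiv_apply_lieBracket (contDiffAt_comp_extChartAt_symm hg) (by simp; norm_cast)
    (differentiableAt_mpullback_extChartAt_symm hW) (differentiableAt_mpullback_extChartAt_symm hV)
  rw [mpullback_extChartAt_symm_self, mpullback_extChartAt_symm_self] at this
  exact this

variable [FiniteDimensional ℝ E']

/-- Brackets of related vector fields are related. -/
lemma mfderiv_mlieBracket_of_related {f : M → M'} {x : M}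
    {V W : ∀ x : M, TangentSpace I x} {V' W' : ∀ x : M', TangentSpace I' x}
    (hf : CMDiffAt ∞ f x) (hV : MDiffAt (T% V) x) (hW : MDiffAt (T% W) x)
    (hV' : MDiffAt (T% V') (f x)) (hW' : MDiffAt (T% W') (f x))
    (hVV' : ∀ᶠ y in 𝓝 x, mfderiv I I' f y (V y) = V' (f y))
    (hWW' : ∀ᶠ y in 𝓝 x, mfderiv I I' f y (W y) = W' (f y)) :
    mfderiv I I' f x (mlieBracket I V W x) = mlieBracket I' V' W' (f x) := by
  -- The map `f` need not be a local diffeomorphism, so fields cannot be pulled back along it.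
  -- Instead the commutator formula is applied to the vector-valued function `φ` at `f x` and to `φ
  -- ∘ f` at `x`; as `φ` has identity derivative at `f x`, it detects the whole bracket.
  set φ := extChartAt I' (f x) with hφ
  have hφs : CMDiffAt ∞ φ (f x) := contMDiffAt_extChartAt
  have hφf : CMDiffAt ∞ (φ ∘ f) x := hφs.comp x hf
  have hfd : ∀ᶠ y in 𝓝 x, MDiffAt f y :=
    eventually_mdifferentiableAt hf
  have hφd : ∀ᶠ y in 𝓝 x, MDiffAt φ (f y) :=
    hf.continuousAt.eventually (eventually_mdifferentiableAt hφs)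
  have key : ∀ {V : ∀ x : M, TangentSpace I x} {V' : ∀ x : M', TangentSpace I' x},
      (∀ᶠ y in 𝓝 x, mfderiv I I' f y (V y) = V' (f y)) →
      (fun y ↦ mvfderiv I (φ ∘ f) y (V y)) =ᶠ[𝓝 x] (fun y ↦ mvfderiv I' φ y (V' y)) ∘ f := by
    intro V V' h
    filter_upwards [h, hfd, hφd] with y hy h1 h2
    rw [mvfderiv_comp_apply' y h2 h1, hy]; rfl
  have hfx := hfd.self_of_nhds
  have hφx := hφd.self_of_nhds
  have h1 := mvfderiv_mlieBracket hφf hV hW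
  have h2 := mvfderiv_mlieBracket hφs hV' hW'
  have e : ∀ {V : ∀ x : M, TangentSpace I x} {V' : ∀ x : M', TangentSpace I' x}
      {U : ∀ x : M, TangentSpace I x} {U' : ∀ x : M', TangentSpace I' x},
      (∀ᶠ y in 𝓝 x, mfderiv I I' f y (V y) = V' (f y)) → MDiffAt (T% V') (f x) →
      (∀ᶠ y in 𝓝 x, mfderiv I I' f y (U y) = U' (f y)) →
      mvfderiv I (fun y ↦ mvfderiv I (φ ∘ f) y (V y)) x (U x) =
        mvfderiv I' (fun y ↦ mvfderiv I' φ y (V' y)) (f x) (U' (f x)) := by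
    intro V V' U U' h hd hU
    have : mvfderiv I (fun y ↦ mvfderiv I (φ ∘ f) y (V y)) x =
        mvfderiv I ((fun y ↦ mvfderiv I' φ y (V' y)) ∘ f) x :=
      (key h).mfderiv_eq
    rw [this, mvfderiv_comp_apply' x (mdifferentiableAt_mvfderiv_apply hφs hd) hfx,
      hU.self_of_nhds]
  rw [e hWW' hW' hVV', e hVV' hV' hWW', ← h2, mvfderiv_comp_apply' x hφx hfx] at h1
  have hid : mfderiv I' 𝓘(ℝ, E') φ (f x) = ContinuousLinearMap.id ℝ _ := mfderiv_extChartAt_self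
  have h3 : ∀ u : TangentSpace I' (f x), mvfderiv I' φ (f x) u = u := fun u ↦
    congrArg (fun L : E' →L[ℝ] E' ↦ L u) hid
  rwa [h3, h3] at h1
end

/-! ### Smooth fields, covariant derivatives, the Koszul formula and skew-adjointness of curvature.
-/

section Fields

variable {E : Type*} [NormedAddCommGroup E] [NormedSpace ℝ E]
  {M : Type*} [TopologicalSpace M] [ChartedSpace E M] [IsManifold 𝓘(ℝ, E) ∞ M]

/-- Every tangent vector is the value of a smooth vector field. -/
lemma exists_contMDiff_field [FiniteDimensional ℝ E] [T2Space M] (x : M) (u : TangentSpace 𝓘(ℝ, E) x) :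
    ∃ X : ∀ x : M, TangentSpace 𝓘(ℝ, E) x, CMDiff ∞ (T% X) ∧ X x = u := by
  obtain ⟨s, hs, hs'⟩ := FiberBundle.exists_contMDiffOn_extend (k := ∞) 𝓘(ℝ, E) E
    (V := fun x : M ↦ TangentSpace 𝓘(ℝ, E) x) u
  -- The local extension is smooth only near `x`; a bump function supported there makes it global.
  obtain ⟨f, -, hf⟩ := (SmoothBumpFunction.nhds_basis_tsupport (I := 𝓘(ℝ, E)) x).mem_iff.1
    (interior_mem_nhds.2 hs)
  refine ⟨(f : M → ℝ) • FiberBundle.extend E u, ?_, ?_⟩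
  · exact ContMDiffOn.smul_section_of_tsupport (u := interior s) f.contMDiff.contMDiffOn
      isOpen_interior hf (hs'.mono interior_subset)
  · simp

section Covariant

variable (D : CovariantDerivative 𝓘(ℝ, E) E (fun x : M ↦ TangentSpace 𝓘(ℝ, E) x))
  {X Y : ∀ x : M, TangentSpace 𝓘(ℝ, E) x} {x : M}

lemma cov_add (hX : MDiffAt (T% X) x) (hY : MDiffAt (T% Y) x) :
    D (fun y ↦ X y + Y y) x = D X x + D Y x :=
  D.isCovariantDerivativeOnUniv.add hX hY

lemma cov_smul {f : M → ℝ} (hf : MDiffAt f x) (hX : MDiffAt (T% X) x)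
    (w : TangentSpace 𝓘(ℝ, E) x) :
    D (fun y ↦ f y • X y) x w = f x • D X x w + mvfderiv 𝓘(ℝ, E) f x w • X x := by
  have := D.isCovariantDerivativeOnUniv.leibniz hX hf
  exact congrArg (fun L : E →L[ℝ] E ↦ L w) this

lemma cov_zero (w : TangentSpace 𝓘(ℝ, E) x) :
    D (fun y ↦ (0 : TangentSpace 𝓘(ℝ, E) y)) x w = 0 :=
  congrArg (fun L : E →L[ℝ] E ↦ L w) (congrFun D.zero x)

lemma cov_contMDiff (hD : CovariantDerivative.ContMDiffCovariantDerivative D ∞)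
    (hX : CMDiff ∞ (T% X)) (hY : CMDiff ∞ (T% Y)) : CMDiff ∞ (T% (fun y ↦ D X y (Y y))) := by
  have h := hD.contMDiff.contMDiff (σ := X) (by simpa using hX.contMDiffOn)
  rw [contMDiffOn_univ] at h
  exact ContMDiff.clm_bundle_apply (b := fun x : M ↦ x) h hY

end Covariant

section Metric

variable {g : ∀ x : M, TangentSpace 𝓘(ℝ, E) x → TangentSpace 𝓘(ℝ, E) x → ℝ}
  {D : CovariantDerivative 𝓘(ℝ, E) E (fun x : M ↦ TangentSpace 𝓘(ℝ, E) x)}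

/-- The Koszul formula. -/
lemma IsLeviCivita.koszul (hD : IsLeviCivita g D) (hsymm : ∀ x u w, g x u w = g x w u)
    (hsub : ∀ x u u' w, g x (u - u') w = g x u w - g x u' w)
    {X Y Z : ∀ x : M, TangentSpace 𝓘(ℝ, E) x} {x : M}
    (hX : MDiffAt (T% X) x) (hY : MDiffAt (T% Y) x) (hZ : MDiffAt (T% Z) x) :
    2 * g x (D Y x (X x)) (Z x) =
      mvfderiv 𝓘(ℝ, E) (fun y ↦ g y (Y y) (Z y)) x (X x)
      + mvfderiv 𝓘(ℝ, E) (fun y ↦ g y (X y) (Z y)) x (Y x)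
      - mvfderiv 𝓘(ℝ, E) (fun y ↦ g y (X y) (Y y)) x (Z x)
      + g x (mlieBracket 𝓘(ℝ, E) X Y x) (Z x)
      - g x (mlieBracket 𝓘(ℝ, E) X Z x) (Y x)
      - g x (mlieBracket 𝓘(ℝ, E) Y Z x) (X x) := by
  rw [← hD.torsion_free X Y x hX hY, ← hD.torsion_free X Z x hX hZ, ← hD.torsion_free Y Z x hY hZ,
    hD.metric Y Z x hY hZ, hD.metric X Z x hX hZ, hD.metric X Y x hX hY, hsub, hsub, hsub,
    hsymm x (X x), hsymm x (Y x) (D Z x (X x)), hsymm x (X x)]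
  ring

/-- The curvature of a Levi-Civita connection is skew-adjoint. -/
lemma IsLeviCivita.curvature_skew [FiniteDimensional ℝ E] (hD : IsLeviCivita g D)
    (hsymm : ∀ x u w, g x u w = g x w u)
    (hsub : ∀ x u u' w, g x (u - u') w = g x u w - g x u' w)
    (hg : ∀ W Z : ∀ x : M, TangentSpace 𝓘(ℝ, E) x, CMDiff ∞ (T% W) → CMDiff ∞ (T% Z) →
      CMDiff ∞ (fun y ↦ g y (W y) (Z y)))
    {U V W Z : ∀ x : M, TangentSpace 𝓘(ℝ, E) x}
    (hU : CMDiff ∞ (T% U)) (hV : CMDiff ∞ (T% V)) (hW : CMDiff ∞ (T% W)) (hZ : CMDiff ∞ (T% Z))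
    (x : M) : g x (curvature D U V W x) (Z x) = -g x (W x) (curvature D U V Z x) := by
  have d {X : ∀ x : M, TangentSpace 𝓘(ℝ, E) x} (hX : CMDiff ∞ (T% X)) (y : M) :
      MDiffAt (T% X) y := (hX y).mdifferentiableAt (by simp)
  have key {U V : ∀ x : M, TangentSpace 𝓘(ℝ, E) x} (hV : CMDiff ∞ (T% V)) :
      mvfderiv 𝓘(ℝ, E) (fun y ↦ mvfderiv 𝓘(ℝ, E) (fun z ↦ g z (W z) (Z z)) y (V y)) x (U x) =
        g x (D (fun y ↦ D W y (V y)) x (U x)) (Z x) + g x (D W x (V x)) (D Z x (U x))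
          + (g x (D W x (U x)) (D Z x (V x)) + g x (W x) (D (fun y ↦ D Z y (V y)) x (U x))) := by
    have hWV := cov_contMDiff D hD.smooth hW hV
    have hZV := cov_contMDiff D hD.smooth hZ hV
    have h1 : (fun y ↦ mvfderiv 𝓘(ℝ, E) (fun z ↦ g z (W z) (Z z)) y (V y)) =
        (fun y ↦ g y (D W y (V y)) (Z y)) + fun y ↦ g y (W y) (D Z y (V y)) :=
      funext fun y ↦ hD.metric W Z y (d hW y) (d hZ y) (V y)
    rw [h1, mvfderiv_add ((hg _ _ hWV hZ x).mdifferentiableAt (by simp))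
      ((hg _ _ hW hZV x).mdifferentiableAt (by simp)), add_apply,
      hD.metric _ Z x (d hWV x) (d hZ x), hD.metric W _ x (d hW x) (d hZV x)]
  -- The function `g(W, Z)` satisfies `[U, V] f = U V f - V U f`. Expanding each side with the
  -- metric property, the mixed terms `g(D_U W, D_V Z)` and `g(D_V W, D_U Z)` cancel.
  have h := mvfderiv_mlieBracket (hg W Z hW hZ x) (d hU x) (d hV x)
  rw [key hV, key hU, hD.metric W Z x (d hW x) (d hZ x)] at h
  have hsub' (u u' w) : g x w (u - u') = g x w u - g x w u' := by
    rw [hsymm, hsub, hsymm, hsymm x u']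
  simp only [curvature, hsub, hsub']
  linarith

end Metric
end Fields

/-! ### Vector fields on products. -/

section ProductFields

variable {E : Type*} [NormedAddCommGroup E] [NormedSpace ℝ E]
  {H : Type*} [TopologicalSpace H] {I : ModelWithCorners ℝ E H}
  {M : Type*} [TopologicalSpace M] [ChartedSpace H M] [IsManifold I ∞ M]
  {E' : Type*} [NormedAddCommGroup E'] [NormedSpace ℝ E']
  {H' : Type*} [TopologicalSpace H'] {I' : ModelWithCorners ℝ E' H'}
  {M' : Type*} [TopologicalSpace M'] [ChartedSpace H' M'] [IsManifold I' ∞ M']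

/-- The vector field `(a, b)` on a product of manifolds. -/
def prodField (a : ∀ x : M, TangentSpace I x) (b : ∀ y : M', TangentSpace I' y) (q : M × M') :
    TangentSpace (I.prod I') q :=
  (a q.1, b q.2)

variable {a : ∀ x : M, TangentSpace I x} {b : ∀ y : M', TangentSpace I' y} {q : M × M'}

lemma contMDiffAt_prodField (ha : CMDiffAt ∞ (T% a) q.1) (hb : CMDiffAt ∞ (T% b) q.2) :
    CMDiffAt ∞ (T% (prodField a b)) q := by
  have h : CMDiffAt ∞ (fun q : M × M' ↦
      ((⟨q.1, a q.1⟩ : TangentBundle I M), (⟨q.2, b q.2⟩ : TangentBundle I' M'))) q :=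
    (ha.comp q contMDiffAt_fst).prodMk (hb.comp q contMDiffAt_snd)
  exact (contMDiff_equivTangentBundleProd_symm (n := ∞) _).comp q h

lemma mdifferentiableAt_prodField (ha : MDiffAt (T% a) q.1) (hb : MDiffAt (T% b) q.2) :
    MDiffAt (T% (prodField a b)) q := by
  have h : MDiffAt (fun q : M × M' ↦
      ((⟨q.1, a q.1⟩ : TangentBundle I M), (⟨q.2, b q.2⟩ : TangentBundle I' M'))) q :=
    (ha.comp q mdifferentiableAt_fst).prodMk (hb.comp q mdifferentiableAt_snd)
  exact ((contMDiff_equivTangentBundleProd_symm (n := 1) _).mdifferentiableAt one_ne_zero).comp q h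

end ProductFields

/-! ### Principal circle bundles, fundamental field and vertical vectors. -/

section CircleBundle

variable {E : Type*} [NormedAddCommGroup E] [NormedSpace ℝ E] [FiniteDimensional ℝ E]
  {B : Type*} [TopologicalSpace B] [ChartedSpace E B] [IsManifold 𝓘(ℝ, E) ∞ B]
  {F : Type*} [NormedAddCommGroup F] [NormedSpace ℝ F] [FiniteDimensional ℝ F]
  {P : Type*} [TopologicalSpace P] [ChartedSpace F P] [IsManifold 𝓘(ℝ, F) ∞ P]
  [MulAction Circle P] {pr : P → B}

namespace IsPrincipalCircleBundle

variable (hpr : IsPrincipalCircleBundle E F pr)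
include hpr

lemma surjective : Function.Surjective pr := by
  intro b
  obtain ⟨U, e, -, hb, hs, ht, -, -, h1, -⟩ := hpr.exists_trivialization b
  have : (b, (1 : Circle)) ∈ e.target := by rw [ht]; exact ⟨hb, trivial⟩
  refine ⟨e.symm (b, 1), ?_⟩
  rw [← h1 _ (e.map_target this), e.right_inv this]

lemma exists_smul_eq {p q : P} (h : pr p = pr q) : ∃ z : Circle, z • p = q := by
  obtain ⟨U, e, -, hb, hs, ht, -, -, h1, h2⟩ := hpr.exists_trivialization (pr p)
  have hp : p ∈ e.source := by rw [hs]; exact hb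
  have hq : q ∈ e.source := by rw [hs, Set.mem_preimage, ← h]; exact hb
  refine ⟨(e q).2 / (e p).2, ?_⟩
  have hz : ((e q).2 / (e p).2) • p ∈ e.source := by
    rw [hs, Set.mem_preimage, hpr.proj_smul]; exact hb
  apply e.injOn hz hq
  ext1
  · rw [h1 _ hz, h1 _ hq, hpr.proj_smul, h]
  · rw [h2 _ hp]; simp

lemma contMDiff_exp_smul : ContMDiff (𝓘(ℝ, ℝ).prod 𝓘(ℝ, F)) 𝓘(ℝ, F) ∞
    (fun q : ℝ × P ↦ Circle.exp q.1 • q.2) :=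
  hpr.contMDiff_smul.comp
    ((contMDiff_circleExp.comp contMDiff_fst).prodMk contMDiff_snd)

lemma contMDiff_const_smul (z : Circle) : ContMDiff 𝓘(ℝ, F) 𝓘(ℝ, F) ∞ (fun p : P ↦ z • p) :=
  hpr.contMDiff_smul.comp (contMDiff_const.prodMk contMDiff_id)

lemma contMDiff_orbit (p : P) : ContMDiff 𝓘(ℝ, ℝ) 𝓘(ℝ, F) ∞ (fun t : ℝ ↦ Circle.exp t • p) :=
  hpr.contMDiff_exp_smul.comp (contMDiff_id.prodMk contMDiff_const)

lemma mfderiv_proj_fundamentalField (p : P) :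
    mfderiv 𝓘(ℝ, F) 𝓘(ℝ, E) pr p (fundamentalField F p) = 0 := by
  have h1 : (pr ∘ fun t : ℝ ↦ Circle.exp t • p) = fun _ ↦ pr p :=
    funext fun t ↦ hpr.proj_smul _ _
  have h2 := mfderiv_comp_apply_of_eq (I := 𝓘(ℝ, ℝ)) (I' := 𝓘(ℝ, F)) (I'' := 𝓘(ℝ, E))
    (f := fun t : ℝ ↦ Circle.exp t • p) (g := pr) (y := p) (0 : ℝ)
    (hpr.contMDiff_proj.mdifferentiableAt (by simp))
    ((hpr.contMDiff_orbit p).mdifferentiableAt (by simp)) (by simp) (1 : ℝ)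
  rw [h1, mfderiv_const] at h2
  exact h2.symm

lemma mfderiv_exp_smul_left (q : ℝ × P) :
    mfderiv (𝓘(ℝ, ℝ).prod 𝓘(ℝ, F)) 𝓘(ℝ, F) (fun q : ℝ × P ↦ Circle.exp q.1 • q.2) q
      ((1 : ℝ), (0 : F)) = fundamentalField F (Circle.exp q.1 • q.2) := by
  obtain ⟨t, p⟩ := q
  have h1 : (fun s : ℝ ↦ Circle.exp s • Circle.exp t • p) =
      (fun q : ℝ × P ↦ Circle.exp q.1 • q.2) ∘ fun s : ℝ ↦ (s + t, p) := by
    funext s; simp [Circle.exp_add, mul_smul]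
  have hd : HasMFDerivAt 𝓘(ℝ, ℝ) (𝓘(ℝ, ℝ).prod 𝓘(ℝ, F)) (fun s : ℝ ↦ (s + t, p)) 0
      (ContinuousLinearMap.inl ℝ ℝ F) := by
    have h3 : HasMFDerivAt 𝓘(ℝ, ℝ) 𝓘(ℝ, ℝ) (fun s : ℝ ↦ s + t) 0 (ContinuousLinearMap.id ℝ ℝ) :=
      ((hasFDerivAt_id (0 : ℝ)).add_const t).hasMFDerivAt
    exact h3.prodMk (hasMFDerivAt_const p 0)
  have h2 := mfderiv_comp_apply_of_eq (I := 𝓘(ℝ, ℝ)) (I'' := 𝓘(ℝ, F))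
    (g := fun q : ℝ × P ↦ Circle.exp q.1 • q.2) (y := (t, p)) (0 : ℝ)
    (hpr.contMDiff_exp_smul.mdifferentiableAt (by simp)) hd.mdifferentiableAt (by simp) (1 : ℝ)
  rw [← h1, hd.mfderiv] at h2
  exact h2.symm

lemma mfderiv_exp_smul_right (t : ℝ) (p : P) (w : TangentSpace 𝓘(ℝ, F) p) :
    mfderiv (𝓘(ℝ, ℝ).prod 𝓘(ℝ, F)) 𝓘(ℝ, F) (fun q : ℝ × P ↦ Circle.exp q.1 • q.2) (t, p)
      ((0 : ℝ), (w : F)) = mfderiv 𝓘(ℝ, F) 𝓘(ℝ, F) (fun q : P ↦ Circle.exp t • q) p w := by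
  have hd : HasMFDerivAt 𝓘(ℝ, F) (𝓘(ℝ, ℝ).prod 𝓘(ℝ, F)) (fun q : P ↦ (t, q)) p
      (ContinuousLinearMap.inr ℝ ℝ F) :=
    (hasMFDerivAt_const t p).prodMk (hasMFDerivAt_id p)
  have h2 := mfderiv_comp_apply (I := 𝓘(ℝ, F)) (I'' := 𝓘(ℝ, F))
    (g := fun q : ℝ × P ↦ Circle.exp q.1 • q.2) p
    (hpr.contMDiff_exp_smul.mdifferentiableAt (by simp)) hd.mdifferentiableAt w
  rw [hd.mfderiv] at h2
  exact h2.symm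

lemma contMDiff_fundamentalField :
    CMDiff ∞ (T% (fundamentalField F : ∀ p : P, TangentSpace 𝓘(ℝ, F) p)) := by
  intro p
  have h1 : CMDiffAt ∞ (T% (prodField (fun t : ℝ ↦ (1 : TangentSpace 𝓘(ℝ, ℝ) t))
      (fun p : P ↦ (0 : TangentSpace 𝓘(ℝ, F) p)))) ((0 : ℝ), p) := by
    apply contMDiffAt_prodField
    · rw [contMDiffAt_vectorSpace_iff_contDiffAt]; exact contDiffAt_const
    · exact contMDiff_zeroSection ℝ _ p
  have h2 := ((hpr.contMDiff_exp_smul.contMDiff_tangentMap (m := ∞) (by simp)) _).comp _ h1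
  have h3 : CMDiffAt ∞ (fun p : P ↦ ((0 : ℝ), p)) p := contMDiffAt_const.prodMk contMDiffAt_id
  refine (h2.comp p h3).congr_of_eventuallyEq (Filter.Eventually.of_forall fun q ↦ ?_)
  have h4 := hpr.mfderiv_exp_smul_left (0, q)
  -- `Circle.exp 0 • q` equals `q` only propositionally, and tangent vectors depend on the base
  -- point, hence the transport.
  have h5 : ∀ q' : P, q' = q → (⟨q, fundamentalField F q⟩ : TangentBundle 𝓘(ℝ, F) P) =
      ⟨q', fundamentalField F q'⟩ := by rintro _ rfl; rfl
  refine (h5 (Circle.exp 0 • q) (by simp)).trans ?_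
  exact congrArg (fun w : F ↦ (⟨Circle.exp 0 • q, w⟩ : TangentBundle 𝓘(ℝ, F) P)) h4.symm

lemma exists_trivialization_at (p : P) : ∃ e : OpenPartialHomeomorph P (B × Circle),
    p ∈ e.source ∧
    ContMDiffOn 𝓘(ℝ, F) (𝓘(ℝ, E).prod (𝓡 1)) ∞ e e.source ∧
    ContMDiffOn (𝓘(ℝ, E).prod (𝓡 1)) 𝓘(ℝ, F) ∞ e.symm e.target ∧
    (∀ q ∈ e.source, (e q).1 = pr q) ∧
    e.MDifferentiable 𝓘(ℝ, F) (𝓘(ℝ, E).prod (𝓡 1)) ∧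
    ∀ q ∈ e.source, ∀ w : TangentSpace 𝓘(ℝ, F) q,
      mfderiv 𝓘(ℝ, F) 𝓘(ℝ, E) pr q w =
        (mfderiv 𝓘(ℝ, F) (𝓘(ℝ, E).prod (𝓡 1)) e q w : E × EuclideanSpace ℝ (Fin 1)).1 := by
  obtain ⟨U, e, -, hb, hs, -, h1, h2, h3, -⟩ := hpr.exists_trivialization (pr p)
  have he : e.MDifferentiable 𝓘(ℝ, F) (𝓘(ℝ, E).prod (𝓡 1)) :=
    ⟨h1.mdifferentiableOn (by simp), h2.mdifferentiableOn (by simp)⟩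
  refine ⟨e, by rw [hs]; exact hb, h1, h2, h3, he, fun q hq w ↦ ?_⟩
  have h4 : pr =ᶠ[𝓝 q] Prod.fst ∘ e := by
    filter_upwards [e.open_source.mem_nhds hq] with y hy using (h3 y hy).symm
  rw [h4.mfderiv_eq]
  have h5 := mfderiv_comp_apply (I := 𝓘(ℝ, F)) (I' := 𝓘(ℝ, E).prod (𝓡 1)) (I'' := 𝓘(ℝ, E))
    (g := Prod.fst) (f := e) q mdifferentiableAt_fst (he.mdifferentiableAt hq) w
  rw [mfderiv_fst] at h5
  exact h5

/-- In a trivialization, `(X, 0)` is a lift as regular as `X`. It is not horizontal in general;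
subtracting the `α`-component later corrects this. -/
lemma exists_local_lift (p : P) :
    ∃ L : (∀ b : B, TangentSpace 𝓘(ℝ, E) b) → ∀ p : P, TangentSpace 𝓘(ℝ, F) p,
      (∀ X, ∀ᶠ q in 𝓝 p, mfderiv 𝓘(ℝ, F) 𝓘(ℝ, E) pr q (L X q) = X (pr q)) ∧
      (∀ X, MDiffAt (T% X) (pr p) → MDiffAt (T% (L X)) p) ∧
      (∀ X, CMDiffAt ∞ (T% X) (pr p) → CMDiffAt ∞ (T% (L X)) p) := by
  obtain ⟨e, hp, h1, h2, h3, he, h4⟩ := hpr.exists_trivialization_at p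
  have hinv (q) (hq : q ∈ e.source) :
      (mfderiv 𝓘(ℝ, F) (𝓘(ℝ, E).prod (𝓡 1)) e q).IsInvertible := ⟨he.mfderiv hq, rfl⟩
  have hep : CMDiffAt ∞ e p := h1.contMDiffAt (e.open_source.mem_nhds hp)
  refine ⟨fun X ↦ mpullback 𝓘(ℝ, F) (𝓘(ℝ, E).prod (𝓡 1)) e
    (prodField X fun z : Circle ↦ (0 : TangentSpace (𝓡 1) z)), fun X ↦ ?_, fun X hX ↦ ?_,
    fun X hX ↦ ?_⟩
  · filter_upwards [e.open_source.mem_nhds hp] with q hq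
    rw [h4 q hq, mpullback_apply, (hinv q hq).self_apply_inverse]
    exact congrArg (fun b ↦ (X b : E)) (h3 q hq)
  · refine MDifferentiableAt.mpullback_vectorField (n := ∞) ?_ hep (hinv p hp) (by norm_cast)
    refine mdifferentiableAt_prodField ?_ ?_
    · rwa [h3 p hp]
    · exact (mdifferentiable_zeroSection ℝ _ _)
  · refine ContMDiffAt.mpullback_vectorField_preimage (n := ∞) ?_ hep (hinv p hp) (by simp)
    refine contMDiffAt_prodField ?_ ?_
    · rwa [h3 p hp]
    · exact (contMDiff_zeroSection ℝ _ _)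

lemma exists_local_section (p : P) : ∃ s : B → P, s (pr p) = p ∧
    ContMDiffAt 𝓘(ℝ, E) 𝓘(ℝ, F) ∞ s (pr p) ∧ ∀ᶠ b in 𝓝 (pr p), pr (s b) = b := by
  obtain ⟨e, hp, h1, h2, h3, -, -⟩ := hpr.exists_trivialization_at p
  have hp2 : (pr p, (e p).2) = e p := by rw [← h3 p hp]
  have hc : ContMDiffAt 𝓘(ℝ, E) (𝓘(ℝ, E).prod (𝓡 1)) ∞ (fun b : B ↦ (b, (e p).2)) (pr p) :=
    contMDiffAt_id.prodMk contMDiffAt_const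
  refine ⟨fun b ↦ e.symm (b, (e p).2), ?_, ?_, ?_⟩
  · exact (congrArg e.symm hp2).trans (e.left_inv hp)
  · refine ContMDiffAt.comp_of_eq (I' := 𝓘(ℝ, E).prod (𝓡 1)) (y := e p) ?_ hc hp2
    exact h2.contMDiffAt (e.open_target.mem_nhds (e.map_source hp))
  · have : ∀ᶠ b in 𝓝 (pr p), (b, (e p).2) ∈ e.target := by
      apply hc.continuousAt.eventually
      exact e.open_target.mem_nhds (by simpa only [hp2] using e.map_source hp)
    filter_upwards [this] with b hb
    rw [← h3 _ (e.map_target hb), e.right_inv hb]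

/-- In a trivialization vertical vectors are tangent to the circle factor, a line; and `v` spans
that line because `A` takes the value `i ≠ 0` on it. -/
lemma exists_eq_smul_fundamentalField (A : ConnectionForm F P) (p : P) (w : TangentSpace 𝓘(ℝ, F) p)
    (hw : mfderiv 𝓘(ℝ, F) 𝓘(ℝ, E) pr p w = 0) : ∃ c : ℝ, w = c • fundamentalField F p := by
  obtain ⟨e, hp, h1, h2, h3, he, h4⟩ := hpr.exists_trivialization_at p
  set de : F ≃L[ℝ] E × EuclideanSpace ℝ (Fin 1) := he.mfderiv hp with hde
  have hv1 : (de (fundamentalField F p)).1 = 0 :=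
    (h4 p hp _).symm.trans (hpr.mfderiv_proj_fundamentalField p)
  have hw1 : (de w).1 = 0 := (h4 p hp _).symm.trans hw
  have hv : (fundamentalField F p : F) ≠ 0 := by
    intro h
    have := A.form_fundamentalField p
    rw [show fundamentalField F p = 0 from h, map_zero] at this
    exact Complex.I_ne_zero this.symm
  have hv2 : (de (fundamentalField F p)).2 ≠ 0 := by
    intro h
    apply hv
    apply de.injective
    exact (Prod.ext hv1 h : de (fundamentalField F p) = 0).trans (map_zero de).symm
  obtain ⟨c, hc⟩ := exists_smul_eq_of_finrank_eq_one (K := ℝ) (by simp) hv2 (de w).2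
  refine ⟨c, ?_⟩
  apply de.injective
  rw [show de (c • fundamentalField F p) = c • de (fundamentalField F p) from map_smul de c _]
  exact Prod.ext (by rw [hw1, Prod.smul_fst, hv1, smul_zero]) (by rw [Prod.smul_snd, hc])

lemma eq_zero_of_vertical_of_horizontal (A : ConnectionForm F P) (p : P) (w : TangentSpace 𝓘(ℝ, F) p)
    (hw : mfderiv 𝓘(ℝ, F) 𝓘(ℝ, E) pr p w = 0) (hA : A.form p w = 0) : w = 0 := by
  obtain ⟨c, rfl⟩ := hpr.exists_eq_smul_fundamentalField A p w hw
  rw [map_smul, A.form_fundamentalField] at hA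
  have : c = 0 := by simpa using hA
  rw [this, zero_smul]

end IsPrincipalCircleBundle

/-- The real 1-form `α` with `A = i α`. -/
def ConnectionForm.re (A : ConnectionForm F P) (p : P) : TangentSpace 𝓘(ℝ, F) p →L[ℝ] ℝ :=
  Complex.imCLM ∘L A.form p

lemma ConnectionForm.form_eq (A : ConnectionForm F P) (p : P) (w : TangentSpace 𝓘(ℝ, F) p) :
    A.form p w = Complex.I * A.re p w := by
  apply Complex.ext <;> simp [ConnectionForm.re, A.imaginary]

lemma ConnectionForm.re_fundamentalField (A : ConnectionForm F P) (p : P) :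
    A.re p (fundamentalField F p) = 1 := by
  simp [ConnectionForm.re, A.form_fundamentalField]

lemma ConnectionForm.contMDiffAt_form (A : ConnectionForm F P)
    {W : ∀ p : P, TangentSpace 𝓘(ℝ, F) p} {p : P} (hW : CMDiffAt ∞ (T% W) p) :
    ContMDiffAt 𝓘(ℝ, F) 𝓘(ℝ, ℂ) ∞ (fun q ↦ A.form q (W q)) p := by
  have h : ContMDiffAt 𝓘(ℝ, F) (𝓘(ℝ, F).prod 𝓘(ℝ, ℂ)) ∞
      (fun q ↦ TotalSpace.mk' ℂ (E := Bundle.Trivial P ℂ) q (A.form q (W q))) p :=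
    ContMDiffAt.clm_bundle_apply (b := fun q : P ↦ q) (F₁ := F) (F₂ := ℂ) (A.contMDiff p) hW
  simp only [contMDiffAt_totalSpace] at h
  exact h.2

lemma ConnectionForm.mdifferentiableAt_form (A : ConnectionForm F P)
    {W : ∀ p : P, TangentSpace 𝓘(ℝ, F) p} {p : P} (hW : MDiffAt (T% W) p) :
    MDifferentiableAt 𝓘(ℝ, F) 𝓘(ℝ, ℂ) (fun q ↦ A.form q (W q)) p := by
  have h : MDifferentiableAt 𝓘(ℝ, F) (𝓘(ℝ, F).prod 𝓘(ℝ, ℂ))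
      (fun q ↦ TotalSpace.mk' ℂ (E := Bundle.Trivial P ℂ) q (A.form q (W q))) p :=
    MDifferentiableAt.clm_bundle_apply (b := fun q : P ↦ q) (F₁ := F) (F₂ := ℂ)
      ((A.contMDiff p).mdifferentiableAt (by simp)) hW
  simp only [mdifferentiableAt_totalSpace] at h
  exact h.2

lemma ConnectionForm.contMDiffAt_re (A : ConnectionForm F P)
    {W : ∀ p : P, TangentSpace 𝓘(ℝ, F) p} {p : P} (hW : CMDiffAt ∞ (T% W) p) :
    CMDiffAt ∞ (fun q ↦ A.re q (W q)) p :=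
  (Complex.imCLM.contMDiff _).comp p (A.contMDiffAt_form hW)

lemma ConnectionForm.mdifferentiableAt_re (A : ConnectionForm F P)
    {W : ∀ p : P, TangentSpace 𝓘(ℝ, F) p} {p : P} (hW : MDiffAt (T% W) p) :
    MDiffAt (fun q ↦ A.re q (W q)) p :=
  Complex.imCLM.mdifferentiableAt.comp p (A.mdifferentiableAt_form hW)

/-- Each of the two projections relates the fields to a pair one of which is zero, so both
components of the bracket vanish. -/
lemma mlieBracket_prodField_zero {X : ∀ p : P, TangentSpace 𝓘(ℝ, F) p} {q : ℝ × P}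
    (hX : MDiffAt (T% X) q.2) :
    mlieBracket (𝓘(ℝ, ℝ).prod 𝓘(ℝ, F))
      (prodField (fun t : ℝ ↦ (1 : TangentSpace 𝓘(ℝ, ℝ) t))
        (fun p : P ↦ (0 : TangentSpace 𝓘(ℝ, F) p)))
      (prodField (fun t : ℝ ↦ (0 : TangentSpace 𝓘(ℝ, ℝ) t)) X) q = 0 := by
  have h1 : MDiffAt (T% (fun t : ℝ ↦ (1 : TangentSpace 𝓘(ℝ, ℝ) t))) q.1 := by
    refine ContMDiffAt.mdifferentiableAt (n := 1) ?_ one_ne_zero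
    rw [contMDiffAt_vectorSpace_iff_contDiffAt]; exact contDiffAt_const
  have h0 : MDiffAt (T% (fun t : ℝ ↦ (0 : TangentSpace 𝓘(ℝ, ℝ) t))) q.1 :=
    mdifferentiable_zeroSection ℝ _ _
  have h0' : MDiffAt (T% (fun p : P ↦ (0 : TangentSpace 𝓘(ℝ, F) p))) q.2 :=
    mdifferentiable_zeroSection ℝ _ _
  have e1 := mfderiv_mlieBracket_of_related (f := Prod.fst) (x := q)
    (contMDiffAt_fst (I := 𝓘(ℝ, ℝ)) (J := 𝓘(ℝ, F)))
    (mdifferentiableAt_prodField h1 h0') (mdifferentiableAt_prodField h0 hX) h1 h0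
    (.of_forall fun y ↦ by rw [mfderiv_fst]; rfl) (.of_forall fun y ↦ by rw [mfderiv_fst]; rfl)
  have e2 := mfderiv_mlieBracket_of_related (f := Prod.snd) (x := q)
    (contMDiffAt_snd (I := 𝓘(ℝ, ℝ)) (J := 𝓘(ℝ, F)))
    (mdifferentiableAt_prodField h1 h0') (mdifferentiableAt_prodField h0 hX) h0' hX
    (.of_forall fun y ↦ by rw [mfderiv_snd]; rfl) (.of_forall fun y ↦ by rw [mfderiv_snd]; rfl)
  have z1 : mlieBracket 𝓘(ℝ, ℝ) (fun t : ℝ ↦ (1 : TangentSpace 𝓘(ℝ, ℝ) t))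
      (fun t : ℝ ↦ (0 : TangentSpace 𝓘(ℝ, ℝ) t)) q.1 = 0 :=
    congrFun (mlieBracket_zero_right (I := 𝓘(ℝ, ℝ))) q.1
  have z2 : mlieBracket 𝓘(ℝ, F) (fun p : P ↦ (0 : TangentSpace 𝓘(ℝ, F) p)) X q.2 = 0 :=
    congrFun (mlieBracket_zero_left (I := 𝓘(ℝ, F))) q.2
  rw [mfderiv_fst, z1] at e1
  rw [mfderiv_snd, z2] at e2
  exact Prod.ext e1 e2

/-! ### Horizontal lifts. -/

section Lift

variable (hpr : IsPrincipalCircleBundle E F pr) (A : ConnectionForm F P)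
include hpr

lemma horizontalLift_spec (X : ∀ b : B, TangentSpace 𝓘(ℝ, E) b) (p : P) :
    A.form p (horizontalLift pr A X p) = 0 ∧
      mfderiv 𝓘(ℝ, F) 𝓘(ℝ, E) pr p (horizontalLift pr A X p) = X (pr p) := by
  obtain ⟨L, hL, -, -⟩ := hpr.exists_local_lift p
  refine Classical.epsilon_spec (p := fun w : TangentSpace 𝓘(ℝ, F) p ↦
    A.form p w = 0 ∧ mfderiv 𝓘(ℝ, F) 𝓘(ℝ, E) pr p w = X (pr p))
    -- Any lift becomes horizontal once its `α`-component along `v` is removed; this witness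
    -- validates the choice made by `Classical.epsilon`.
    ⟨L X p - A.re p (L X p) • fundamentalField F p, ?_, ?_⟩
  · rw [map_sub, map_smul, A.form_fundamentalField, A.form_eq]
    simp [mul_comm]
  · rw [map_sub, map_smul, hpr.mfderiv_proj_fundamentalField, (hL X).self_of_nhds, smul_zero,
      sub_zero]

lemma form_horizontalLift (X : ∀ b : B, TangentSpace 𝓘(ℝ, E) b) (p : P) :
    A.form p (horizontalLift pr A X p) = 0 :=
  (horizontalLift_spec hpr A X p).1

lemma re_horizontalLift (X : ∀ b : B, TangentSpace 𝓘(ℝ, E) b) (p : P) :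
    A.re p (horizontalLift pr A X p) = 0 := by
  simp [ConnectionForm.re, form_horizontalLift hpr]

lemma mfderiv_proj_horizontalLift (X : ∀ b : B, TangentSpace 𝓘(ℝ, E) b) (p : P) :
    mfderiv 𝓘(ℝ, F) 𝓘(ℝ, E) pr p (horizontalLift pr A X p) = X (pr p) :=
  (horizontalLift_spec hpr A X p).2

/-- A tangent vector of `P` is determined by its projection and by the value of `A`. -/
lemma ext_of_proj_of_re {p : P} {w w' : TangentSpace 𝓘(ℝ, F) p}
    (h : mfderiv 𝓘(ℝ, F) 𝓘(ℝ, E) pr p w = mfderiv 𝓘(ℝ, F) 𝓘(ℝ, E) pr p w')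
    (hA : A.re p w = A.re p w') : w = w' := by
  rw [← sub_eq_zero]
  apply hpr.eq_zero_of_vertical_of_horizontal A
  · rw [map_sub, h, sub_self]
  · rw [A.form_eq, map_sub, hA, sub_self]; simp

lemma eq_lift_add_smul {p : P} (w : TangentSpace 𝓘(ℝ, F) p) (X : ∀ b : B, TangentSpace 𝓘(ℝ, E) b)
    (hX : X (pr p) = mfderiv 𝓘(ℝ, F) 𝓘(ℝ, E) pr p w) :
    w = horizontalLift pr A X p + A.re p w • fundamentalField F p := by
  apply ext_of_proj_of_re hpr A
  · rw [map_add, map_smul, mfderiv_proj_horizontalLift hpr, hpr.mfderiv_proj_fundamentalField, hX,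
      smul_zero, add_zero]
  · rw [map_add, map_smul, re_horizontalLift hpr, A.re_fundamentalField, smul_eq_mul, mul_one,
      zero_add]

lemma horizontalLift_eq_iff {X : ∀ b : B, TangentSpace 𝓘(ℝ, E) b} {p : P}
    {w : TangentSpace 𝓘(ℝ, F) p} : w = horizontalLift pr A X p ↔
      A.re p w = 0 ∧ mfderiv 𝓘(ℝ, F) 𝓘(ℝ, E) pr p w = X (pr p) := by
  constructor
  · rintro rfl
    exact ⟨re_horizontalLift hpr A X p, mfderiv_proj_horizontalLift hpr A X p⟩
  · rintro ⟨h1, h2⟩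
    apply ext_of_proj_of_re hpr A
    · rw [h2, mfderiv_proj_horizontalLift hpr]
    · rw [h1, re_horizontalLift hpr]

lemma horizontalLift_congr {X Y : ∀ b : B, TangentSpace 𝓘(ℝ, E) b} {p : P}
    (h : X (pr p) = Y (pr p)) : horizontalLift pr A X p = horizontalLift pr A Y p := by
  rw [horizontalLift_eq_iff hpr]
  exact ⟨re_horizontalLift hpr A X p, (mfderiv_proj_horizontalLift hpr A X p).trans h⟩

lemma horizontalLift_add (X Y : ∀ b : B, TangentSpace 𝓘(ℝ, E) b) (p : P) :
    horizontalLift pr A (fun b ↦ X b + Y b) p =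
      horizontalLift pr A X p + horizontalLift pr A Y p := by
  symm
  rw [horizontalLift_eq_iff hpr, map_add, map_add, re_horizontalLift hpr, re_horizontalLift hpr,
    mfderiv_proj_horizontalLift hpr, mfderiv_proj_horizontalLift hpr]
  simp

lemma horizontalLift_sub (X Y : ∀ b : B, TangentSpace 𝓘(ℝ, E) b) (p : P) :
    horizontalLift pr A (fun b ↦ X b - Y b) p =
      horizontalLift pr A X p - horizontalLift pr A Y p := by
  symm
  rw [horizontalLift_eq_iff hpr, map_sub, map_sub, re_horizontalLift hpr, re_horizontalLift hpr,
    mfderiv_proj_horizontalLift hpr, mfderiv_proj_horizontalLift hpr]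
  simp

lemma horizontalLift_smul (f : B → ℝ) (X : ∀ b : B, TangentSpace 𝓘(ℝ, E) b) (p : P) :
    horizontalLift pr A (fun b ↦ f b • X b) p = f (pr p) • horizontalLift pr A X p := by
  symm
  rw [horizontalLift_eq_iff hpr, map_smul, map_smul, re_horizontalLift hpr,
    mfderiv_proj_horizontalLift hpr]
  simp

lemma horizontalLift_zero (p : P) :
    horizontalLift pr A (fun b ↦ (0 : TangentSpace 𝓘(ℝ, E) b)) p = 0 := by
  symm
  rw [horizontalLift_eq_iff hpr]
  simp

lemma horizontalLift_eventuallyEq {L : ∀ p : P, TangentSpace 𝓘(ℝ, F) p} {p : P}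
    {X : ∀ b : B, TangentSpace 𝓘(ℝ, E) b}
    (hL : ∀ᶠ q in 𝓝 p, mfderiv 𝓘(ℝ, F) 𝓘(ℝ, E) pr q (L q) = X (pr q)) :
    T% (horizontalLift pr A X) =ᶠ[𝓝 p] T% (L - (fun q ↦ A.re q (L q)) •
      (fundamentalField F : ∀ q : P, TangentSpace 𝓘(ℝ, F) q)) := by
  filter_upwards [hL] with q hq
  have := eq_lift_add_smul hpr A (L q) X hq.symm
  rw [← sub_eq_iff_eq_add] at this
  rw [← this]
  rfl

lemma contMDiffAt_horizontalLift {X : ∀ b : B, TangentSpace 𝓘(ℝ, E) b} {p : P}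
    (hX : CMDiffAt ∞ (T% X) (pr p)) : CMDiffAt ∞ (T% (horizontalLift pr A X)) p := by
  obtain ⟨L, hL, -, hL'⟩ := hpr.exists_local_lift p
  exact ((hL' X hX).sub_section ((A.contMDiffAt_re (hL' X hX)).smul_section
    (hpr.contMDiff_fundamentalField p))).congr_of_eventuallyEq
      (horizontalLift_eventuallyEq hpr A (hL X))

lemma contMDiff_horizontalLift {X : ∀ b : B, TangentSpace 𝓘(ℝ, E) b}
    (hX : CMDiff ∞ (T% X)) : CMDiff ∞ (T% (horizontalLift pr A X)) :=
  fun p ↦ contMDiffAt_horizontalLift hpr A (hX (pr p))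

lemma mdifferentiableAt_horizontalLift {X : ∀ b : B, TangentSpace 𝓘(ℝ, E) b} {p : P}
    (hX : MDiffAt (T% X) (pr p)) : MDiffAt (T% (horizontalLift pr A X)) p := by
  obtain ⟨L, hL, hL', -⟩ := hpr.exists_local_lift p
  exact (mdifferentiableAt_sub_section (hL' X hX) ((A.mdifferentiableAt_re (hL' X hX)).smul_section
    ((hpr.contMDiff_fundamentalField p).mdifferentiableAt (by simp)))).congr_of_eventuallyEq
      (horizontalLift_eventuallyEq hpr A (hL X))

/-- A vector field on `B` is smooth if its horizontal lift is. -/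
lemma contMDiff_of_horizontalLift {X : ∀ b : B, TangentSpace 𝓘(ℝ, E) b}
    (hX : CMDiff ∞ (T% (horizontalLift pr A X))) : CMDiff ∞ (T% X) := by
  intro b
  obtain ⟨p, rfl⟩ := hpr.surjective b
  -- Near `pr p`, the field `X` is the projection of its lift evaluated along a smooth local
  -- section.
  obtain ⟨s, hsp, hs, hs'⟩ := hpr.exists_local_section p
  have h1 : ContMDiff 𝓘(ℝ, F) 𝓘(ℝ, E).tangent ∞ (fun q : P ↦
      (⟨pr q, X (pr q)⟩ : TangentBundle 𝓘(ℝ, E) B)) := by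
    have h := (hpr.contMDiff_proj.contMDiff_tangentMap (m := ∞) (by simp)).comp hX
    refine h.congr fun q ↦ ?_
    exact congrArg (fun w ↦ (⟨pr q, w⟩ : TangentBundle 𝓘(ℝ, E) B))
      (mfderiv_proj_horizontalLift hpr A X q).symm
  refine ((h1 (s (pr p))).comp (pr p) hs).congr_of_eventuallyEq ?_
  filter_upwards [hs'] with b hb
  have h2 : ∀ b', b' = b → (⟨b, X b⟩ : TangentBundle 𝓘(ℝ, E) B) = ⟨b', X b'⟩ := by
    rintro _ rfl; rfl
  exact h2 _ hb

/-! ### Brackets of horizontal lifts -/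

lemma mfderiv_proj_mfderiv_smul (z : Circle) (p : P) (w : TangentSpace 𝓘(ℝ, F) p) :
    (mfderiv 𝓘(ℝ, F) 𝓘(ℝ, E) pr (z • p) (mfderiv 𝓘(ℝ, F) 𝓘(ℝ, F) (fun q : P ↦ z • q) p w) : E) =
      mfderiv 𝓘(ℝ, F) 𝓘(ℝ, E) pr p w := by
  have h1 : pr ∘ (fun q : P ↦ z • q) = pr := funext fun q ↦ hpr.proj_smul z q
  have h2 := mfderiv_comp_apply (I := 𝓘(ℝ, F)) (I' := 𝓘(ℝ, F)) (I'' := 𝓘(ℝ, E))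
    (f := fun q : P ↦ z • q) (g := pr) p
    (hpr.contMDiff_proj.mdifferentiableAt (by simp))
    ((hpr.contMDiff_const_smul z).mdifferentiableAt (by simp)) w
  rw [h1] at h2
  exact h2.symm

lemma mfderiv_smul_horizontalLift (z : Circle) (X : ∀ b : B, TangentSpace 𝓘(ℝ, E) b) (p : P) :
    mfderiv 𝓘(ℝ, F) 𝓘(ℝ, F) (fun q : P ↦ z • q) p (horizontalLift pr A X p) =
      horizontalLift pr A X (z • p) := by
  rw [horizontalLift_eq_iff hpr]
  constructor
  · simp [ConnectionForm.re, A.invariant, form_horizontalLift hpr]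
  · refine (mfderiv_proj_mfderiv_smul hpr z p _).trans ?_
    refine (mfderiv_proj_horizontalLift hpr A X p).trans ?_
    exact congrArg (fun b ↦ (X b : E)) (hpr.proj_smul z p).symm

/-- Infinitesimal form of the invariance of lifts, obtained without flows. The action map `ℝ × P →
P` relates `(∂ₜ, 0)` to `v` and, by invariance, `(0, X̂)` to `X̂`; the two fields upstairs commute,
hence so do their images. -/
lemma mlieBracket_fundamentalField_horizontalLift {X : ∀ b : B, TangentSpace 𝓘(ℝ, E) b} {p : P}
    (hX : MDiffAt (T% X) (pr p)) :
    mlieBracket 𝓘(ℝ, F) (fundamentalField F) (horizontalLift pr A X) p = 0 := by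
  have hL := mdifferentiableAt_horizontalLift hpr A hX
  have hv : MDiffAt (T% (fundamentalField F : ∀ p : P, TangentSpace 𝓘(ℝ, F) p)) p :=
    (hpr.contMDiff_fundamentalField p).mdifferentiableAt (by simp)
  have h1 : MDiffAt (T% (fun t : ℝ ↦ (1 : TangentSpace 𝓘(ℝ, ℝ) t))) (0 : ℝ) := by
    refine ContMDiffAt.mdifferentiableAt (n := 1) ?_ one_ne_zero
    rw [contMDiffAt_vectorSpace_iff_contDiffAt]; exact contDiffAt_const
  have h0 : MDiffAt (T% (fun t : ℝ ↦ (0 : TangentSpace 𝓘(ℝ, ℝ) t))) (0 : ℝ) :=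
    mdifferentiable_zeroSection ℝ _ _
  have h0' : MDiffAt (T% (fun p : P ↦ (0 : TangentSpace 𝓘(ℝ, F) p))) p :=
    mdifferentiable_zeroSection ℝ _ _
  have hp : Circle.exp 0 • p = p := by simp
  have e := mfderiv_mlieBracket_of_related (f := fun q : ℝ × P ↦ Circle.exp q.1 • q.2)
    (x := ((0 : ℝ), p)) (I' := 𝓘(ℝ, F)) (V' := fundamentalField F) (W' := horizontalLift pr A X)
    (hpr.contMDiff_exp_smul _) (mdifferentiableAt_prodField h1 h0')
    (mdifferentiableAt_prodField h0 hL) (by simpa only [hp] using hv)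
    (by simpa only [hp] using hL)
    (.of_forall fun y ↦ hpr.mfderiv_exp_smul_left y)
    (.of_forall fun y ↦ (hpr.mfderiv_exp_smul_right y.1 y.2 _).trans
      (mfderiv_smul_horizontalLift hpr A _ X y.2))
  rw [mlieBracket_prodField_zero (q := ((0 : ℝ), p)) hL] at e
  have e0 := e.symm.trans (map_zero (mfderiv (𝓘(ℝ, ℝ).prod 𝓘(ℝ, F)) 𝓘(ℝ, F)
    (fun q : ℝ × P ↦ Circle.exp q.1 • q.2) ((0 : ℝ), p)))
  exact (show ∀ q : P, q = p →
    (mlieBracket 𝓘(ℝ, F) (fundamentalField F) (horizontalLift pr A X) q : F) = 0 →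
    (mlieBracket 𝓘(ℝ, F) (fundamentalField F) (horizontalLift pr A X) p : F) = 0 by
      rintro _ rfl h; exact h) _ hp e0

lemma mfderiv_proj_mlieBracket_horizontalLift {X Y : ∀ b : B, TangentSpace 𝓘(ℝ, E) b} {p : P}
    (hX : MDiffAt (T% X) (pr p)) (hY : MDiffAt (T% Y) (pr p)) :
    mfderiv 𝓘(ℝ, F) 𝓘(ℝ, E) pr p
      (mlieBracket 𝓘(ℝ, F) (horizontalLift pr A X) (horizontalLift pr A Y) p) =
        mlieBracket 𝓘(ℝ, E) X Y (pr p) :=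
  mfderiv_mlieBracket_of_related (hpr.contMDiff_proj p)
    (mdifferentiableAt_horizontalLift hpr A hX) (mdifferentiableAt_horizontalLift hpr A hY) hX hY
    (.of_forall fun q ↦ mfderiv_proj_horizontalLift hpr A X q)
    (.of_forall fun q ↦ mfderiv_proj_horizontalLift hpr A Y q)

lemma mlieBracket_horizontalLift {X Y : ∀ b : B, TangentSpace 𝓘(ℝ, E) b} {p : P}
    (hX : MDiffAt (T% X) (pr p)) (hY : MDiffAt (T% Y) (pr p)) :
    mlieBracket 𝓘(ℝ, F) (horizontalLift pr A X) (horizontalLift pr A Y) p =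
      horizontalLift pr A (mlieBracket 𝓘(ℝ, E) X Y) p +
        A.re p (mlieBracket 𝓘(ℝ, F) (horizontalLift pr A X) (horizontalLift pr A Y) p) •
          fundamentalField F p :=
  eq_lift_add_smul hpr A _ _ (mfderiv_proj_mlieBracket_horizontalLift hpr A hX hY).symm

/-- The curvature is invariant under the action of the circle. -/
lemma re_mlieBracket_smul {X Y : ∀ b : B, TangentSpace 𝓘(ℝ, E) b} {p : P} (z : Circle)
    (hX : MDiffAt (T% X) (pr p)) (hY : MDiffAt (T% Y) (pr p)) :
    A.re (z • p) (mlieBracket 𝓘(ℝ, F) (horizontalLift pr A X) (horizontalLift pr A Y) (z • p)) =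
      A.re p (mlieBracket 𝓘(ℝ, F) (horizontalLift pr A X) (horizontalLift pr A Y) p) := by
  have hz : pr (z • p) = pr p := hpr.proj_smul z p
  have h := mfderiv_mlieBracket_of_related (f := fun q : P ↦ z • q) (x := p)
    (hpr.contMDiff_const_smul z p) (mdifferentiableAt_horizontalLift hpr A hX)
    (mdifferentiableAt_horizontalLift hpr A hY)
    (mdifferentiableAt_horizontalLift hpr A (p := z • p) (by rwa [hz]))
    (mdifferentiableAt_horizontalLift hpr A (p := z • p) (by rwa [hz]))
    (.of_forall fun q ↦ mfderiv_smul_horizontalLift hpr A z X q)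
    (.of_forall fun q ↦ mfderiv_smul_horizontalLift hpr A z Y q)
  rw [← h]
  simp only [ConnectionForm.re, ContinuousLinearMap.comp_apply, A.invariant]

end Lift
end CircleBundle

/-! ### Regularity of pairings under the base metric. -/

section Base

variable {E : Type*} [NormedAddCommGroup E] [NormedSpace ℝ E]
  {B : Type*} [TopologicalSpace B] [ChartedSpace E B] [IsManifold 𝓘(ℝ, E) ∞ B]
  (g : PseudoRiemannianMetric E B)

lemma PseudoRiemannianMetric.ext_of_val {x : B} {u u' : TangentSpace 𝓘(ℝ, E) x}
    (h : ∀ w, g.val x u w = g.val x u' w) : u = u' := by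
  rw [← sub_eq_zero]
  exact g.nondegenerate x _ fun w ↦ by rw [map_sub, sub_apply, h, sub_self]

variable {E' : Type*} [NormedAddCommGroup E'] [NormedSpace ℝ E'] {H' : Type*} [TopologicalSpace H']
  {I' : ModelWithCorners ℝ E' H'} {N : Type*} [TopologicalSpace N] [ChartedSpace H' N]

/-- Stated for fields along a map into `B`, so as to apply to projections of fields of `P`, which
need not come from fields of `B`. -/
lemma PseudoRiemannianMetric.contMDiffAt_val {f : N → B} {X Y : ∀ y : N, TangentSpace 𝓘(ℝ, E) (f y)}
    {y : N} (hX : ContMDiffAt I' 𝓘(ℝ, E).tangent ∞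
      (fun y ↦ (⟨f y, X y⟩ : TangentBundle 𝓘(ℝ, E) B)) y)
    (hY : ContMDiffAt I' 𝓘(ℝ, E).tangent ∞
      (fun y ↦ (⟨f y, Y y⟩ : TangentBundle 𝓘(ℝ, E) B)) y) :
    ContMDiffAt I' 𝓘(ℝ, ℝ) ∞ (fun y ↦ g.val (f y) (X y) (Y y)) y := by
  have hf : ContMDiffAt I' 𝓘(ℝ, E) ∞ f y := by
    have h := hX
    simp only [contMDiffAt_totalSpace] at h
    exact h.1
  have h : ContMDiffAt I' (𝓘(ℝ, E).prod 𝓘(ℝ, ℝ)) ∞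
      (fun y ↦ TotalSpace.mk' ℝ (E := Bundle.Trivial B ℝ) (f y) (g.val (f y) (X y) (Y y))) y :=
    ContMDiffAt.clm_bundle_apply₂ (F₁ := E) (F₂ := E) (b := f)
      ((g.contMDiff (f y)).comp y hf) hX hY
  simp only [contMDiffAt_totalSpace] at h
  exact h.2

variable {g} in
lemma PseudoRiemannianMetric.contMDiff_val {X Y : ∀ x : B, TangentSpace 𝓘(ℝ, E) x}
    (hX : CMDiff ∞ (T% X)) (hY : CMDiff ∞ (T% Y)) : CMDiff ∞ (fun b ↦ g.val b (X b) (Y b)) :=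
  fun b ↦ g.contMDiffAt_val (f := fun b : B ↦ b) (hX b) (hY b)

lemma PseudoRiemannianMetric.mdifferentiableAt_val {X Y : ∀ x : B, TangentSpace 𝓘(ℝ, E) x} {x : B}
    (hX : MDiffAt (T% X) x) (hY : MDiffAt (T% Y) x) : MDiffAt (fun b ↦ g.val b (X b) (Y b)) x := by
  have h : MDifferentiableAt 𝓘(ℝ, E) (𝓘(ℝ, E).prod 𝓘(ℝ, ℝ))
      (fun y ↦ TotalSpace.mk' ℝ (E := Bundle.Trivial B ℝ) y (g.val y (X y) (Y y))) x :=
    MDifferentiableAt.clm_bundle_apply₂ (F₁ := E) (F₂ := E) (b := fun b : B ↦ b)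
      ((g.contMDiff x).mdifferentiableAt (by simp)) hX hY
  simp only [mdifferentiableAt_totalSpace] at h
  exact h.2

end Base

/-! ### The Levi-Civita connection of the Kaluza-Klein metric. -/

section KaluzaKleinConnection

variable {E : Type*} [NormedAddCommGroup E] [NormedSpace ℝ E] [FiniteDimensional ℝ E]
  {B : Type*} [TopologicalSpace B] [ChartedSpace E B] [IsManifold 𝓘(ℝ, E) ∞ B]
  {F : Type*} [NormedAddCommGroup F] [NormedSpace ℝ F] [FiniteDimensional ℝ F]
  {P : Type*} [TopologicalSpace P] [ChartedSpace F P] [IsManifold 𝓘(ℝ, F) ∞ P]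
  [MulAction Circle P]
  {g : PseudoRiemannianMetric E B} {σ : ℝ} {pr : P → B} {A : ConnectionForm F P}

lemma kaluzaKleinMetric_apply (p : P) (w w' : TangentSpace 𝓘(ℝ, F) p) :
    kaluzaKleinMetric g σ pr A p w w' =
      g.val (pr p) (mfderiv 𝓘(ℝ, F) 𝓘(ℝ, E) pr p w) (mfderiv 𝓘(ℝ, F) 𝓘(ℝ, E) pr p w')
        - σ * (A.re p w * A.re p w') := by
  rw [kaluzaKleinMetric, A.form_eq, A.form_eq]
  simp
  ring

lemma kaluzaKleinMetric_symm (p : P) (w w' : TangentSpace 𝓘(ℝ, F) p) :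
    kaluzaKleinMetric g σ pr A p w w' = kaluzaKleinMetric g σ pr A p w' w := by
  rw [kaluzaKleinMetric_apply, kaluzaKleinMetric_apply, g.symm, mul_comm (A.re p w)]

lemma kaluzaKleinMetric_sub (p : P) (w w' u : TangentSpace 𝓘(ℝ, F) p) :
    kaluzaKleinMetric g σ pr A p (w - w') u =
      kaluzaKleinMetric g σ pr A p w u - kaluzaKleinMetric g σ pr A p w' u := by
  simp only [kaluzaKleinMetric_apply, map_sub, sub_apply]
  ring

variable (hpr : IsPrincipalCircleBundle E F pr)
include hpr

lemma contMDiff_kaluzaKleinMetric {W Z : ∀ p : P, TangentSpace 𝓘(ℝ, F) p}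
    (hW : CMDiff ∞ (T% W)) (hZ : CMDiff ∞ (T% Z)) :
    CMDiff ∞ (fun p ↦ kaluzaKleinMetric g σ pr A p (W p) (Z p)) := by
  intro p
  simp only [kaluzaKleinMetric_apply]
  have h := hpr.contMDiff_proj.contMDiff_tangentMap (m := ∞) (by simp)
  exact (g.contMDiffAt_val (f := pr) ((h.comp hW) p) ((h.comp hZ) p)).sub
    (contMDiffAt_const.mul ((A.contMDiffAt_re (hW p)).mul (A.contMDiffAt_re (hZ p))))

lemma kaluzaKleinMetric_horizontalLift (p : P) (w : TangentSpace 𝓘(ℝ, F) p)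
    (X : ∀ b : B, TangentSpace 𝓘(ℝ, E) b) :
    kaluzaKleinMetric g σ pr A p w (horizontalLift pr A X p) =
      g.val (pr p) (mfderiv 𝓘(ℝ, F) 𝓘(ℝ, E) pr p w) (X (pr p)) := by
  rw [kaluzaKleinMetric_apply, mfderiv_proj_horizontalLift hpr, re_horizontalLift hpr]
  simp

lemma kaluzaKleinMetric_fundamentalField (p : P) (w : TangentSpace 𝓘(ℝ, F) p) :
    kaluzaKleinMetric g σ pr A p w (fundamentalField F p) = -(σ * A.re p w) := by
  rw [kaluzaKleinMetric_apply, hpr.mfderiv_proj_fundamentalField, A.re_fundamentalField]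
  simp

lemma kaluzaKleinMetric_lift_lift (X Y : ∀ b : B, TangentSpace 𝓘(ℝ, E) b) (p : P) :
    kaluzaKleinMetric g σ pr A p (horizontalLift pr A X p) (horizontalLift pr A Y p) =
      g.val (pr p) (X (pr p)) (Y (pr p)) := by
  rw [kaluzaKleinMetric_horizontalLift hpr, mfderiv_proj_horizontalLift hpr]

lemma kaluzaKleinMetric_lift_fundamentalField (X : ∀ b : B, TangentSpace 𝓘(ℝ, E) b) (p : P) :
    kaluzaKleinMetric g σ pr A p (horizontalLift pr A X p) (fundamentalField F p) = 0 := by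
  rw [kaluzaKleinMetric_fundamentalField hpr, re_horizontalLift hpr]; simp

lemma kaluzaKleinMetric_fundamentalField_lift (X : ∀ b : B, TangentSpace 𝓘(ℝ, E) b) (p : P) :
    kaluzaKleinMetric g σ pr A p (fundamentalField F p) (horizontalLift pr A X p) = 0 := by
  rw [kaluzaKleinMetric_symm, kaluzaKleinMetric_lift_fundamentalField hpr]

lemma kaluzaKleinMetric_fundamentalField_self (p : P) :
    kaluzaKleinMetric g σ pr A p (fundamentalField F p) (fundamentalField F p) = -σ := by
  rw [kaluzaKleinMetric_fundamentalField hpr, A.re_fundamentalField, mul_one]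

lemma mvfderiv_comp_proj {f : B → ℝ} {p : P} (hf : MDiffAt f (pr p))
    (w : TangentSpace 𝓘(ℝ, F) p) :
    mvfderiv 𝓘(ℝ, F) (fun q ↦ f (pr q)) p w =
      mvfderiv 𝓘(ℝ, E) f (pr p) (mfderiv 𝓘(ℝ, F) 𝓘(ℝ, E) pr p w) :=
  mvfderiv_comp_apply' p hf (hpr.contMDiff_proj.mdifferentiableAt (by simp)) w

variable {D : CovariantDerivative 𝓘(ℝ, F) F (fun p : P ↦ TangentSpace 𝓘(ℝ, F) p)}
  (hD : IsLeviCivita (kaluzaKleinMetric g σ pr A) D)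

lemma mdifferentiableAt_fundamentalField (p : P) :
    MDiffAt (T% (fundamentalField F : ∀ p : P, TangentSpace 𝓘(ℝ, F) p)) p :=
  (hpr.contMDiff_fundamentalField p).mdifferentiableAt (by simp)

include hD

lemma mlieBracket_horizontalLift_fundamentalField {X : ∀ b : B, TangentSpace 𝓘(ℝ, E) b} {p : P}
    (hX : MDiffAt (T% X) (pr p)) :
    mlieBracket 𝓘(ℝ, F) (horizontalLift pr A X) (fundamentalField F) p = 0 := by
  rw [mlieBracket_swap_apply, mlieBracket_fundamentalField_horizontalLift hpr A hX, neg_zero]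

/-- `2 g̃(D_X̂ v, Ẑ) = σ α([X̂, Ẑ])`. -/
lemma metric_cov_fundamentalField_lift {X Z : ∀ b : B, TangentSpace 𝓘(ℝ, E) b} {p : P}
    (hX : MDiffAt (T% X) (pr p)) (hZ : MDiffAt (T% Z) (pr p)) :
    2 * g.val (pr p) (mfderiv 𝓘(ℝ, F) 𝓘(ℝ, E) pr p
      (D (fundamentalField F) p (horizontalLift pr A X p))) (Z (pr p)) =
      σ * A.re p (mlieBracket 𝓘(ℝ, F) (horizontalLift pr A X) (horizontalLift pr A Z) p) := by
  have k := hD.koszul kaluzaKleinMetric_symm kaluzaKleinMetric_sub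
    (mdifferentiableAt_horizontalLift hpr A hX) (mdifferentiableAt_fundamentalField hpr p)
    (mdifferentiableAt_horizontalLift hpr A hZ)
  simp only [kaluzaKleinMetric_lift_lift hpr, kaluzaKleinMetric_lift_fundamentalField hpr,
    kaluzaKleinMetric_fundamentalField_lift hpr, kaluzaKleinMetric_fundamentalField hpr,
    kaluzaKleinMetric_horizontalLift hpr,
    mlieBracket_horizontalLift_fundamentalField hpr hD hX,
    mlieBracket_fundamentalField_horizontalLift hpr A hZ, mvfderiv_const,
    mvfderiv_comp_proj hpr (f := fun b ↦ g.val b (X b) (Z b)) (g.mdifferentiableAt_val hX hZ),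
    hpr.mfderiv_proj_fundamentalField] at k
  rw [k]
  simp

/-- The square `g̃(v, v) = -σ` is constant, so `D v` is orthogonal to `v`, that is, horizontal. -/
lemma re_cov_fundamentalField (hσ : σ ≠ 0) {p : P} (w : TangentSpace 𝓘(ℝ, F) p) :
    A.re p (D (fundamentalField F) p w) = 0 := by
  have k := hD.metric _ _ p (mdifferentiableAt_fundamentalField hpr p)
    (mdifferentiableAt_fundamentalField hpr p) w
  simp only [kaluzaKleinMetric_fundamentalField_self hpr, mvfderiv_const] at k
  rw [kaluzaKleinMetric_symm p (fundamentalField F p), kaluzaKleinMetric_fundamentalField hpr] at k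
  simp at k
  have : σ * A.re p (D (fundamentalField F) p w) = 0 := by linarith
  simpa [hσ] using this

lemma cov_fundamentalField_fundamentalField (hσ : σ ≠ 0) (p : P) :
    D (fundamentalField F) p (fundamentalField F p) = 0 := by
  apply ext_of_proj_of_re hpr A
  · rw [map_zero]
    apply g.ext_of_val
    intro u
    have hZ : MDiffAt (T% (FiberBundle.extend E u)) (pr p) := FiberBundle.mdifferentiableAt_extend ..
    have k := hD.koszul kaluzaKleinMetric_symm kaluzaKleinMetric_sub
      (mdifferentiableAt_fundamentalField hpr p) (mdifferentiableAt_fundamentalField hpr p)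
      (mdifferentiableAt_horizontalLift hpr A hZ)
    simp only [kaluzaKleinMetric_fundamentalField_self hpr,
      kaluzaKleinMetric_fundamentalField_lift hpr, kaluzaKleinMetric_fundamentalField hpr,
      kaluzaKleinMetric_horizontalLift hpr, mlieBracket_self,
      mlieBracket_fundamentalField_horizontalLift hpr A hZ, mvfderiv_const] at k
    simpa using k
  · rw [re_cov_fundamentalField hpr hD hσ, map_zero]

/-- The operator is `u ↦ T pr (D_û v)`, computed at one point of the fibre; invariance of the
curvature under the circle gives the formula at all other points. This makes the `Classical.epsilon`
in `phi` meaningful. -/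
lemma exists_phi : ∃ φ : ∀ b : B, TangentSpace 𝓘(ℝ, E) b →L[ℝ] TangentSpace 𝓘(ℝ, E) b,
    ∀ (X Y : ∀ b : B, TangentSpace 𝓘(ℝ, E) b) (p : P),
      MDiffAt (T% X) (pr p) → MDiffAt (T% Y) (pr p) →
      g.val (pr p) (φ (pr p) (X (pr p))) (Y (pr p)) = σ / 2 *
        A.re p (mlieBracket 𝓘(ℝ, F) (horizontalLift pr A X) (horizontalLift pr A Y) p) := by
  have key (b : B) : ∃ L : TangentSpace 𝓘(ℝ, E) b →L[ℝ] TangentSpace 𝓘(ℝ, E) b,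
      ∀ (X Y : ∀ b : B, TangentSpace 𝓘(ℝ, E) b),
      MDiffAt (T% X) b → MDiffAt (T% Y) b → ∀ p : P, pr p = b →
      g.val b (L (X b)) (Y b) = σ / 2 *
        A.re p (mlieBracket 𝓘(ℝ, F) (horizontalLift pr A X) (horizontalLift pr A Y) p) := by
    obtain ⟨q, rfl⟩ := hpr.surjective b
    let L : TangentSpace 𝓘(ℝ, E) (pr q) →ₗ[ℝ] TangentSpace 𝓘(ℝ, E) (pr q) :=
      { toFun := fun u ↦ mfderiv 𝓘(ℝ, F) 𝓘(ℝ, E) pr q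
          (D (fundamentalField F) q (horizontalLift pr A (FiberBundle.extend E u) q))
        map_add' := fun u u' ↦ by
          rw [← map_add, ← map_add, ← horizontalLift_add hpr]
          congr 2
          exact horizontalLift_congr hpr A (by simp)
        map_smul' := fun c u ↦ by
          rw [RingHom.id_apply, ← map_smul, ← map_smul,
            ← horizontalLift_smul hpr A (fun _ ↦ c)]
          congr 2
          exact horizontalLift_congr hpr A (by simp) }
    have : FiniteDimensional ℝ (TangentSpace 𝓘(ℝ, E) (pr q)) :=
      inferInstanceAs (FiniteDimensional ℝ E)
    have : T2Space (TangentSpace 𝓘(ℝ, E) (pr q)) := inferInstanceAs (T2Space E)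
    refine ⟨LinearMap.toContinuousLinearMap L, fun X Y hX hY p hp ↦ ?_⟩
    obtain ⟨z, rfl⟩ := hpr.exists_smul_eq hp.symm
    rw [re_mlieBracket_smul hpr A z hX hY]
    have h := metric_cov_fundamentalField_lift hpr hD hX hY
    have h' : horizontalLift pr A (FiberBundle.extend E (X (pr q))) q = horizontalLift pr A X q :=
      horizontalLift_congr hpr A (by simp)
    rw [← h'] at h
    change g.val (pr q) (mfderiv 𝓘(ℝ, F) 𝓘(ℝ, E) pr q (D (fundamentalField F) q
      (horizontalLift pr A (FiberBundle.extend E (X (pr q))) q))) (Y (pr q)) = _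
    linarith
  choose φ hφ using key
  exact ⟨φ, fun X Y p hX hY ↦ hφ _ X Y hX hY p rfl⟩

lemma metric_phi {X Y : ∀ b : B, TangentSpace 𝓘(ℝ, E) b} {p : P}
    (hX : MDiffAt (T% X) (pr p)) (hY : MDiffAt (T% Y) (pr p)) :
    g.val (pr p) (phi g σ pr A (pr p) (X (pr p))) (Y (pr p)) = σ / 2 *
        A.re p (mlieBracket 𝓘(ℝ, F) (horizontalLift pr A X) (horizontalLift pr A Y) p) := by
  -- Translation to real terms: `Ω(X, Y) = -i α([X̂, Ŷ])`, so `σ (i/2) Ω` is the real number `(σ/2)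
  -- α([X̂, Ŷ])`.
  have e (a : ℝ) : (σ : ℂ) * (Complex.I / 2) * -(Complex.I * a) = ((σ / 2 * a : ℝ) : ℂ) := by
    push_cast
    linear_combination (-(σ : ℂ) / 2 * a) * Complex.I_mul_I
  have h := Classical.epsilon_spec
    (p := fun φ : ∀ b : B, TangentSpace 𝓘(ℝ, E) b →L[ℝ] TangentSpace 𝓘(ℝ, E) b ↦
    ∀ (X Y : ∀ b : B, TangentSpace 𝓘(ℝ, E) b) (p : P),
      MDiffAt (T% X) (pr p) → MDiffAt (T% Y) (pr p) →
      (g.val (pr p) (φ (pr p) (X (pr p))) (Y (pr p)) : ℂ) =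
        σ * (Complex.I / 2) * curvatureForm pr A X Y p) (by
    obtain ⟨φ, hφ⟩ := exists_phi hpr hD
    refine ⟨φ, fun X Y p hX hY ↦ ?_⟩
    rw [hφ X Y p hX hY, curvatureForm, A.form_eq, e]) X Y p hX hY
  rw [curvatureForm, A.form_eq, e, Complex.ofReal_inj] at h
  exact h

lemma metric_phi_skew {b : B} (u w : TangentSpace 𝓘(ℝ, E) b) :
    g.val b (phi g σ pr A b u) w = -g.val b (phi g σ pr A b w) u := by
  obtain ⟨p, rfl⟩ := hpr.surjective b
  have hX : MDiffAt (T% (FiberBundle.extend E u)) (pr p) := FiberBundle.mdifferentiableAt_extend ..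
  have hY : MDiffAt (T% (FiberBundle.extend E w)) (pr p) := FiberBundle.mdifferentiableAt_extend ..
  have h1 := metric_phi hpr hD hX hY
  have h2 := metric_phi hpr hD hY hX
  rw [mlieBracket_swap_apply, map_neg] at h2
  simp only [FiberBundle.extend_apply_self] at h1 h2
  rw [h1, h2]; ring

lemma metric_phi_self {b : B} (u : TangentSpace 𝓘(ℝ, E) b) :
    g.val b (phi g σ pr A b u) u = 0 := by
  have := metric_phi_skew hpr hD u u
  linarith

lemma cov_fundamentalField_horizontalLift (hσ : σ ≠ 0) (X : ∀ b : B, TangentSpace 𝓘(ℝ, E) b) (p : P) :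
    D (fundamentalField F) p (horizontalLift pr A X p) =
      horizontalLift pr A (fun b ↦ phi g σ pr A b (X b)) p := by
  rw [horizontalLift_eq_iff hpr]
  refine ⟨re_cov_fundamentalField hpr hD hσ _, g.ext_of_val fun w ↦ ?_⟩
  have hX : MDiffAt (T% (FiberBundle.extend E (X (pr p)))) (pr p) :=
    FiberBundle.mdifferentiableAt_extend ..
  have hY : MDiffAt (T% (FiberBundle.extend E w)) (pr p) := FiberBundle.mdifferentiableAt_extend ..
  have h1 := metric_phi hpr hD hX hY
  have h2 := metric_cov_fundamentalField_lift hpr hD hX hY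
  have h' : horizontalLift pr A (FiberBundle.extend E (X (pr p))) p = horizontalLift pr A X p :=
    horizontalLift_congr hpr A (by simp)
  rw [h'] at h2
  simp only [FiberBundle.extend_apply_self] at h1 h2
  linarith

lemma cov_horizontalLift_fundamentalField (hσ : σ ≠ 0) {X : ∀ b : B, TangentSpace 𝓘(ℝ, E) b} {p : P}
    (hX : MDiffAt (T% X) (pr p)) :
    D (horizontalLift pr A X) p (fundamentalField F p) =
      horizontalLift pr A (fun b ↦ phi g σ pr A b (X b)) p := by
  have h := hD.torsion_free (horizontalLift pr A X) (fundamentalField F) p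
    (mdifferentiableAt_horizontalLift hpr A hX) (mdifferentiableAt_fundamentalField hpr p)
  rw [mlieBracket_horizontalLift_fundamentalField hpr hD hX,
    cov_fundamentalField_horizontalLift hpr hD hσ, sub_eq_zero] at h
  exact h.symm

/-- The choice defining `phi` carries no smoothness. It is recovered from the lift of `φ X`, which
is the smooth field `D_X̂ v`. -/
lemma contMDiff_phi (hσ : σ ≠ 0) {X : ∀ b : B, TangentSpace 𝓘(ℝ, E) b} (hX : CMDiff ∞ (T% X)) :
    CMDiff ∞ (T% (fun b ↦ phi g σ pr A b (X b))) := by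
  apply contMDiff_of_horizontalLift hpr A
  have h := cov_contMDiff D hD.smooth hpr.contMDiff_fundamentalField
    (contMDiff_horizontalLift hpr A hX)
  simpa only [cov_fundamentalField_horizontalLift hpr hD hσ] using h

/-- The horizontal part follows by comparing the Koszul formulas on `P` and `B` term by term; the
vertical part by differentiating `g̃(Ŷ, v) = 0` and using `D_X̂ v`. Only the value of `X` at `pr p`
matters, so `X` is replaced by a differentiable extension. -/
lemma cov_horizontalLift_horizontalLift (hσ : σ = 1 ∨ σ = -1)
    {nabla : CovariantDerivative 𝓘(ℝ, E) E (fun b : B ↦ TangentSpace 𝓘(ℝ, E) b)}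
    (hnabla : IsLeviCivita (fun b u w ↦ g.val b u w) nabla)
    (X : ∀ b : B, TangentSpace 𝓘(ℝ, E) b)
    {Y : ∀ b : B, TangentSpace 𝓘(ℝ, E) b} {p : P} (hY : MDiffAt (T% Y) (pr p)) :
    D (horizontalLift pr A Y) p (horizontalLift pr A X p) =
      horizontalLift pr A (fun b ↦ nabla Y b (X b)) p
        + (σ * g.val (pr p) (phi g σ pr A (pr p) (X (pr p))) (Y (pr p))) • fundamentalField F p := by
  have hσ0 : σ ≠ 0 := by rcases hσ with rfl | rfl <;> norm_num
  have hσ2 : σ * σ = 1 := by rcases hσ with rfl | rfl <;> norm_num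
  have hX : MDiffAt (T% (FiberBundle.extend E (X (pr p)))) (pr p) :=
    FiberBundle.mdifferentiableAt_extend ..
  have hX' : horizontalLift pr A (FiberBundle.extend E (X (pr p))) p = horizontalLift pr A X p :=
    horizontalLift_congr hpr A (by simp)
  have hv : A.re p (D (horizontalLift pr A Y) p (horizontalLift pr A X p)) =
      σ * g.val (pr p) (phi g σ pr A (pr p) (X (pr p))) (Y (pr p)) := by
    have h := hD.metric (horizontalLift pr A Y) (fundamentalField F) p
      (mdifferentiableAt_horizontalLift hpr A hY) (mdifferentiableAt_fundamentalField hpr p)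
      (horizontalLift pr A X p)
    simp only [kaluzaKleinMetric_lift_fundamentalField hpr, kaluzaKleinMetric_fundamentalField hpr,
      mvfderiv_const, cov_fundamentalField_horizontalLift hpr hD hσ0,
      kaluzaKleinMetric_lift_lift hpr] at h
    rw [g.symm] at h
    simp at h
    linear_combination (-A.re p (D (horizontalLift pr A Y) p (horizontalLift pr A X p))) * hσ2
      + σ * h
  rw [← hv]
  apply eq_lift_add_smul hpr
  apply g.ext_of_val
  intro w
  have hZ : MDiffAt (T% (FiberBundle.extend E w)) (pr p) := FiberBundle.mdifferentiableAt_extend ..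
  have k := hD.koszul kaluzaKleinMetric_symm kaluzaKleinMetric_sub
    (mdifferentiableAt_horizontalLift hpr A hX) (mdifferentiableAt_horizontalLift hpr A hY)
    (mdifferentiableAt_horizontalLift hpr A hZ)
  have k' := hnabla.koszul (fun b ↦ g.symm b) (fun b u u' w ↦ by simp) hX hY hZ
  simp only [kaluzaKleinMetric_lift_lift hpr, kaluzaKleinMetric_horizontalLift hpr,
    mfderiv_proj_mlieBracket_horizontalLift hpr A hX hY,
    mfderiv_proj_mlieBracket_horizontalLift hpr A hX hZ,
    mfderiv_proj_mlieBracket_horizontalLift hpr A hY hZ,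
    mvfderiv_comp_proj hpr (f := fun b ↦ g.val b (_ : TangentSpace 𝓘(ℝ, E) b) _)
      (g.mdifferentiableAt_val hX hZ),
    mvfderiv_comp_proj hpr (f := fun b ↦ g.val b (_ : TangentSpace 𝓘(ℝ, E) b) _)
      (g.mdifferentiableAt_val hX hY),
    mvfderiv_comp_proj hpr (f := fun b ↦ g.val b (_ : TangentSpace 𝓘(ℝ, E) b) _)
      (g.mdifferentiableAt_val hY hZ),
    mfderiv_proj_horizontalLift hpr, hX', FiberBundle.extend_apply_self] at k k'
  linarith

end KaluzaKleinConnection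

/-! ### The structure equations from either hypothesis. -/

section Parallel

variable {E : Type*} [NormedAddCommGroup E] [NormedSpace ℝ E] [FiniteDimensional ℝ E]
  {B : Type*} [TopologicalSpace B] [ChartedSpace E B] [IsManifold 𝓘(ℝ, E) ∞ B]
  {F : Type*} [NormedAddCommGroup F] [NormedSpace ℝ F] [FiniteDimensional ℝ F]
  {P : Type*} [TopologicalSpace P] [ChartedSpace F P] [IsManifold 𝓘(ℝ, F) ∞ P]
  [MulAction Circle P]
  {g : PseudoRiemannianMetric E B} {σ : ℝ} {pr : P → B} {A : ConnectionForm F P}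

/-- As `v` commutes with all horizontal lifts, the extra terms come only from differentiating the
coefficients. -/
lemma mlieBracket_lift_add_smul (hpr : IsPrincipalCircleBundle E F pr)
    {X Y : ∀ b : B, TangentSpace 𝓘(ℝ, E) b} {a c : P → ℝ} {p : P}
    (hX : MDiffAt (T% X) (pr p)) (hY : MDiffAt (T% Y) (pr p))
    (ha : MDiffAt a p) (hc : MDiffAt c p) :
    mlieBracket 𝓘(ℝ, F) (fun q ↦ horizontalLift pr A X q + a q • fundamentalField F q)
        (fun q ↦ horizontalLift pr A Y q + c q • fundamentalField F q) p =
      mlieBracket 𝓘(ℝ, F) (horizontalLift pr A X) (horizontalLift pr A Y) p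
        + (mvfderiv 𝓘(ℝ, F) c p (horizontalLift pr A X p + a p • fundamentalField F p)
          - mvfderiv 𝓘(ℝ, F) a p (horizontalLift pr A Y p + c p • fundamentalField F p)) •
            fundamentalField F p := by
  have hv := mdifferentiableAt_fundamentalField hpr p
  have hX' := mdifferentiableAt_horizontalLift hpr A hX
  have hY' := mdifferentiableAt_horizontalLift hpr A hY
  have hav : MDiffAt (T% (a • (fundamentalField F : ∀ p : P, TangentSpace 𝓘(ℝ, F) p))) p :=
    ha.smul_section hv
  have hcv : MDiffAt (T% (c • (fundamentalField F : ∀ p : P, TangentSpace 𝓘(ℝ, F) p))) p :=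
    hc.smul_section hv
  have hYv : MDiffAt (T% (horizontalLift pr A Y +
      c • (fundamentalField F : ∀ p : P, TangentSpace 𝓘(ℝ, F) p))) p :=
    mdifferentiableAt_add_section hY' hcv
  have h1 : mlieBracket 𝓘(ℝ, F) (fundamentalField F) (horizontalLift pr A Y +
      c • (fundamentalField F : ∀ p : P, TangentSpace 𝓘(ℝ, F) p)) p =
      mvfderiv 𝓘(ℝ, F) c p (fundamentalField F p) • fundamentalField F p := by
    rw [mlieBracket_add_right hY' hcv, mlieBracket_smul_right hc hv, mlieBracket_self,
      mlieBracket_fundamentalField_horizontalLift hpr A hY]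
    simp
  have h2 : mlieBracket 𝓘(ℝ, F) (horizontalLift pr A X) (fundamentalField F) p = 0 := by
    rw [mlieBracket_swap_apply, mlieBracket_fundamentalField_horizontalLift hpr A hX, neg_zero]
  change mlieBracket 𝓘(ℝ, F) (horizontalLift pr A X +
      a • (fundamentalField F : ∀ p : P, TangentSpace 𝓘(ℝ, F) p)) (horizontalLift pr A Y +
      c • (fundamentalField F : ∀ p : P, TangentSpace 𝓘(ℝ, F) p)) p = _
  rw [mlieBracket_add_left hX' hav, mlieBracket_smul_left ha hv, h1,
    mlieBracket_add_right hY' hcv, mlieBracket_smul_right hc hv, h2]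
  simp only [map_add, map_smul, Pi.add_apply, Pi.smul_apply', smul_eq_mul]
  module

variable {D : CovariantDerivative 𝓘(ℝ, F) F (fun p : P ↦ TangentSpace 𝓘(ℝ, F) p)}
  {nabla : CovariantDerivative 𝓘(ℝ, E) E (fun b : B ↦ TangentSpace 𝓘(ℝ, E) b)}
  {ξ : ∀ b : B, TangentSpace 𝓘(ℝ, E) b} {ε : P → ℝ}

/-- Both situations of the theorem lead to these structure equations. -/
structure StructureEquations (g : PseudoRiemannianMetric E B) (σ : ℝ) (pr : P → B)
    (A : ConnectionForm F P)
    (nabla : CovariantDerivative 𝓘(ℝ, E) E (fun b : B ↦ TangentSpace 𝓘(ℝ, E) b))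
    (ξ : ∀ b : B, TangentSpace 𝓘(ℝ, E) b) (ε : P → ℝ) : Prop where
  contMDiff : ContMDiff 𝓘(ℝ, F) 𝓘(ℝ, ℝ) ∞ ε
  mul_self (p : P) : ε p * ε p = 1
  phi_apply (b : B) : phi g σ pr A b (ξ b) = 0
  cov_apply (p : P) (w : TangentSpace 𝓘(ℝ, E) (pr p)) :
    nabla ξ (pr p) w = -(ε p) • phi g σ pr A (pr p) w

lemma eq_zero_of_eq_smul (hσ : σ ≠ 0) (hξσ : ∀ b, g.val b (ξ b) (ξ b) = σ) {b : B}
    {u : TangentSpace 𝓘(ℝ, E) b} {c : ℝ} (hu : u = c • ξ b) (h : g.val b u (ξ b) = 0) : u = 0 := by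
  rw [hu, map_smul, smul_apply, hξσ, smul_eq_mul, mul_eq_zero, or_iff_left hσ] at h
  rw [hu, h, zero_smul]

lemma metric_cov_self (hnabla : IsLeviCivita (fun b u w ↦ g.val b u w) nabla)
    (hξ : CMDiff ∞ (T% ξ)) (hξσ : ∀ b, g.val b (ξ b) (ξ b) = σ) (b : B)
    (w : TangentSpace 𝓘(ℝ, E) b) : g.val b (nabla ξ b w) (ξ b) = 0 := by
  have hd : MDiffAt (T% ξ) b := (hξ b).mdifferentiableAt (by simp)
  have h := hnabla.metric ξ ξ b hd hd w
  simp only [hξσ, mvfderiv_const] at h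
  rw [g.symm b (ξ b)] at h
  simp at h
  linarith

variable (hpr : IsPrincipalCircleBundle E F pr) (hD : IsLeviCivita (kaluzaKleinMetric g σ pr A) D)
  (hnabla : IsLeviCivita (fun b u w ↦ g.val b u w) nabla)
  (hσ : σ = 1 ∨ σ = -1) (hξ : CMDiff ∞ (T% ξ)) (hξσ : ∀ b, g.val b (ξ b) (ξ b) = σ)
include hpr hD hnabla hσ hξ hξσ

lemma HasRecurrentField.structureEquations (h : HasRecurrentField g σ pr A D ξ ε) :
    StructureEquations g σ pr A nabla ξ ε := by
  obtain ⟨f, k, hf, hk, hl, ⟨-, θ, hθ⟩, hε⟩ := h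
  have hσ0 : σ ≠ 0 := by rcases hσ with rfl | rfl <;> norm_num
  have hd (b : B) : MDiffAt (T% ξ) b := (hξ b).mdifferentiableAt (by simp)
  have hsq (p : P) : f p * f p = k p * k p := by
    have h := (hl p).2
    simp only [kaluzaKleinMetric_apply, map_add, map_smul, mfderiv_proj_horizontalLift hpr,
      hpr.mfderiv_proj_fundamentalField, re_horizontalLift hpr, A.re_fundamentalField, smul_apply,
      hξσ, smul_eq_mul, smul_zero, add_zero, mul_zero, zero_add, mul_one] at h
    have : σ * (f p * f p - k p * k p) = 0 := by linear_combination h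
    simpa [hσ0, sub_eq_zero] using this
  have hf0 (p : P) : f p ≠ 0 := fun h0 ↦ by
    have hk0 : k p = 0 := by simpa [h0] using (hsq p).symm
    exact (hl p).1 (by simp [h0, hk0])
  -- Nullity gives `k = ± f` with `f` nowhere zero, so the sign of `f k` is the quotient `k / f`;
  -- this also shows that `ε` is smooth.
  have hεk (p : P) : ε p = k p / f p := by
    rw [hε]
    have hpos : 0 < f p * f p := mul_self_pos.2 (hf0 p)
    rcases mul_self_eq_mul_self_iff.1 (hsq p) with h | h
    · rw [← h, Real.sign_of_pos hpos, div_self (hf0 p)]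
    · have h' : k p = -f p := by rw [h, neg_neg]
      rw [h', mul_neg, Real.sign_of_neg (by linarith), neg_div, div_self (hf0 p)]
  -- Projection of the recurrence equation to `TB`. The derivative of the coefficient `k` multiplies
  -- `v` and disappears; that of `f` only contributes a multiple of `ξ`.
  have hrec (p : P) (w : TangentSpace 𝓘(ℝ, F) p) :
      f p • mfderiv 𝓘(ℝ, F) 𝓘(ℝ, E) pr p (D (horizontalLift pr A ξ) p w) +
        k p • mfderiv 𝓘(ℝ, F) 𝓘(ℝ, E) pr p (D (fundamentalField F) p w) =
      (θ p w * f p - mvfderiv 𝓘(ℝ, F) f p w) • ξ (pr p) := by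
    have hfd : MDiffAt f p := (hf p).mdifferentiableAt (by simp)
    have hkd : MDiffAt k p := (hk p).mdifferentiableAt (by simp)
    have hv := mdifferentiableAt_fundamentalField hpr p
    have hl := mdifferentiableAt_horizontalLift hpr A (hd (pr p))
    have h := hθ p w
    rw [cov_add D (X := fun q ↦ f q • horizontalLift pr A ξ q)
      (Y := fun q ↦ k q • fundamentalField F q) (hfd.smul_section hl) (hkd.smul_section hv), add_apply, cov_smul D hfd hl,
      cov_smul D hkd hv] at h
    replace h := congrArg (mfderiv 𝓘(ℝ, F) 𝓘(ℝ, E) pr p) h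
    simp only [map_add, map_smul, mfderiv_proj_horizontalLift hpr,
      hpr.mfderiv_proj_fundamentalField, smul_zero, add_zero] at h
    rw [sub_smul, mul_smul, ← h]
    abel
  -- In the direction `v` the equation reads `f φ ξ = c ξ`; but `φ ξ` is orthogonal to `ξ`, which is
  -- not null, so both sides vanish.
  have hφ (b : B) : phi g σ pr A b (ξ b) = 0 := by
    obtain ⟨p, rfl⟩ := hpr.surjective b
    have h := hrec p (fundamentalField F p)
    rw [cov_fundamentalField_fundamentalField hpr hD hσ0,
      cov_horizontalLift_fundamentalField hpr hD hσ0 (hd _), mfderiv_proj_horizontalLift hpr,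
      map_zero, smul_zero, add_zero] at h
    have h0 := eq_zero_of_eq_smul hσ0 hξσ h
      (by rw [map_smul, smul_apply, metric_phi_self hpr hD, smul_zero])
    exact (smul_eq_zero.1 h0).resolve_left (hf0 p)
  refine ⟨?_, fun p ↦ ?_, hφ, fun p w ↦ ?_⟩
  · rw [show ε = fun p ↦ k p / f p from funext hεk]
    exact hk.div₀ hf hf0
  · rw [hεk, div_mul_div_comm, ← hsq, div_self (mul_ne_zero (hf0 p) (hf0 p))]
  · have h := hrec p (horizontalLift pr A (FiberBundle.extend E w) p)
    rw [cov_horizontalLift_horizontalLift hpr hD hσ hnabla _ (hd _),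
      cov_fundamentalField_horizontalLift hpr hD hσ0, map_add, map_smul,
      mfderiv_proj_horizontalLift hpr, mfderiv_proj_horizontalLift hpr,
      hpr.mfderiv_proj_fundamentalField, smul_zero, add_zero, FiberBundle.extend_apply_self] at h
    have h0 := eq_zero_of_eq_smul hσ0 hξσ h (by
      rw [map_add, map_smul, map_smul, add_apply, smul_apply, smul_apply,
        metric_cov_self hnabla hξ hξσ, metric_phi_skew hpr hD, hφ]
      simp)
    rw [hεk, div_eq_inv_mul, ← mul_neg, mul_smul, eq_inv_smul_iff₀ (hf0 p), neg_smul]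
    exact eq_neg_of_add_eq_zero_left h0

lemma IsKillingTwistOfFlat.structureEquations (h : IsKillingTwistOfFlat g σ pr A ξ ε) :
    StructureEquations g σ pr A nabla ξ ε := by
  obtain ⟨hK, hε, A₀, hA₀, hAA₀⟩ := h
  have hσ0 : σ ≠ 0 := by rcases hσ with rfl | rfl <;> norm_num
  have hσ2 : σ * σ = 1 := by rcases hσ with rfl | rfl <;> norm_num
  have hd (b : B) : MDiffAt (T% ξ) b := (hξ b).mdifferentiableAt (by simp)
  obtain ⟨e, he, hεe⟩ : ∃ e : ℝ, e * e = 1 ∧ ∀ p, ε p = e := by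
    rcases hε with h | h
    · exact ⟨1, by norm_num, h⟩
    · exact ⟨-1, by norm_num, h⟩
  have hre (p : P) (w : TangentSpace 𝓘(ℝ, F) p) : A.re p w = A₀.re p w +
      σ * e * g.val (pr p) (ξ (pr p)) (mfderiv 𝓘(ℝ, F) 𝓘(ℝ, E) pr p w) := by
    have h := hAA₀ p w
    rw [A.form_eq, A₀.form_eq, ← mul_add, hεe] at h
    exact_mod_cast mul_left_cancel₀ Complex.I_ne_zero h
  -- The Killing equation in pointwise form: `∇ ξ` is skew for `g`.
  have hkill (b : B) (u w : TangentSpace 𝓘(ℝ, E) b) :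
      g.val b (nabla ξ b u) w = -g.val b (nabla ξ b w) u := by
    have hX : MDiffAt (T% (FiberBundle.extend E u)) b := FiberBundle.mdifferentiableAt_extend ..
    have hY : MDiffAt (T% (FiberBundle.extend E w)) b := FiberBundle.mdifferentiableAt_extend ..
    have h := hK _ _ b hX hY
    have h' := hnabla.metric _ _ b hX hY (ξ b)
    rw [← hnabla.torsion_free _ _ b (hd b) hX, ← hnabla.torsion_free _ _ b (hd b) hY] at h
    simp only [FiberBundle.extend_apply_self, map_sub, sub_apply] at h h'
    rw [g.symm b u (nabla ξ b w)] at h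
    linarith
  have hcov (p : P) (w : TangentSpace 𝓘(ℝ, E) (pr p)) :
      nabla ξ (pr p) w = -e • phi g σ pr A (pr p) w := by
    apply g.ext_of_val
    intro u
    have hX : MDiffAt (T% (FiberBundle.extend E w)) (pr p) := FiberBundle.mdifferentiableAt_extend ..
    have hY : MDiffAt (T% (FiberBundle.extend E u)) (pr p) := FiberBundle.mdifferentiableAt_extend ..
    have hφ := metric_phi hpr hD hX hY
    -- As `α₀ = α - σ e η`, the lift for `A₀` is the lift for `A` corrected by `σ e η(X) v`.
    have hl (X : ∀ b : B, TangentSpace 𝓘(ℝ, E) b) : horizontalLift pr A₀ X = fun q ↦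
        horizontalLift pr A X q + (σ * e * g.val (pr q) (ξ (pr q)) (X (pr q))) •
          fundamentalField F q := by
      ext1 q
      have h := eq_lift_add_smul hpr A (horizontalLift pr A₀ X q) X
        (mfderiv_proj_horizontalLift hpr A₀ X q).symm
      rwa [hre, re_horizontalLift hpr, mfderiv_proj_horizontalLift hpr, zero_add] at h
    have hgX := g.mdifferentiableAt_val (hd (pr p)) hX
    have hgY := g.mdifferentiableAt_val (hd (pr p)) hY
    have hflat : A₀.re p (mlieBracket 𝓘(ℝ, F) (horizontalLift pr A₀ (FiberBundle.extend E w))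
        (horizontalLift pr A₀ (FiberBundle.extend E u)) p) = 0 := by
      have h := hA₀ _ _ p hX hY
      rw [curvatureForm, A₀.form_eq] at h
      simpa using h
    have hprd : MDiffAt pr p := hpr.contMDiff_proj.mdifferentiableAt (by simp)
    have hda {X : ∀ b : B, TangentSpace 𝓘(ℝ, E) b} (hX : MDiffAt (T% X) (pr p)) :
        MDiffAt (fun q ↦ σ * e * g.val (pr q) (ξ (pr q)) (X (pr q))) p :=
      mdifferentiableAt_const.mul ((g.mdifferentiableAt_val (hd (pr p)) hX).comp p hprd)
    have hdv {X : ∀ b : B, TangentSpace 𝓘(ℝ, E) b} (hX : MDiffAt (T% X) (pr p))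
        (w : TangentSpace 𝓘(ℝ, F) p) :
        mvfderiv 𝓘(ℝ, F) (fun q ↦ σ * e * g.val (pr q) (ξ (pr q)) (X (pr q))) p w =
        σ * e * (g.val (pr p) (nabla ξ (pr p) (mfderiv 𝓘(ℝ, F) 𝓘(ℝ, E) pr p w)) (X (pr p)) +
          g.val (pr p) (ξ (pr p)) (nabla X (pr p) (mfderiv 𝓘(ℝ, F) 𝓘(ℝ, E) pr p w))) := by
      rw [← hnabla.metric _ _ _ (hd _) hX,
        ← mvfderiv_comp_proj hpr (f := fun b ↦ g.val b (ξ b) (X b))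
        (g.mdifferentiableAt_val (hd (pr p)) hX)]
      exact mvfderiv_const_mul' (σ * e) ((g.mdifferentiableAt_val (hd (pr p)) hX).comp p hprd) w
    -- Evaluating `α = α₀ + σ e η` on the bracket of the `A₀`-lifts, where `α₀` vanishes by
    -- flatness, gives `α([X̂, Ŷ]) = -σ e dη(X, Y)`.
    have h0 := hre p (mlieBracket 𝓘(ℝ, F) (horizontalLift pr A₀ (FiberBundle.extend E w))
        (horizontalLift pr A₀ (FiberBundle.extend E u)) p)
    rw [hflat, mfderiv_proj_mlieBracket_horizontalLift hpr A₀ hX hY, hl, hl,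
      mlieBracket_lift_add_smul hpr hX hY (hda hX) (hda hY), hdv hX, hdv hY,
      ← hnabla.torsion_free _ _ _ hX hY] at h0
    simp only [map_add, map_smul, mfderiv_proj_horizontalLift hpr, A.re_fundamentalField,
      hpr.mfderiv_proj_fundamentalField, smul_zero, add_zero, FiberBundle.extend_apply_self,
      map_sub, smul_eq_mul, mul_one] at h0 hφ
    rw [hkill _ u w] at h0
    rw [map_smul, smul_apply, hφ, smul_eq_mul]
    linear_combination (e * σ / 2) * h0 - g.val (pr p) (nabla ξ (pr p) w) u * σ * σ * he
      - g.val (pr p) (nabla ξ (pr p) w) u * hσ2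
  refine ⟨?_, fun p ↦ by rw [hεe, he], fun b ↦ ?_, fun p w ↦ by rw [hcov, hεe]⟩
  · rw [show ε = fun _ ↦ e from funext hεe]
    exact contMDiff_const
  · obtain ⟨p, rfl⟩ := hpr.surjective b
    apply g.ext_of_val
    intro w
    -- Skewness turns the constancy of `g(ξ, ξ)` into `∇_ξ ξ = 0`, hence `φ ξ = 0`.
    have h := hkill (pr p) (ξ (pr p)) w
    rw [metric_cov_self hnabla hξ hξσ, neg_zero, hcov, map_smul, smul_apply, smul_eq_mul] at h
    have he0 : -e ≠ 0 := fun h ↦ by simp [neg_eq_zero.1 h] at he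
    rw [(mul_eq_zero.1 h).resolve_left he0, map_zero, zero_apply]

end Parallel

/-! ### The parallel field, the transverse connection and brackets of parallel lifts. -/

section Transverse

variable {E : Type*} [NormedAddCommGroup E] [NormedSpace ℝ E] [FiniteDimensional ℝ E]
  {B : Type*} [TopologicalSpace B] [ChartedSpace E B] [IsManifold 𝓘(ℝ, E) ∞ B]
  {F : Type*} [NormedAddCommGroup F] [NormedSpace ℝ F] [FiniteDimensional ℝ F]
  {P : Type*} [TopologicalSpace P] [ChartedSpace F P] [IsManifold 𝓘(ℝ, F) ∞ P]
  [MulAction Circle P]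

lemma mdifferentiableAt_of_contMDiff {X : ∀ b : B, TangentSpace 𝓘(ℝ, E) b}
    (hX : CMDiff ∞ (T% X)) (b : B) : MDiffAt (T% X) b :=
  (hX b).mdifferentiableAt (by simp)

/-- The Kaluza-Klein geometry of `pr : P → B` together with the structure equations. -/
structure ParallelGeometry (g : PseudoRiemannianMetric E B) (σ : ℝ) (pr : P → B)
    (A : ConnectionForm F P)
    (D : CovariantDerivative 𝓘(ℝ, F) F (fun p : P ↦ TangentSpace 𝓘(ℝ, F) p))
    (nabla : CovariantDerivative 𝓘(ℝ, E) E (fun b : B ↦ TangentSpace 𝓘(ℝ, E) b))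
    (ξ : ∀ b : B, TangentSpace 𝓘(ℝ, E) b) (ε : P → ℝ) : Prop
    extends StructureEquations g σ pr A nabla ξ ε where
  bundle : IsPrincipalCircleBundle E F pr
  leviCivita : IsLeviCivita (kaluzaKleinMetric g σ pr A) D
  leviCivita_base : IsLeviCivita (fun b u w ↦ g.val b u w) nabla
  sign : σ = 1 ∨ σ = -1
  contMDiff_field : CMDiff ∞ (T% ξ)
  metric_self (b : B) : g.val b (ξ b) (ξ b) = σ

/-- The combination of the horizontal lift and the fundamental field which is the horizontal lift
for fields orthogonal to `ξ`, and the parallel field `r` for `ξ`. -/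
def parallelLift (g : PseudoRiemannianMetric E B) (σ : ℝ) (pr : P → B)
    (A : ConnectionForm F P) (ξ : ∀ b : B, TangentSpace 𝓘(ℝ, E) b) (ε : P → ℝ)
    (W : ∀ b : B, TangentSpace 𝓘(ℝ, E) b) (p : P) : TangentSpace 𝓘(ℝ, F) p :=
  horizontalLift pr A W p + (σ * ε p * g.val (pr p) (ξ (pr p)) (W (pr p))) • fundamentalField F p

variable {g : PseudoRiemannianMetric E B} {σ : ℝ} {pr : P → B} {A : ConnectionForm F P}
  {D : CovariantDerivative 𝓘(ℝ, F) F (fun p : P ↦ TangentSpace 𝓘(ℝ, F) p)}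
  {nabla : CovariantDerivative 𝓘(ℝ, E) E (fun b : B ↦ TangentSpace 𝓘(ℝ, E) b)}
  {ξ : ∀ b : B, TangentSpace 𝓘(ℝ, E) b} {ε : P → ℝ}

lemma parallelLift_of_orthogonal {X : ∀ b : B, TangentSpace 𝓘(ℝ, E) b}
    (hX : ∀ b, g.val b (ξ b) (X b) = 0) :
    parallelLift g σ pr A ξ ε X = horizontalLift pr A X := by
  ext1 p
  simp [parallelLift, hX]

namespace ParallelGeometry

variable (H : ParallelGeometry g σ pr A D nabla ξ ε)
include H

lemma sign_mul_self : σ * σ = 1 := by rcases H.sign with rfl | rfl <;> norm_num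

lemma sign_ne_zero : σ ≠ 0 := by rcases H.sign with rfl | rfl <;> norm_num

lemma parallelLift_self : parallelLift g σ pr A ξ ε ξ = rField pr A ξ ε := by
  ext1 p
  rw [parallelLift, rField, H.metric_self, mul_right_comm, H.sign_mul_self, one_mul]

lemma mdifferentiableAt_sign (p : P) : MDiffAt ε p := (H.contMDiff p).mdifferentiableAt (by simp)

/-- Differentiate `ε² = 1`. The function `ε` is only locally constant in general, so its derivatives
have to be discarded explicitly. -/
lemma mvfderiv_sign (p : P) (w : TangentSpace 𝓘(ℝ, F) p) : mvfderiv 𝓘(ℝ, F) ε p w = 0 := by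
  have h := mvfderiv_mul (I := 𝓘(ℝ, F)) (H.mdifferentiableAt_sign p) (H.mdifferentiableAt_sign p)
  rw [show ε * ε = fun _ ↦ 1 from funext H.mul_self, mvfderiv_const] at h
  have h1 : (0 : ℝ) = ε p * mvfderiv 𝓘(ℝ, F) ε p w + ε p * mvfderiv 𝓘(ℝ, F) ε p w :=
    congrArg (fun L : F →L[ℝ] ℝ ↦ L w) h
  have h2 : ε p ≠ 0 := fun h ↦ by simpa [h] using H.mul_self p
  have : ε p * mvfderiv 𝓘(ℝ, F) ε p w = 0 := by linarith
  exact (mul_eq_zero.1 this).resolve_left h2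

lemma mvfderiv_sign_mul {f : B → ℝ} {p : P} (hf : MDiffAt f (pr p)) (c : ℝ)
    (w : TangentSpace 𝓘(ℝ, F) p) :
    MDiffAt (fun q ↦ c * ε q * f (pr q)) p ∧
    mvfderiv 𝓘(ℝ, F) (fun q ↦ c * ε q * f (pr q)) p w =
      c * ε p * mvfderiv 𝓘(ℝ, E) f (pr p) (mfderiv 𝓘(ℝ, F) 𝓘(ℝ, E) pr p w) := by
  have hf' : MDiffAt (fun q ↦ f (pr q)) p :=
    hf.comp p (H.bundle.contMDiff_proj.mdifferentiableAt (by simp))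
  have hc : MDiffAt (fun q ↦ c * ε q) p := mdifferentiableAt_const.mul (H.mdifferentiableAt_sign p)
  have h1 : mvfderiv 𝓘(ℝ, F) (fun q ↦ c * ε q) p w = 0 := by
    rw [mvfderiv_const_mul' c (H.mdifferentiableAt_sign p), H.mvfderiv_sign, mul_zero]
  refine ⟨hc.mul hf', ?_⟩
  have h := mvfderiv_mul (I := 𝓘(ℝ, F)) hc hf'
  refine (congrArg (fun L : F →L[ℝ] ℝ ↦ L w) h).trans ?_
  change c * ε p * mvfderiv 𝓘(ℝ, F) (fun q ↦ f (pr q)) p w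
    + f (pr p) * mvfderiv 𝓘(ℝ, F) (fun q ↦ c * ε q) p w = _
  rw [h1, mul_zero, add_zero, mvfderiv_comp_proj H.bundle hf]

lemma mfderiv_proj_parallelLift (W : ∀ b : B, TangentSpace 𝓘(ℝ, E) b) (p : P) :
    mfderiv 𝓘(ℝ, F) 𝓘(ℝ, E) pr p (parallelLift g σ pr A ξ ε W p) = W (pr p) := by
  rw [parallelLift, map_add, map_smul, mfderiv_proj_horizontalLift H.bundle,
    H.bundle.mfderiv_proj_fundamentalField, smul_zero, add_zero]

lemma contMDiff_parallelLift {W : ∀ b : B, TangentSpace 𝓘(ℝ, E) b} (hW : CMDiff ∞ (T% W)) :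
    CMDiff ∞ (T% (parallelLift g σ pr A ξ ε W)) := fun p ↦
  ((contMDiff_horizontalLift H.bundle A hW) p).add_section (ContMDiffAt.smul_section
    ((contMDiffAt_const.mul (H.contMDiff p)).mul
      (((PseudoRiemannianMetric.contMDiff_val H.contMDiff_field hW).comp H.bundle.contMDiff_proj) p))
    (H.bundle.contMDiff_fundamentalField p))

lemma contMDiff_rField : CMDiff ∞ (T% (rField pr A ξ ε)) := by
  have h := H.contMDiff_parallelLift H.contMDiff_field
  rwa [H.parallelLift_self] at h

lemma metric_field_phi {b : B} (u : TangentSpace 𝓘(ℝ, E) b) :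
    g.val b (ξ b) (phi g σ pr A b u) = 0 := by
  rw [g.symm, metric_phi_skew H.bundle H.leviCivita, H.phi_apply]
  simp

lemma metric_phi_field {b : B} (u : TangentSpace 𝓘(ℝ, E) b) :
    g.val b (phi g σ pr A b u) (ξ b) = 0 := by
  rw [g.symm, H.metric_field_phi]

lemma phi_transverse {X : ∀ b : B, TangentSpace 𝓘(ℝ, E) b} (hX : CMDiff ∞ (T% X)) :
    IsTransverseSection g ξ (fun b ↦ phi g σ pr A b (X b)) :=
  ⟨contMDiff_phi H.bundle H.leviCivita H.sign_ne_zero hX, fun _ ↦ H.metric_field_phi _⟩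

/-- The field `r` is parallel. -/
lemma cov_rField (p : P) (w : TangentSpace 𝓘(ℝ, F) p) : D (rField pr A ξ ε) p w = 0 := by
  have hl := mdifferentiableAt_horizontalLift H.bundle A
    (mdifferentiableAt_of_contMDiff H.contMDiff_field (pr p))
  have hv := mdifferentiableAt_fundamentalField H.bundle p
  have h1 (w : TangentSpace 𝓘(ℝ, F) p) : D (rField pr A ξ ε) p w =
      D (horizontalLift pr A ξ) p w + ε p • D (fundamentalField F) p w := by
    change D (fun q ↦ horizontalLift pr A ξ q + ε q • fundamentalField F q) p w = _
    rw [cov_add D (Y := fun q ↦ ε q • fundamentalField F q) hl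
      ((H.mdifferentiableAt_sign p).smul_section hv), add_apply,
      cov_smul D (H.mdifferentiableAt_sign p) hv, H.mvfderiv_sign, zero_smul, add_zero]
  have h2 := eq_lift_add_smul H.bundle A w (FiberBundle.extend E
    (mfderiv 𝓘(ℝ, F) 𝓘(ℝ, E) pr p w)) (by simp)
  rw [h2, map_add, map_smul, h1, h1, cov_fundamentalField_fundamentalField H.bundle H.leviCivita
    H.sign_ne_zero, cov_fundamentalField_horizontalLift H.bundle H.leviCivita H.sign_ne_zero,
    cov_horizontalLift_fundamentalField H.bundle H.leviCivita H.sign_ne_zero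
      (mdifferentiableAt_of_contMDiff H.contMDiff_field _),
    cov_horizontalLift_horizontalLift H.bundle H.leviCivita H.sign H.leviCivita_base _
      (mdifferentiableAt_of_contMDiff H.contMDiff_field _), H.metric_phi_field]
  have h3 : horizontalLift pr A (fun b ↦ phi g σ pr A b (ξ b)) p = 0 := by
    rw [← horizontalLift_zero H.bundle A p]
    exact horizontalLift_congr H.bundle A (H.phi_apply _)
  have h4 (X : ∀ b : B, TangentSpace 𝓘(ℝ, E) b) :
      horizontalLift pr A (fun b ↦ nabla ξ b (X b)) p =
        -(ε p) • horizontalLift pr A (fun b ↦ phi g σ pr A b (X b)) p := by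
    rw [← horizontalLift_smul H.bundle A (fun _ ↦ -(ε p))]
    exact horizontalLift_congr H.bundle A (H.cov_apply p _)
  rw [h3, h4]
  module

/-! ### The transverse connection -/

lemma contMDiff_mlieBracket {X Y : ∀ b : B, TangentSpace 𝓘(ℝ, E) b} (hX : CMDiff ∞ (T% X))
    (hY : CMDiff ∞ (T% Y)) : CMDiff ∞ (T% (fun b ↦ mlieBracket 𝓘(ℝ, E) X Y b)) := by
  have h (b : B) := H.leviCivita_base.torsion_free X Y b (mdifferentiableAt_of_contMDiff hX _)
    (mdifferentiableAt_of_contMDiff hY _)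
  simp only [← h]
  exact fun b ↦ (cov_contMDiff nabla H.leviCivita_base.smooth hY hX b).sub_section
    (cov_contMDiff nabla H.leviCivita_base.smooth hX hY b)

/-- Differentiate the constant `g(ξ, Y)` and insert `∇ ξ = -ε φ`. Allowing any constant covers both
sections of `𝒟` (`c = 0`) and `ξ` itself (`c = σ`). -/
lemma metric_field_cov {Y : ∀ b : B, TangentSpace 𝓘(ℝ, E) b} {c : ℝ} (hY : CMDiff ∞ (T% Y))
    (hc : ∀ b, g.val b (ξ b) (Y b) = c) (p : P) (w : TangentSpace 𝓘(ℝ, E) (pr p)) :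
    g.val (pr p) (ξ (pr p)) (nabla Y (pr p) w) =
      ε p * g.val (pr p) (phi g σ pr A (pr p) w) (Y (pr p)) := by
  have h := H.leviCivita_base.metric ξ Y (pr p)
    (mdifferentiableAt_of_contMDiff H.contMDiff_field _) (mdifferentiableAt_of_contMDiff hY _) w
  simp only [hc, mvfderiv_const, H.cov_apply, map_smul, smul_apply, zero_apply, smul_eq_mul] at h
  linarith

/-- The structure equations replace the projections and the bracket by tensorial terms in `∇` and
`φ`. The field `W` is arbitrary because the curvature involves `[W₁, W₂]`, whose component along `ξ`
need not be constant. -/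
lemma transverseDeriv_eq {Y : ∀ b : B, TangentSpace 𝓘(ℝ, E) b} (hY : IsTransverseSection g ξ Y)
    (W : ∀ b : B, TangentSpace 𝓘(ℝ, E) b) (p : P) :
    transverseDeriv g σ ξ nabla W Y (pr p) = nabla Y (pr p) (W (pr p))
      + (σ * ε p * g.val (pr p) (ξ (pr p)) (W (pr p))) • phi g σ pr A (pr p) (Y (pr p))
      - (σ * ε p * g.val (pr p) (phi g σ pr A (pr p) (W (pr p))) (Y (pr p))) • ξ (pr p) := by
  have hb := H.leviCivita_base.torsion_free ξ Y (pr p)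
    (mdifferentiableAt_of_contMDiff H.contMDiff_field _) (mdifferentiableAt_of_contMDiff hY.1 _)
  rw [transverseDeriv, ← hb]
  simp only [transverseProj, H.cov_apply, map_sub, map_smul, H.metric_field_cov hY.1 hY.2,
    H.metric_field_phi, H.phi_apply, map_zero, zero_apply, smul_eq_mul]
  module

lemma metric_transverseProj (b : B) (w : TangentSpace 𝓘(ℝ, E) b) :
    g.val b (ξ b) (transverseProj g σ ξ b w) = 0 := by
  rw [transverseProj, map_sub, map_smul, H.metric_self, smul_eq_mul, mul_right_comm,
    H.sign_mul_self, one_mul, sub_self]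

lemma transverseProj_transverse {X : ∀ b : B, TangentSpace 𝓘(ℝ, E) b} (hX : CMDiff ∞ (T% X)) :
    IsTransverseSection g ξ (fun b ↦ transverseProj g σ ξ b (X b)) :=
  ⟨fun b ↦ (hX b).sub_section (ContMDiffAt.smul_section (contMDiffAt_const.mul
      (PseudoRiemannianMetric.contMDiff_val H.contMDiff_field hX b)) (H.contMDiff_field b)),
    fun b ↦ H.metric_transverseProj b _⟩

lemma transverseDeriv_transverse {W Y : ∀ b : B, TangentSpace 𝓘(ℝ, E) b} (hW : CMDiff ∞ (T% W))
    (hY : IsTransverseSection g ξ Y) :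
    IsTransverseSection g ξ (transverseDeriv g σ ξ nabla W Y) := by
  have hproj {X : ∀ b : B, TangentSpace 𝓘(ℝ, E) b} (hX : CMDiff ∞ (T% X)) :=
    (H.transverseProj_transverse hX).1
  constructor
  · have hbr := H.contMDiff_mlieBracket H.contMDiff_field hY.1
    intro b
    exact (hproj (cov_contMDiff nabla H.leviCivita_base.smooth hY.1 (hproj hW)) b).add_section
      (ContMDiffAt.smul_section (contMDiffAt_const.mul
        (PseudoRiemannianMetric.contMDiff_val H.contMDiff_field hW b)) (hproj hbr b))
  · intro b
    rw [transverseDeriv, map_add, map_smul, H.metric_transverseProj, H.metric_transverseProj,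
      smul_zero, add_zero]

/-- The transverse connection is metric. -/
lemma metric_transverseDeriv {U Y : ∀ b : B, TangentSpace 𝓘(ℝ, E) b}
    (hU : IsTransverseSection g ξ U) (hY : IsTransverseSection g ξ Y)
    (W : ∀ b : B, TangentSpace 𝓘(ℝ, E) b) (b : B) :
    mvfderiv 𝓘(ℝ, E) (fun b ↦ g.val b (U b) (Y b)) b (W b) =
      g.val b (transverseDeriv g σ ξ nabla W U b) (Y b)
        + g.val b (U b) (transverseDeriv g σ ξ nabla W Y b) := by
  obtain ⟨p, rfl⟩ := H.bundle.surjective b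
  have h := H.leviCivita_base.metric U Y (pr p) (mdifferentiableAt_of_contMDiff hU.1 _)
    (mdifferentiableAt_of_contMDiff hY.1 _) (W (pr p))
  have hs := metric_phi_skew H.bundle H.leviCivita (U (pr p)) (Y (pr p))
  rw [g.symm (pr p) (phi g σ pr A (pr p) (Y (pr p)))] at hs
  rw [h, H.transverseDeriv_eq hU, H.transverseDeriv_eq hY]
  simp only [map_add, map_sub, map_smul, add_apply, sub_apply, smul_apply, smul_eq_mul, hY.2]
  rw [g.symm (pr p) (U (pr p)) (ξ (pr p)), hU.2, hs]
  ring

/-- The vertical term `σ g(φ W, Y) v` equals `σ ε g(φ W, Y) (r - ξ̂)`. The part along `ξ̂` is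
exactly the correction that turns `∇` into `∇^𝒟`, leaving a multiple of the parallel field `r`. -/
lemma cov_horizontalLift_parallelLift {Y : ∀ b : B, TangentSpace 𝓘(ℝ, E) b}
    (hY : IsTransverseSection g ξ Y) (W : ∀ b : B, TangentSpace 𝓘(ℝ, E) b) (p : P) :
    D (horizontalLift pr A Y) p (parallelLift g σ pr A ξ ε W p) =
      horizontalLift pr A (transverseDeriv g σ ξ nabla W Y) p
        + (σ * ε p * g.val (pr p) (phi g σ pr A (pr p) (W (pr p))) (Y (pr p))) •
          rField pr A ξ ε p := by
  have hY' := mdifferentiableAt_of_contMDiff hY.1 (pr p)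
  set a := σ * ε p * g.val (pr p) (ξ (pr p)) (W (pr p)) with ha
  set c := g.val (pr p) (phi g σ pr A (pr p) (W (pr p))) (Y (pr p)) with hc
  have h1 : horizontalLift pr A (transverseDeriv g σ ξ nabla W Y) p =
      horizontalLift pr A (fun b ↦ nabla Y b (W b)) p
        + a • horizontalLift pr A (fun b ↦ phi g σ pr A b (Y b)) p
        - (σ * ε p * c) • horizontalLift pr A ξ p := by
    rw [← horizontalLift_smul H.bundle A (fun _ ↦ a), ← horizontalLift_add H.bundle A,
      ← horizontalLift_smul H.bundle A (fun _ ↦ σ * ε p * c), ← horizontalLift_sub H.bundle A]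
    exact horizontalLift_congr H.bundle A (H.transverseDeriv_eq hY W p)
  have h2 : σ * ε p * c * ε p = σ * c := by linear_combination (σ * c) * H.mul_self p
  rw [parallelLift, map_add, map_smul, cov_horizontalLift_horizontalLift H.bundle H.leviCivita
    H.sign H.leviCivita_base _ hY', cov_horizontalLift_fundamentalField H.bundle H.leviCivita
    H.sign_ne_zero hY', h1, rField, smul_add, smul_smul, h2]
  abel

lemma cov_fundamentalField_parallelLift (W : ∀ b : B, TangentSpace 𝓘(ℝ, E) b) (p : P) :
    D (fundamentalField F) p (parallelLift g σ pr A ξ ε W p) =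
      horizontalLift pr A (fun b ↦ phi g σ pr A b (W b)) p := by
  rw [parallelLift, map_add, map_smul, cov_fundamentalField_horizontalLift H.bundle H.leviCivita
    H.sign_ne_zero, cov_fundamentalField_fundamentalField H.bundle H.leviCivita H.sign_ne_zero,
    smul_zero, add_zero]

lemma re_mlieBracket_horizontalLift {X Y : ∀ b : B, TangentSpace 𝓘(ℝ, E) b} {p : P}
    (hX : MDiffAt (T% X) (pr p)) (hY : MDiffAt (T% Y) (pr p)) :
    A.re p (mlieBracket 𝓘(ℝ, F) (horizontalLift pr A X) (horizontalLift pr A Y) p) =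
      2 * σ * g.val (pr p) (phi g σ pr A (pr p) (X (pr p))) (Y (pr p)) := by
  rw [metric_phi H.bundle H.leviCivita hX hY]
  linear_combination (-A.re p (mlieBracket 𝓘(ℝ, F) (horizontalLift pr A X)
    (horizontalLift pr A Y) p)) * H.sign_mul_self

lemma metric_field_mlieBracket {W₁ W₂ : ∀ b : B, TangentSpace 𝓘(ℝ, E) b} {c₁ c₂ : ℝ}
    (h₁ : CMDiff ∞ (T% W₁)) (h₂ : CMDiff ∞ (T% W₂)) (hc₁ : ∀ b, g.val b (ξ b) (W₁ b) = c₁)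
    (hc₂ : ∀ b, g.val b (ξ b) (W₂ b) = c₂) (p : P) :
    g.val (pr p) (ξ (pr p)) (mlieBracket 𝓘(ℝ, E) W₁ W₂ (pr p)) =
      2 * ε p * g.val (pr p) (phi g σ pr A (pr p) (W₁ (pr p))) (W₂ (pr p)) := by
  rw [← H.leviCivita_base.torsion_free _ _ _ (mdifferentiableAt_of_contMDiff h₁ _)
    (mdifferentiableAt_of_contMDiff h₂ _), map_sub, H.metric_field_cov h₁ hc₁,
    H.metric_field_cov h₂ hc₂, metric_phi_skew H.bundle H.leviCivita (W₂ (pr p))]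
  ring

/-- Both sides project to `[W₁, W₂]`. With `η(W₁)` and `η(W₂)` constant, the `α`-component on the
left is `2 σ g(φ W₁, W₂)`; on the right it is `σ ε η([W₁, W₂])`, which agrees as `ε² = 1`. -/
lemma mlieBracket_parallelLift {W₁ W₂ : ∀ b : B, TangentSpace 𝓘(ℝ, E) b} {c₁ c₂ : ℝ}
    (h₁ : CMDiff ∞ (T% W₁)) (h₂ : CMDiff ∞ (T% W₂)) (hc₁ : ∀ b, g.val b (ξ b) (W₁ b) = c₁)
    (hc₂ : ∀ b, g.val b (ξ b) (W₂ b) = c₂) (p : P) :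
    mlieBracket 𝓘(ℝ, F) (parallelLift g σ pr A ξ ε W₁) (parallelLift g σ pr A ξ ε W₂) p =
      parallelLift g σ pr A ξ ε (mlieBracket 𝓘(ℝ, E) W₁ W₂) p := by
  have hX := mdifferentiableAt_of_contMDiff h₁ (pr p)
  have hY := mdifferentiableAt_of_contMDiff h₂ (pr p)
  have hd (c : ℝ) (w : TangentSpace 𝓘(ℝ, F) p) :=
    H.mvfderiv_sign_mul (f := fun _ ↦ c) (p := p) mdifferentiableAt_const σ w
  have he (W : ∀ b : B, TangentSpace 𝓘(ℝ, E) b) (c : ℝ) (hc : ∀ b, g.val b (ξ b) (W b) = c) :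
      parallelLift g σ pr A ξ ε W = fun q ↦ horizontalLift pr A W q
        + (σ * ε q * c) • fundamentalField F q := by
    ext1 q
    rw [parallelLift, hc]
  rw [he _ _ hc₁, he _ _ hc₂, mlieBracket_lift_add_smul H.bundle hX hY (hd c₁ 0).1 (hd c₂ 0).1,
    (hd _ _).2, (hd _ _).2, mlieBracket_horizontalLift H.bundle A hX hY,
    H.re_mlieBracket_horizontalLift hX hY, parallelLift, H.metric_field_mlieBracket h₁ h₂ hc₁ hc₂]
  simp only [mvfderiv_const, zero_apply, mul_zero, sub_self, zero_smul, add_zero]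
  congr 2
  linear_combination (-2 * σ * g.val (pr p) (phi g σ pr A (pr p) (W₁ (pr p))) (W₂ (pr p)))
    * H.mul_self p

/-- By torsion-freeness the bracket is the difference of `D_W̄ v` and `D_v W̄`, both equal to the
lift of `φ W`. -/
lemma mlieBracket_parallelLift_fundamentalField {W : ∀ b : B, TangentSpace 𝓘(ℝ, E) b} {c : ℝ}
    (hW : CMDiff ∞ (T% W)) (hc : ∀ b, g.val b (ξ b) (W b) = c) (p : P) :
    mlieBracket 𝓘(ℝ, F) (parallelLift g σ pr A ξ ε W) (fundamentalField F) p = 0 := by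
  have hv := mdifferentiableAt_fundamentalField H.bundle p
  have hf := H.leviCivita.torsion_free (parallelLift g σ pr A ξ ε W) (fundamentalField F) p
    (mdifferentiableAt_of_contMDiff (H.contMDiff_parallelLift hW) p) hv
  have hd (w : TangentSpace 𝓘(ℝ, F) p) :=
    H.mvfderiv_sign_mul (f := fun _ ↦ c) (p := p) mdifferentiableAt_const σ w
  have hl := mdifferentiableAt_horizontalLift H.bundle A (mdifferentiableAt_of_contMDiff hW (pr p))
  have he : parallelLift g σ pr A ξ ε W = fun q ↦ horizontalLift pr A W q
      + (σ * ε q * c) • fundamentalField F q := by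
    ext1 q
    rw [parallelLift, hc]
  rw [← hf, H.cov_fundamentalField_parallelLift, he,
    cov_add D (Y := fun q ↦ (σ * ε q * c) • fundamentalField F q) hl
      ((hd 0).1.smul_section hv), add_apply, cov_smul D (hd 0).1 hv, (hd _).2,
    cov_fundamentalField_fundamentalField H.bundle H.leviCivita H.sign_ne_zero,
    cov_horizontalLift_fundamentalField H.bundle H.leviCivita H.sign_ne_zero
      (mdifferentiableAt_of_contMDiff hW _)]
  rw [mvfderiv_const]
  simp

end ParallelGeometry
end Transverse

/-! ### Curvature on parallel lifts and on the fundamental field. -/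

section Curvature

variable {E : Type*} [NormedAddCommGroup E] [NormedSpace ℝ E] [FiniteDimensional ℝ E]
  {B : Type*} [TopologicalSpace B] [ChartedSpace E B] [IsManifold 𝓘(ℝ, E) ∞ B]
  {F : Type*} [NormedAddCommGroup F] [NormedSpace ℝ F] [FiniteDimensional ℝ F]
  {P : Type*} [TopologicalSpace P] [ChartedSpace F P] [IsManifold 𝓘(ℝ, F) ∞ P]
  [MulAction Circle P]
  {g : PseudoRiemannianMetric E B} {σ : ℝ} {pr : P → B} {A : ConnectionForm F P}
  {D : CovariantDerivative 𝓘(ℝ, F) F (fun p : P ↦ TangentSpace 𝓘(ℝ, F) p)}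
  {nabla : CovariantDerivative 𝓘(ℝ, E) E (fun b : B ↦ TangentSpace 𝓘(ℝ, E) b)}
  {ξ : ∀ b : B, TangentSpace 𝓘(ℝ, E) b} {ε : P → ℝ}

/-- The exterior derivative of `φ` for the transverse connection,
`∇^𝒟_{W₁} (φ W₂) - ∇^𝒟_{W₂} (φ W₁) - φ [W₁, W₂]`. -/
def extDerivPhi (g : PseudoRiemannianMetric E B) (σ : ℝ) (pr : P → B) (A : ConnectionForm F P)
    (nabla : CovariantDerivative 𝓘(ℝ, E) E (fun b : B ↦ TangentSpace 𝓘(ℝ, E) b))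
    (ξ W₁ W₂ : ∀ b : B, TangentSpace 𝓘(ℝ, E) b) (b : B) : TangentSpace 𝓘(ℝ, E) b :=
  transverseDeriv g σ ξ nabla W₁ (fun b ↦ phi g σ pr A b (W₂ b)) b
    - transverseDeriv g σ ξ nabla W₂ (fun b ↦ phi g σ pr A b (W₁ b)) b
    - phi g σ pr A b (mlieBracket 𝓘(ℝ, E) W₁ W₂ b)

namespace ParallelGeometry

variable (H : ParallelGeometry g σ pr A D nabla ξ ε)
include H

lemma cov_horizontalLift_add_smul {U : ∀ b : B, TangentSpace 𝓘(ℝ, E) b} {f : B → ℝ} {p : P}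
    (hU : CMDiff ∞ (T% U)) (hf : MDiffAt f (pr p)) (w : TangentSpace 𝓘(ℝ, F) p) :
    D (fun q ↦ horizontalLift pr A U q + (σ * ε q * f (pr q)) • rField pr A ξ ε q) p w =
      D (horizontalLift pr A U) p w
        + (σ * ε p * mvfderiv 𝓘(ℝ, E) f (pr p) (mfderiv 𝓘(ℝ, F) 𝓘(ℝ, E) pr p w)) •
          rField pr A ξ ε p := by
  have hd := H.mvfderiv_sign_mul hf σ w
  have hr := mdifferentiableAt_of_contMDiff H.contMDiff_rField p
  rw [cov_add D (Y := fun q ↦ (σ * ε q * f (pr q)) • rField pr A ξ ε q)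
    (mdifferentiableAt_horizontalLift H.bundle A (mdifferentiableAt_of_contMDiff hU _))
    (hd.1.smul_section hr), add_apply, cov_smul D hd.1 hr, hd.2, H.cov_rField, smul_zero, zero_add]

/-- Since `r` is parallel and `ε` locally constant, only the function `g(φ W₂, Y)` is
differentiated, by metricity of `∇^𝒟`. The last two of the three resulting terms are together
symmetric in `W₁`, `W₂` and cancel in the curvature. -/
lemma cov_cov_parallelLift {W₁ W₂ Y : ∀ b : B, TangentSpace 𝓘(ℝ, E) b}
    (h₂ : CMDiff ∞ (T% W₂)) (hY : IsTransverseSection g ξ Y) (p : P) :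
    D (fun q ↦ D (horizontalLift pr A Y) q (parallelLift g σ pr A ξ ε W₂ q)) p
        (parallelLift g σ pr A ξ ε W₁ p) =
      horizontalLift pr A (transverseDeriv g σ ξ nabla W₁ (transverseDeriv g σ ξ nabla W₂ Y)) p
        + (σ * ε p *
          (g.val (pr p) (transverseDeriv g σ ξ nabla W₁ (fun b ↦ phi g σ pr A b (W₂ b)) (pr p))
              (Y (pr p))
            + g.val (pr p) (phi g σ pr A (pr p) (W₂ (pr p)))
              (transverseDeriv g σ ξ nabla W₁ Y (pr p))
            + g.val (pr p) (phi g σ pr A (pr p) (W₁ (pr p)))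
              (transverseDeriv g σ ξ nabla W₂ Y (pr p)))) • rField pr A ξ ε p := by
  have hφ := H.phi_transverse h₂
  have hDY := H.transverseDeriv_transverse h₂ hY
  simp only [H.cov_horizontalLift_parallelLift hY]
  rw [H.cov_horizontalLift_add_smul (f := fun b ↦ g.val b (phi g σ pr A b (W₂ b)) (Y b)) hDY.1
    ((PseudoRiemannianMetric.contMDiff_val hφ.1 hY.1 _).mdifferentiableAt (by simp)),
    H.mfderiv_proj_parallelLift, H.metric_transverseDeriv hφ hY,
    H.cov_horizontalLift_parallelLift hDY]
  module

lemma curvature_parallelLift_horizontalLift {W₁ W₂ Y : ∀ b : B, TangentSpace 𝓘(ℝ, E) b}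
    {c₁ c₂ : ℝ} (h₁ : CMDiff ∞ (T% W₁)) (h₂ : CMDiff ∞ (T% W₂))
    (hc₁ : ∀ b, g.val b (ξ b) (W₁ b) = c₁) (hc₂ : ∀ b, g.val b (ξ b) (W₂ b) = c₂)
    (hY : IsTransverseSection g ξ Y) (p : P) :
    curvature D (parallelLift g σ pr A ξ ε W₁) (parallelLift g σ pr A ξ ε W₂)
        (horizontalLift pr A Y) p =
      horizontalLift pr A (transverseCurvature g σ ξ nabla W₁ W₂ Y) p
        + (σ * ε p * g.val (pr p) (extDerivPhi g σ pr A nabla ξ W₁ W₂ (pr p)) (Y (pr p))) •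
          rField pr A ξ ε p := by
  have h : horizontalLift pr A (transverseCurvature g σ ξ nabla W₁ W₂ Y) p =
      horizontalLift pr A (transverseDeriv g σ ξ nabla W₁ (transverseDeriv g σ ξ nabla W₂ Y)) p
      - horizontalLift pr A (transverseDeriv g σ ξ nabla W₂ (transverseDeriv g σ ξ nabla W₁ Y)) p
      - horizontalLift pr A (transverseDeriv g σ ξ nabla (mlieBracket 𝓘(ℝ, E) W₁ W₂) Y) p := by
    rw [← horizontalLift_sub H.bundle, ← horizontalLift_sub H.bundle]
    rfl
  rw [curvature, H.mlieBracket_parallelLift h₁ h₂ hc₁ hc₂, H.cov_cov_parallelLift h₂ hY,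
    H.cov_cov_parallelLift h₁ hY, H.cov_horizontalLift_parallelLift hY, h, extDerivPhi]
  simp only [map_sub, sub_apply]
  module

lemma curvature_parallelLift_fundamentalField {W₁ W₂ : ∀ b : B, TangentSpace 𝓘(ℝ, E) b}
    {c₁ c₂ : ℝ} (h₁ : CMDiff ∞ (T% W₁)) (h₂ : CMDiff ∞ (T% W₂))
    (hc₁ : ∀ b, g.val b (ξ b) (W₁ b) = c₁) (hc₂ : ∀ b, g.val b (ξ b) (W₂ b) = c₂) (p : P) :
    curvature D (parallelLift g σ pr A ξ ε W₁) (parallelLift g σ pr A ξ ε W₂)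
        (fundamentalField F) p =
      horizontalLift pr A (extDerivPhi g σ pr A nabla ξ W₁ W₂) p := by
  have h : horizontalLift pr A (extDerivPhi g σ pr A nabla ξ W₁ W₂) p =
      horizontalLift pr A (transverseDeriv g σ ξ nabla W₁ (fun b ↦ phi g σ pr A b (W₂ b))) p
      - horizontalLift pr A (transverseDeriv g σ ξ nabla W₂ (fun b ↦ phi g σ pr A b (W₁ b))) p
      - horizontalLift pr A (fun b ↦ phi g σ pr A b (mlieBracket 𝓘(ℝ, E) W₁ W₂ b)) p := by
    rw [← horizontalLift_sub H.bundle, ← horizontalLift_sub H.bundle]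
    rfl
  rw [curvature, H.mlieBracket_parallelLift h₁ h₂ hc₁ hc₂]
  simp only [H.cov_fundamentalField_parallelLift]
  rw [H.cov_horizontalLift_parallelLift (H.phi_transverse h₂),
    H.cov_horizontalLift_parallelLift (H.phi_transverse h₁), h,
    -- The `r`-components `g(φ W₁, φ W₂)` and `g(φ W₂, φ W₁)` cancel by symmetry.
    g.symm _ (phi g σ pr A (pr p) (W₁ (pr p)))]
  abel

lemma curvature_fundamentalField_horizontalLift {W Y : ∀ b : B, TangentSpace 𝓘(ℝ, E) b} {c : ℝ}
    (hW : CMDiff ∞ (T% W)) (hc : ∀ b, g.val b (ξ b) (W b) = c) (hY : IsTransverseSection g ξ Y)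
    (p : P) :
    curvature D (parallelLift g σ pr A ξ ε W) (fundamentalField F) (horizontalLift pr A Y) p =
      horizontalLift pr A (transverseDerivEnd g σ ξ nabla (phi g σ pr A) W Y) p
        + (σ * ε p * g.val (pr p) (phi g σ pr A (pr p) (W (pr p)))
          (phi g σ pr A (pr p) (Y (pr p)))) • rField pr A ξ ε p := by
  have h : horizontalLift pr A (transverseDerivEnd g σ ξ nabla (phi g σ pr A) W Y) p =
      horizontalLift pr A (transverseDeriv g σ ξ nabla W (fun b ↦ phi g σ pr A b (Y b))) p
      - horizontalLift pr A (fun b ↦ phi g σ pr A b (transverseDeriv g σ ξ nabla W Y b)) p := by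
    rw [← horizontalLift_sub H.bundle]
    rfl
  have hDY := H.transverseDeriv_transverse hW hY
  have h1 (q : P) := cov_horizontalLift_fundamentalField H.bundle H.leviCivita H.sign_ne_zero
    (mdifferentiableAt_of_contMDiff hY.1 (pr q))
  rw [curvature, H.mlieBracket_parallelLift_fundamentalField hW hc, map_zero, sub_zero]
  simp only [h1, H.cov_horizontalLift_parallelLift hY]
  rw [H.cov_horizontalLift_parallelLift (H.phi_transverse hY.1),
    H.cov_horizontalLift_add_smul (f := fun b ↦ g.val b (phi g σ pr A b (W b)) (Y b)) hDY.1
    ((PseudoRiemannianMetric.contMDiff_val (H.phi_transverse hW).1 hY.1 _).mdifferentiableAt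
      (by simp)), H.bundle.mfderiv_proj_fundamentalField,
    cov_horizontalLift_fundamentalField H.bundle H.leviCivita H.sign_ne_zero
    (mdifferentiableAt_of_contMDiff hDY.1 _), h, map_zero, mul_zero, zero_smul, add_zero]
  abel

lemma curvature_fundamentalField_fundamentalField {W : ∀ b : B, TangentSpace 𝓘(ℝ, E) b} {c : ℝ}
    (hW : CMDiff ∞ (T% W)) (hc : ∀ b, g.val b (ξ b) (W b) = c) (p : P) :
    curvature D (parallelLift g σ pr A ξ ε W) (fundamentalField F) (fundamentalField F) p =
      -horizontalLift pr A (fun b ↦ phi g σ pr A b (phi g σ pr A b (W b))) p := by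
  rw [curvature, H.mlieBracket_parallelLift_fundamentalField hW hc, map_zero, sub_zero]
  simp only [H.cov_fundamentalField_parallelLift,
    cov_fundamentalField_fundamentalField H.bundle H.leviCivita H.sign_ne_zero]
  rw [cov_zero, cov_horizontalLift_fundamentalField H.bundle H.leviCivita H.sign_ne_zero
    (mdifferentiableAt_of_contMDiff (H.phi_transverse hW).1 _), zero_sub]

lemma curvature_rField (U V : ∀ p : P, TangentSpace 𝓘(ℝ, F) p) (p : P) :
    curvature D U V (rField pr A ξ ε) p = 0 := by
  simp only [curvature, H.cov_rField, cov_zero, sub_zero]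

/-- Here `r̃ = r - 2 ε v` with `r` parallel and `ε` locally constant. -/
lemma curvature_rTildeField {U V : ∀ p : P, TangentSpace 𝓘(ℝ, F) p} (hU : CMDiff ∞ (T% U))
    (hV : CMDiff ∞ (T% V)) (p : P) :
    curvature D U V (rTildeField pr A ξ ε) p =
      -(2 * ε p) • curvature D U V (fundamentalField F) p := by
  have hε (q : P) := H.mvfderiv_sign_mul (f := fun _ ↦ 1) (p := q) mdifferentiableAt_const (-2)
  simp only [mul_one, mvfderiv_const, zero_apply, mul_zero] at hε
  have hs (Z : ∀ p : P, TangentSpace 𝓘(ℝ, F) p) (hZ : CMDiff ∞ (T% Z)) (q : P)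
      (w : TangentSpace 𝓘(ℝ, F) q) :
      D (fun q ↦ (-2 * ε q) • Z q) q w = (-2 * ε q) • D Z q w := by
    rw [cov_smul D (hε q w).1 (mdifferentiableAt_of_contMDiff hZ q), (hε q w).2, zero_smul, add_zero]
  have hv := H.bundle.contMDiff_fundamentalField
  have hcov (q : P) (w : TangentSpace 𝓘(ℝ, F) q) :
      D (rTildeField pr A ξ ε) q w = (-2 * ε q) • D (fundamentalField F) q w := by
    have h : rTildeField pr A ξ ε = fun q ↦ rField pr A ξ ε q
        + (-2 * ε q) • fundamentalField F q := by
      ext1 q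
      rw [rTildeField, rField]
      module
    rw [h, cov_add D (Y := fun q ↦ (-2 * ε q) • fundamentalField F q)
      (mdifferentiableAt_of_contMDiff H.contMDiff_rField q)
      ((hε q w).1.smul_section (mdifferentiableAt_of_contMDiff hv q)), add_apply, H.cov_rField,
      zero_add, hs _ hv]
  simp only [curvature, hcov]
  rw [hs _ (cov_contMDiff D H.leviCivita.smooth hv hV),
    hs _ (cov_contMDiff D H.leviCivita.smooth hv hU)]
  module

/-! ### The closedness of the curvature form -/

lemma transverseDeriv_field {Y : ∀ b : B, TangentSpace 𝓘(ℝ, E) b}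
    (hY : IsTransverseSection g ξ Y) :
    transverseDeriv g σ ξ nabla ξ Y = mlieBracket 𝓘(ℝ, E) ξ Y := by
  ext1 b
  obtain ⟨p, rfl⟩ := H.bundle.surjective b
  rw [H.transverseDeriv_eq hY, ← H.leviCivita_base.torsion_free _ _ _
    (mdifferentiableAt_of_contMDiff H.contMDiff_field _) (mdifferentiableAt_of_contMDiff hY.1 _),
    H.metric_self, H.phi_apply, H.cov_apply, mul_right_comm, H.sign_mul_self]
  simp

lemma mlieBracket_field_transverse {Y : ∀ b : B, TangentSpace 𝓘(ℝ, E) b}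
    (hY : IsTransverseSection g ξ Y) : IsTransverseSection g ξ (mlieBracket 𝓘(ℝ, E) ξ Y) := by
  rw [← H.transverseDeriv_field hY]
  exact H.transverseDeriv_transverse H.contMDiff_field hY

/-- The Lie derivative of `φ` along `ξ` vanishes. -/
lemma mvfderiv_metric_phi_field {X Y : ∀ b : B, TangentSpace 𝓘(ℝ, E) b}
    (hX : IsTransverseSection g ξ X) (hY : IsTransverseSection g ξ Y) (p : P) :
    mvfderiv 𝓘(ℝ, E) (fun b ↦ g.val b (phi g σ pr A b (X b)) (Y b)) (pr p) (ξ (pr p)) =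
      g.val (pr p) (phi g σ pr A (pr p) (mlieBracket 𝓘(ℝ, E) ξ X (pr p))) (Y (pr p))
        + g.val (pr p) (phi g σ pr A (pr p) (X (pr p))) (mlieBracket 𝓘(ℝ, E) ξ Y (pr p)) := by
  have hlift {X : ∀ b : B, TangentSpace 𝓘(ℝ, E) b} (hX : IsTransverseSection g ξ X) :
      mlieBracket 𝓘(ℝ, F) (rField pr A ξ ε) (horizontalLift pr A X) =
        horizontalLift pr A (mlieBracket 𝓘(ℝ, E) ξ X) := by
    ext1 q
    rw [← H.parallelLift_self, ← parallelLift_of_orthogonal (A := A) (σ := σ) (ε := ε) hX.2,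
      H.mlieBracket_parallelLift H.contMDiff_field hX.1 H.metric_self hX.2,
      parallelLift_of_orthogonal (H.mlieBracket_field_transverse hX).2]
  set f : B → ℝ := fun b ↦ g.val b (phi g σ pr A b (X b)) (Y b) with hf
  have hfd : MDiffAt f (pr p) :=
    (PseudoRiemannianMetric.contMDiff_val (H.phi_transverse hX.1).1 hY.1 _).mdifferentiableAt
      (by simp)
  have hfd' : MDiffAt (fun q ↦ f (pr q)) p :=
    hfd.comp p (H.bundle.contMDiff_proj.mdifferentiableAt (by simp))
  have hfc : MDiffAt (fun q ↦ 2 * σ * f (pr q)) p := mdifferentiableAt_const.mul hfd'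
  have hXY : mlieBracket 𝓘(ℝ, F) (horizontalLift pr A X) (horizontalLift pr A Y) = fun q ↦
      horizontalLift pr A (mlieBracket 𝓘(ℝ, E) X Y) q
        + (2 * σ * f (pr q)) • fundamentalField F q := by
    ext1 q
    rw [mlieBracket_horizontalLift H.bundle A (mdifferentiableAt_of_contMDiff hX.1 _)
      (mdifferentiableAt_of_contMDiff hY.1 _), H.re_mlieBracket_horizontalLift
      (mdifferentiableAt_of_contMDiff hX.1 _) (mdifferentiableAt_of_contMDiff hY.1 _)]
  have hξ := mdifferentiableAt_of_contMDiff H.contMDiff_field (pr p)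
  have h2 : minSmoothness ℝ 2 ≤ (∞ : WithTop ℕ∞) := by
    rw [minSmoothness_of_isRCLikeNormedField]
    exact ENat.LEInfty.out
  have h3 : minSmoothness ℝ 3 ≤ (∞ : WithTop ℕ∞) := by
    rw [minSmoothness_of_isRCLikeNormedField]
    exact ENat.LEInfty.out
  have : IsManifold 𝓘(ℝ, F) (minSmoothness ℝ 3) P := IsManifold.of_le (n := ∞) h3
  have J := leibniz_identity_mlieBracket_apply (I := 𝓘(ℝ, F))
    ((H.contMDiff_rField p).of_le h2)
    ((contMDiff_horizontalLift H.bundle A hX.1 p).of_le h2)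
    ((contMDiff_horizontalLift H.bundle A hY.1 p).of_le h2)
  rw [hlift hX, hlift hY, hXY, show rField pr A ξ ε = fun q ↦ horizontalLift pr A ξ q
    + ε q • fundamentalField F q from rfl, mlieBracket_lift_add_smul H.bundle hξ
    (mdifferentiableAt_of_contMDiff (H.contMDiff_mlieBracket hX.1 hY.1) _)
    (H.mdifferentiableAt_sign p) hfc, H.mvfderiv_sign,
    mvfderiv_const_mul' _ hfd', mvfderiv_comp_proj H.bundle hfd] at J
  replace J := congrArg (A.re p) J
  simp only [map_add, map_smul, mfderiv_proj_horizontalLift H.bundle,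
    H.bundle.mfderiv_proj_fundamentalField, smul_zero, add_zero, sub_zero,
    A.re_fundamentalField, smul_eq_mul, mul_one] at J
  rw [H.re_mlieBracket_horizontalLift hξ
      (mdifferentiableAt_of_contMDiff (H.contMDiff_mlieBracket hX.1 hY.1) _),
    H.re_mlieBracket_horizontalLift
      (mdifferentiableAt_of_contMDiff (H.mlieBracket_field_transverse hX).1 _)
      (mdifferentiableAt_of_contMDiff hY.1 _),
    H.re_mlieBracket_horizontalLift (mdifferentiableAt_of_contMDiff hX.1 _)
      (mdifferentiableAt_of_contMDiff (H.mlieBracket_field_transverse hY).1 _), H.phi_apply,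
      map_zero, zero_apply, mul_zero, zero_add, ← mul_add, mul_right_inj'
      (mul_ne_zero two_ne_zero H.sign_ne_zero)] at J
  exact J

lemma eq_zero_of_metric_transverse [T2Space B] {b : B} {u : TangentSpace 𝓘(ℝ, E) b}
    (h : g.val b u (ξ b) = 0)
    (hu : ∀ Y, IsTransverseSection g ξ Y → g.val b u (Y b) = 0) : u = 0 := by
  apply g.nondegenerate
  intro w
  obtain ⟨W, hW, rfl⟩ := exists_contMDiff_field b w
  have h1 := hu _ (H.transverseProj_transverse hW)
  rwa [transverseProj, map_sub, map_smul, h, smul_zero, sub_zero] at h1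

/-- Since `φ ξ = 0`, what remains is `∇^𝒟_ξ (φ X) - φ [ξ, X]`. Tested against a section `Y` of `𝒟`,
it vanishes by comparing metricity of `∇^𝒟` along `ξ`, where `∇^𝒟_ξ = [ξ, ·]`, with the invariance
of `g(φ ·, ·)` along `ξ`. -/
lemma extDerivPhi_field [T2Space B] {X : ∀ b : B, TangentSpace 𝓘(ℝ, E) b}
    (hX : IsTransverseSection g ξ X) : extDerivPhi g σ pr A nabla ξ ξ X = fun _ ↦ 0 := by
  ext1 b
  have h0 : (fun b ↦ phi g σ pr A b (ξ b)) = fun _ ↦ 0 := funext H.phi_apply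
  have hz : IsTransverseSection g ξ (fun b ↦ phi g σ pr A b (ξ b)) :=
    H.phi_transverse H.contMDiff_field
  have e : extDerivPhi g σ pr A nabla ξ ξ X b =
      transverseDeriv g σ ξ nabla ξ (fun b ↦ phi g σ pr A b (X b)) b
        - phi g σ pr A b (mlieBracket 𝓘(ℝ, E) ξ X b) := by
    obtain ⟨p, rfl⟩ := H.bundle.surjective b
    rw [extDerivPhi, H.transverseDeriv_eq hz, h0, cov_zero]
    simp [H.phi_apply]
  rw [e]
  apply H.eq_zero_of_metric_transverse
  · rw [map_sub, sub_apply, H.metric_phi_field, g.symm,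
      (H.transverseDeriv_transverse H.contMDiff_field (H.phi_transverse hX.1)).2, sub_zero]
  · intro Y hY
    have h1 := H.metric_transverseDeriv (H.phi_transverse hX.1) hY ξ b
    obtain ⟨p, rfl⟩ := H.bundle.surjective b
    rw [H.mvfderiv_metric_phi_field hX hY, H.transverseDeriv_field hY] at h1
    rw [map_sub, sub_apply]
    linarith

lemma transverseDerivEnd_field [T2Space B] {Y : ∀ b : B, TangentSpace 𝓘(ℝ, E) b}
    (hY : IsTransverseSection g ξ Y) (b : B) :
    transverseDerivEnd g σ ξ nabla (phi g σ pr A) ξ Y b = 0 := by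
  have h0 : (fun b ↦ phi g σ pr A b (ξ b)) = fun _ ↦ 0 := funext H.phi_apply
  have h := congrFun (H.extDerivPhi_field hY) b
  obtain ⟨p, rfl⟩ := H.bundle.surjective b
  rw [extDerivPhi, H.transverseDeriv_eq (H.phi_transverse H.contMDiff_field) Y, h0, cov_zero] at h
  simp only [H.phi_apply] at h
  rw [transverseDerivEnd, H.transverseDeriv_field hY]
  simpa using h

/-- On `𝒟` the torsion of `∇^𝒟` is a multiple of `ξ`, which `φ` annihilates. -/
lemma extDerivPhi_eq {X Y : ∀ b : B, TangentSpace 𝓘(ℝ, E) b} (hX : IsTransverseSection g ξ X)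
    (hY : IsTransverseSection g ξ Y) (b : B) :
    extDerivPhi g σ pr A nabla ξ X Y b = transverseDerivEnd g σ ξ nabla (phi g σ pr A) X Y b
      - transverseDerivEnd g σ ξ nabla (phi g σ pr A) Y X b := by
  obtain ⟨p, rfl⟩ := H.bundle.surjective b
  rw [extDerivPhi, transverseDerivEnd, transverseDerivEnd, H.transverseDeriv_eq hX,
    H.transverseDeriv_eq hY, ← H.leviCivita_base.torsion_free _ _ _
    (mdifferentiableAt_of_contMDiff hX.1 _) (mdifferentiableAt_of_contMDiff hY.1 _), hX.2, hY.2]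
  simp only [map_sub, map_add, map_smul, H.phi_apply]
  module

lemma curvature_rField_fundamentalField [T2Space B] [T2Space P]
    {W : ∀ p : P, TangentSpace 𝓘(ℝ, F) p} (hW : CMDiff ∞ (T% W)) (p : P) :
    curvature D (rField pr A ξ ε) (fundamentalField F) W p = 0 := by
  have hv := H.bundle.contMDiff_fundamentalField
  -- By skew-adjointness, `R(r, v) W` is orthogonal to every `Z` killed by `R(r, v)`. Testing with
  -- `v`, `r` and the lifts of sections of `𝒟`, which span, proves the vanishing for arbitrary `W`
  -- without a tensoriality argument.
  have key {Z : ∀ p : P, TangentSpace 𝓘(ℝ, F) p} (hZ : CMDiff ∞ (T% Z))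
      (h : curvature D (rField pr A ξ ε) (fundamentalField F) Z p = 0) :
      kaluzaKleinMetric g σ pr A p
        (curvature D (rField pr A ξ ε) (fundamentalField F) W p) (Z p) = 0 := by
    rw [H.leviCivita.curvature_skew kaluzaKleinMetric_symm kaluzaKleinMetric_sub
      (fun _ _ ↦ contMDiff_kaluzaKleinMetric H.bundle) H.contMDiff_rField hv hW hZ, h,
      kaluzaKleinMetric_apply, map_zero, map_zero]
    simp
  set u := curvature D (rField pr A ξ ε) (fundamentalField F) W p
  have h1 : A.re p u = 0 := by
    have h := key hv (by
      rw [← H.parallelLift_self, H.curvature_fundamentalField_fundamentalField H.contMDiff_field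
        H.metric_self, neg_eq_zero, ← horizontalLift_zero H.bundle A p]
      exact horizontalLift_congr H.bundle A (by rw [H.phi_apply, map_zero]))
    rw [kaluzaKleinMetric_fundamentalField H.bundle, neg_eq_zero, mul_eq_zero] at h
    exact h.resolve_left H.sign_ne_zero
  apply ext_of_proj_of_re H.bundle A _ (by rw [h1, map_zero])
  rw [map_zero]
  apply H.eq_zero_of_metric_transverse
  · have h := key H.contMDiff_rField (H.curvature_rField _ _ p)
    rw [kaluzaKleinMetric_apply, h1, zero_mul, mul_zero, sub_zero, rField, map_add, map_smul,
      H.bundle.mfderiv_proj_fundamentalField, mfderiv_proj_horizontalLift H.bundle, smul_zero,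
      add_zero] at h
    exact h
  · intro Y hY
    have h := key (contMDiff_horizontalLift H.bundle A hY.1) (by
      rw [← H.parallelLift_self, H.curvature_fundamentalField_horizontalLift H.contMDiff_field
        H.metric_self hY, H.phi_apply, map_zero, zero_apply, mul_zero, zero_smul, add_zero,
        ← horizontalLift_zero H.bundle A p]
      exact horizontalLift_congr H.bundle A (H.transverseDerivEnd_field hY _))
    rwa [kaluzaKleinMetric_horizontalLift H.bundle] at h

end ParallelGeometry
end Curvature

end KaluzaKlein

end

theorem mainTheorem6
    {E : Type*} [NormedAddCommGroup E] [NormedSpace ℝ E] [FiniteDimensional ℝ E]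
    {B : Type*} [TopologicalSpace B] [T2Space B] [ChartedSpace E B] [IsManifold 𝓘(ℝ, E) ∞ B]
    {F : Type*} [NormedAddCommGroup F] [NormedSpace ℝ F] [FiniteDimensional ℝ F]
    {P : Type*} [TopologicalSpace P] [T2Space P] [ChartedSpace F P] [IsManifold 𝓘(ℝ, F) ∞ P]
    [MulAction Circle P]
    -- the pseudo-Riemannian base and its Levi-Civita connection
    (g : PseudoRiemannianMetric E B)
    (nabla : CovariantDerivative 𝓘(ℝ, E) E (fun b : B ↦ TangentSpace 𝓘(ℝ, E) b))
    (hnabla : IsLeviCivita (fun b u w ↦ g.val b u w) nabla)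
    -- the principal circle bundle with connection form, and the Levi-Civita connection of the
    -- Kaluza-Klein metric
    (σ : ℝ) (hσ : σ = 1 ∨ σ = -1)
    (pr : P → B) (hpr : IsPrincipalCircleBundle E F pr)
    (A : ConnectionForm F P)
    (D : CovariantDerivative 𝓘(ℝ, F) F (fun p : P ↦ TangentSpace 𝓘(ℝ, F) p))
    (hD : IsLeviCivita (kaluzaKleinMetric g σ pr A) D)
    (ξ : ∀ b : B, TangentSpace 𝓘(ℝ, E) b) (hξ : CMDiff ∞ (T% ξ))
    (hξσ : ∀ b, g.val b (ξ b) (ξ b) = σ)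
    (ε : P → ℝ)
    (hyp : HasRecurrentField g σ pr A D ξ ε ∨ IsKillingTwistOfFlat g σ pr A ξ ε) :
    let R := curvature D
    let r := rField pr A ξ ε
    let rt := rTildeField pr A ξ ε
    let v : ∀ p : P, TangentSpace 𝓘(ℝ, F) p := fundamentalField F
    let lift := horizontalLift (E := E) pr A
    let φ := phi g σ pr A
    let RD := transverseCurvature g σ ξ nabla
    let Dφ := transverseDerivEnd g σ ξ nabla φ
    (∀ U V : ∀ p : P, TangentSpace 𝓘(ℝ, F) p, CMDiff ∞ (T% U) → CMDiff ∞ (T% V) →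
      ∀ p, R U V r p = 0) ∧
    (∀ W : ∀ p : P, TangentSpace 𝓘(ℝ, F) p, CMDiff ∞ (T% W) → ∀ p, R r v W p = 0) ∧
    (∀ X Y Z : ∀ b : B, TangentSpace 𝓘(ℝ, E) b,
      IsTransverseSection g ξ X → IsTransverseSection g ξ Y → IsTransverseSection g ξ Z →
      ∀ p : P,
        R r (lift X) (lift Y) p = lift (RD ξ X Y) p ∧
        R r (lift X) rt p = 0 ∧
        R (lift X) (lift Y) (lift Z) p =
          lift (RD X Y Z) p
            + (σ * ε p * g.val (pr p) (Dφ X Y (pr p) - Dφ Y X (pr p)) (Z (pr p))) • r p ∧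
        R (lift X) (lift Y) rt p = -(2 * ε p) • lift (fun b ↦ Dφ X Y b - Dφ Y X b) p ∧
        R (lift X) v (lift Y) p =
          lift (Dφ X Y) p
            + (ε p * σ * g.val (pr p) (φ (pr p) (X (pr p))) (φ (pr p) (Y (pr p)))) • r p ∧
        R (lift X) v rt p = (2 * ε p) • lift (fun b ↦ φ b (φ b (X b))) p) := by
  have S : StructureEquations g σ pr A nabla ξ ε := hyp.elim
    (fun h ↦ h.structureEquations hpr hD hnabla hσ hξ hξσ)
    (fun h ↦ h.structureEquations hpr hD hnabla hσ hξ hξσ)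
  have H : ParallelGeometry g σ pr A D nabla ξ ε := ⟨S, hpr, hD, hnabla, hσ, hξ, hξσ⟩
  intro R r rt v lift φ RD Dφ
  -- Lifts of sections of `𝒟` and `r` are both parallel lifts, with `η` equal to `0` and `σ`
  -- respectively, so each general formula is used with `W₁ = ξ` or with `W₁ = X`.
  have hl {X : ∀ b : B, TangentSpace 𝓘(ℝ, E) b} (hX : IsTransverseSection g ξ X) :
      lift X = parallelLift g σ pr A ξ ε X := (parallelLift_of_orthogonal hX.2).symm
  have hlift {X : ∀ b : B, TangentSpace 𝓘(ℝ, E) b} (hX : IsTransverseSection g ξ X) :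
      CMDiff ∞ (T% (lift X)) := contMDiff_horizontalLift hpr A hX.1
  have hr : r = parallelLift g σ pr A ξ ε ξ := H.parallelLift_self.symm
  have hv : CMDiff ∞ (T% v) := hpr.contMDiff_fundamentalField
  refine ⟨fun U V _ _ p ↦ H.curvature_rField U V p,
    fun W hW p ↦ H.curvature_rField_fundamentalField hW p, fun X Y Z hX hY hZ p ↦
    ⟨?_, ?_, ?_, ?_, ?_, ?_⟩⟩
  · have h := H.curvature_parallelLift_horizontalLift hξ hX.1 hξσ hX.2 hY p
    rw [H.extDerivPhi_field hX, map_zero, zero_apply, mul_zero, zero_smul, add_zero, ← hl hX,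
      ← hr] at h
    exact h
  · have h := H.curvature_parallelLift_fundamentalField hξ hX.1 hξσ hX.2 p
    rw [H.extDerivPhi_field hX, horizontalLift_zero hpr, ← hl hX, ← hr] at h
    refine (H.curvature_rTildeField H.contMDiff_rField (hlift hX) p).trans ?_
    rw [h, smul_zero]
  · have h := H.curvature_parallelLift_horizontalLift hX.1 hY.1 hX.2 hY.2 hZ p
    rw [H.extDerivPhi_eq hX hY, ← hl hX, ← hl hY] at h
    exact h
  · have h := H.curvature_parallelLift_fundamentalField hX.1 hY.1 hX.2 hY.2 p
    rw [funext (H.extDerivPhi_eq hX hY), ← hl hX, ← hl hY] at h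
    refine (H.curvature_rTildeField (hlift hX) (hlift hY) p).trans ?_
    rw [h]
  · have h := H.curvature_fundamentalField_horizontalLift hX.1 hX.2 hY p
    rw [← hl hX, mul_comm σ] at h
    exact h
  · have h := H.curvature_fundamentalField_fundamentalField hX.1 hX.2 p
    rw [← hl hX] at h
    refine (H.curvature_rTildeField (hlift hX) hv p).trans ?_
    rw [h, smul_neg, neg_smul, neg_neg]
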